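/- Let $X$ be (the geometric realization of) a locally finite affine building of positive dimension, equipped with its complete (i.e. maximal) system of apartments: the apartments are Euclidean Coxeter complexes, whose Coxeter group is an affine reflection group (discrete, cocompact, possibly reducible). Half apartments are the closed halves into which walls divide apartments; $-\alpha$ denotes the half apartment complementary to $\alpha$ in a given apartment. Automorphisms of $X$ are type-preserving. Suppose that $X$ is Moufang, i.e. there are an apartment $\Sigma$ of $X$ and groups $U_\alpha$ of automorphisms of $X$, one for each half apartment $\alpha\subseteq\Sigma$, such that: 1. $U_\alpha$ fixes every chamber in $\alpha$, and for each panel $\pi\subseteq\partial\alpha$ it acts simply transitively on the set of those chambers containing $\pi$ that do not lie in $\alpha$; 2. if $\alpha\ne\beta$ are prenilpotent, i.e. each of $\alpha\cap\beta$ and $(-\alpha)\cap(-\beta)$ contains a chamber, then $[U_\alpha,U_\beta]$ is contained in the group generated by all $U_\gamma$ with $\gamma\notin\{\alpha,\beta\}$, $\alpha\cap\beta\subseteq\gamma$ and $(-\alpha)\cap(-\beta)\subseteq-\gamma$; 3. for each $u\in U_\alpha\setminus\{1\}$ there is an element $n\in U_{-\alpha}\,u\,U_{-\alpha}$ with $n\Sigma=\Sigma$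 and $nU_\beta n^{-1}=U_{n\beta}$ for all half apartments $\beta\subseteq\Sigma$. Let $C$ be a chamber at infinity of $X$, i.e. a class of sectors, two sectors being in the same class if their intersection contains a sector; a subset of $X$ is said to contain $C$ if it contains a sector belonging to $C$. Then there is an infinite sequence $(A_i)_{i\in\mathbb N}$ of apartments of $X$ with $\bigcup_{i} A_i=X$ that is directed with respect to $C$: for each $j$, the closed set $$\overline{A_j\setminus\bigcup_{i<j}A_i}$$ is an intersection of half apartments of $A_j$ that do not contain $C$ (the family of half apartments may be empty, in which case the intersection is $A_j$, or infinite). -/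

import Mathlib

open Set
open scoped RealInnerProductSpace

section Model

variable {E : Type*} [NormedAddCommGroup E] [InnerProductSpace ℝ E]

/-- An affine Weyl group: a discrete, cocompact group of isometries of a Euclidean space that is
generated by the hyperplane reflections it contains (a reflection is written
`x ↦ x - 2 (⟪v, x⟫ - c) v` with `v` a unit vector). Products of irreducible groups are allowed. -/
structure IsAffineWeylGroup (W : Subgroup (E ≃ᵃⁱ[ℝ] E)) : Prop where
  generated : W = Subgroup.closure
    {r | r ∈ W ∧ ∃ (v : E) (c : ℝ), ‖v‖ = 1 ∧ ∀ x : E, r x = x - (2 * (⟪v, x⟫ - c)) • v}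
  discrete : ∀ R : ℝ, {w : E ≃ᵃⁱ[ℝ] E | w ∈ W ∧ ‖w 0‖ ≤ R}.Finite
  cocompact : ∃ R : ℝ, ∀ x : E, ∃ w ∈ W, dist x (w 0) ≤ R

/-- An affine root of `W`, i.e. one of the two closed half spaces `{x | level ≤ ⟪normal, x⟫}`
bounded by the fixed hyperplane of a reflection in `W`. -/
@[ext]
structure AffineRoot (W : Subgroup (E ≃ᵃⁱ[ℝ] E)) where
  normal : E
  level : ℝ
  norm_normal : ‖normal‖ = 1
  reflection_mem : ∃ r ∈ W, ∀ x : E, r x = x - (2 * (⟪normal, x⟫ - level)) • normal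

namespace AffineRoot

variable {W : Subgroup (E ≃ᵃⁱ[ℝ] E)}

/-- The closed half space of a root. -/
def half (a : AffineRoot W) : Set E := {x | a.level ≤ ⟪a.normal, x⟫}

/-- The wall bounding the half space. -/
def wall (a : AffineRoot W) : Set E := {x | ⟪a.normal, x⟫ = a.level}

/-- The complementary root `-α`. -/
def opp (a : AffineRoot W) : AffineRoot W where
  normal := -a.normal
  level := -a.level
  norm_normal := by rw [norm_neg]; exact a.norm_normal
  reflection_mem := by
    obtain ⟨r, hr, h⟩ := a.reflection_mem
    refine ⟨r, hr, fun x => ?_⟩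
    rw [h x, inner_neg_left, smul_neg, ← neg_smul]
    congr 2
    ring

end AffineRoot

/-- The closed chambers of the Coxeter complex of `W`: for a point `x` on no wall, the intersection
of all the half spaces that contain `x`. -/
def modelChambers (W : Subgroup (E ≃ᵃⁱ[ℝ] E)) : Set (Set E) :=
  {D | ∃ x : E, (∀ a : AffineRoot W, x ∉ a.wall) ∧
    D = {y | ∀ a : AffineRoot W, x ∈ a.half → y ∈ a.half}}

/-- The (closed) panels of the Coxeter complex of `W`: the codimension one faces of chambers. -/
def modelPanels (W : Subgroup (E ≃ᵃⁱ[ℝ] E)) : Set (Set E) :=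
  {P | P.Nonempty ∧ Module.finrank ℝ (vectorSpan ℝ P) + 1 = Module.finrank ℝ E ∧
    ∃ D ∈ modelChambers W, ∃ a : AffineRoot W, P = D ∩ a.wall}

/-- The sectors of the Coxeter complex of `W`: translates `x + K` of the closed Weyl chambers `K` of
the finite linear part of `W`; `K` is given by a vector `ξ` in its interior. -/
def modelSectors (W : Subgroup (E ≃ᵃⁱ[ℝ] E)) : Set (Set E) :=
  {S | ∃ x ξ : E, (∀ a : AffineRoot W, ⟪a.normal, ξ⟫ ≠ 0) ∧
    S = {y | ∀ a : AffineRoot W, 0 < ⟪a.normal, ξ⟫ → 0 ≤ ⟪a.normal, y - x⟫}}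

namespace AffineRoot

variable {W : Subgroup (E ≃ᵃⁱ[ℝ] E)}

/-- Prenilpotent pairs of roots. -/
def Prenilpotent (a b : AffineRoot W) : Prop :=
  (∃ D ∈ modelChambers W, D ⊆ a.half ∩ b.half) ∧
  (∃ D ∈ modelChambers W, D ⊆ a.opp.half ∩ b.opp.half)

/-- The open interval `(α, β)` of roots. -/
def between (a b : AffineRoot W) : Set (AffineRoot W) :=
  {g | a.half ∩ b.half ⊆ g.half ∧ a.opp.half ∩ b.opp.half ⊆ g.opp.half} \ {a, b}

end AffineRoot

end Model

/-- The geometric realization `X` of an affine building of type `W`, with a system of apartments: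
the charts are the type-preserving identifications of the Coxeter complex of `W` with the
apartments. Any two chambers lie in a common apartment, and two apartments with a common chamber
are isomorphic by an isomorphism that fixes their intersection pointwise. -/
structure AffineBuilding {E : Type*} [NormedAddCommGroup E] [InnerProductSpace ℝ E]
    (W : Subgroup (E ≃ᵃⁱ[ℝ] E)) (X : Type*) where
  charts : Set (E → X)
  injective : ∀ f ∈ charts, Function.Injective f
  comp_mem : ∀ f ∈ charts, ∀ w ∈ W, f ∘ w ∈ charts
  cover : ∀ p : X, ∃ f ∈ charts, p ∈ range f
  common_apartment : ∀ f ∈ charts, ∀ g ∈ charts, ∀ D ∈ modelChambers W, ∀ D' ∈ modelChambers W,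
    ∃ h ∈ charts, f '' D ⊆ range h ∧ g '' D' ⊆ range h
  compatible : ∀ f ∈ charts, ∀ g ∈ charts, (∃ D ∈ modelChambers W, f '' D ⊆ range g) →
    ∃ w ∈ W, ∀ x : E, f x ∈ range g → f x = g (w x)

namespace AffineBuilding

variable {E : Type*} [NormedAddCommGroup E] [InnerProductSpace ℝ E]
  {W : Subgroup (E ≃ᵃⁱ[ℝ] E)} {X : Type*}

/-- The system of apartments is the complete one, i.e. it is maximal. -/
def IsComplete (B : AffineBuilding W X) : Prop :=
  ∀ B' : AffineBuilding W X, B.charts ⊆ B'.charts → B'.charts = B.charts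

/-- The weak topology with respect to the apartments (equivalently, to the closed cells). -/
abbrev topology (B : AffineBuilding W X) : TopologicalSpace X :=
  ⨆ f ∈ B.charts, TopologicalSpace.coinduced f inferInstance

/-- Closure of a subset of the building. -/
def closure (B : AffineBuilding W X) (s : Set X) : Set X := @_root_.closure X B.topology s

/-- Apartments, as subsets of the building. -/
def apartments (B : AffineBuilding W X) : Set (Set X) :=
  {A | ∃ f ∈ B.charts, A = range f}

/-- Half apartments of the apartment `A`. -/
def halfApartments (B : AffineBuilding W X) (A : Set X) : Set (Set X) :=
  {H | ∃ f ∈ B.charts, range f = A ∧ ∃ a : AffineRoot W, H = f '' a.half}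

/-- Closed chambers of the building. -/
def chambers (B : AffineBuilding W X) : Set (Set X) :=
  {c | ∃ f ∈ B.charts, ∃ D ∈ modelChambers W, c = f '' D}

/-- Every point lies in only finitely many closed chambers. -/
def IsLocallyFinite (B : AffineBuilding W X) : Prop :=
  ∀ p : X, {c | c ∈ B.chambers ∧ p ∈ c}.Finite

/-- Sectors of the building. -/
def sectors (B : AffineBuilding W X) : Set (Set X) :=
  {T | ∃ f ∈ B.charts, ∃ S ∈ modelSectors W, T = f '' S}

/-- Chambers at infinity: classes of sectors, where two sectors are in the same class if and only
if their intersection contains a sector. -/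
def chambersAtInfinity (B : AffineBuilding W X) : Set (Set (Set X)) :=
  {C | ∃ S ∈ B.sectors, C = {T | T ∈ B.sectors ∧ ∃ R ∈ B.sectors, R ⊆ S ∩ T}}

/-- The subset `Y` of the building (an apartment or a half apartment) contains the chamber at
infinity `C`: it contains a sector that represents `C`. -/
def ContainsAtInfinity (Y : Set X) (C : Set (Set X)) : Prop := ∃ T ∈ C, T ⊆ Y

/-- The group of (type-preserving) automorphisms of the building. -/
def autGroup (B : AffineBuilding W X) : Subgroup (Equiv.Perm X) where
  carrier := {g | ∀ f : E → X, g ∘ f ∈ B.charts ↔ f ∈ B.charts}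
  one_mem' := fun _ => Iff.rfl
  mul_mem' := by
    intro g h hg hh f
    have := hg (h ∘ f)
    rw [hh f] at this
    exact this
  inv_mem' := by
    intro g hg f
    have := hg ((g⁻¹ : Equiv.Perm X) ∘ f)
    rw [← this]
    have e : (g : X → X) ∘ ((g⁻¹ : Equiv.Perm X) ∘ f) = f := by
      funext x
      simp
    rw [e]

/-- A system of root groups `U` for the apartment `range f` of the building. Half apartments of
`range f` are indexed by the affine roots of `W`. A type-preserving automorphism that maps a chamber
to itself fixes it pointwise. -/
structure IsRootGroupSystem (B : AffineBuilding W X) (f : E → X)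
    (U : AffineRoot W → Subgroup (Equiv.Perm X)) : Prop where
  le_aut : ∀ a, U a ≤ B.autGroup
  fixes : ∀ a, ∀ u ∈ U a, ∀ x ∈ a.half, u (f x) = f x
  simply_transitive : ∀ a, ∀ P ∈ modelPanels W, P ⊆ a.wall →
    ∀ c ∈ B.chambers, f '' P ⊆ c → ¬ c ⊆ f '' a.half →
    ∀ c' ∈ B.chambers, f '' P ⊆ c' → ¬ c' ⊆ f '' a.half →
      ∃! u : Equiv.Perm X, u ∈ U a ∧ u '' c = c'
  commutator : ∀ a b : AffineRoot W, a ≠ b → a.Prenilpotent b →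
    ⁅U a, U b⁆ ≤ ⨆ g ∈ a.between b, U g
  reflect : ∀ a, ∀ u ∈ U a, u ≠ 1 →
    ∃ v ∈ U a.opp, ∃ v' ∈ U a.opp, ∃ n : Equiv.Perm X, n = v * u * v' ∧
      n '' range f = range f ∧
      ∀ b b' : AffineRoot W, n '' (f '' b.half) = f '' b'.half →
        (U b).map (MulAut.conj n).toMonoidHom = U b'

/-- The Moufang property: some apartment has a system of root groups. -/
def IsMoufang (B : AffineBuilding W X) : Prop :=
  ∃ f ∈ B.charts, ∃ U : AffineRoot W → Subgroup (Equiv.Perm X), B.IsRootGroupSystem f U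

/-- A sequence of apartments is directed with respect to the chamber at infinity `C` if each
`closure (A j \ ⋃ i < j, A i)` is the intersection in `A j` of a (possibly empty or infinite) family
of half apartments of `A j` that do not contain `C`. -/
def IsDirected (B : AffineBuilding W X) (C : Set (Set X)) (A : ℕ → Set X) : Prop :=
  (∀ j, A j ∈ B.apartments) ∧
  ∀ j, ∃ F : Set (Set X),
    (∀ H ∈ F, H ∈ B.halfApartments (A j) ∧ ¬ ContainsAtInfinity H C) ∧
    B.closure (A j \ ⋃ i < j, A i) = A j ∩ ⋂₀ F

end AffineBuilding

/-! Represent $C$ by a sector with chart `f` and direction `ξ`. Only charts are used that agree with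
`f` at all points lying deep for every wall normal positive on `ξ`. Two such charts agree wherever
their images meet, so intersections of apartments become agreement loci. It suffices to order enough
of these charts so that each new one agrees with the earlier ones on a union of half spaces with
normals positive on `ξ` (or everywhere), on each of which it equals a single earlier chart
(`Admissible`). The closed complement is then an intersection of opposite half spaces, and these do
not contain $C$.

Geometry: retractions centred at a chamber do not increase distances, so the agreement locus of two
charts is closed and convex, and if it contains a chamber it is cut out by roots
(`exists_root_separating`). Completeness enters through `exists_chart_extending`: a pairwise
compatible family of chambers lies in one apartment. In particular a half apartment and an adjacent
chamber do. Moving along galleries, every chamber lies in an apartment of the chosen family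
(`exists_chart_chamber`), and there are only countably many chambers.

Induction: the positive normals are ordered by slope and discarded one at a time. Requiring depth
only for the remaining normals gives finer and finer equivalence relations on charts, ending in
equality. When a normal `a` is discarded, a class splits into subclasses. For `g`, `h` in the class,
the `hull` of their agreement locus in direction `a` is a half space or everything, and depends only
on the subclasses. By `exists_exchange` some chart in the subclass of `h` equals `g` on this hull:
fold repeatedly across the boundary of the hull and pass to the limit.

Combinatorics: subclasses are ranked in order of first use. Before a chart `m` is added, each
subclass of lower rank in use receives a chart equal to `m` on the hull; these have lower rank, so
the recursion ends. In this way growth procedures for the subclasses combine to one for the class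
(`IsExchangeSystem.exists_isGrowth`). -/

/-! ### Roots, walls and chambers of the model apartment: local structure. -/

section WeylGeometry

variable {E : Type*} [NormedAddCommGroup E] [InnerProductSpace ℝ E]
  {W : Subgroup (E ≃ᵃⁱ[ℝ] E)}

namespace AffineRoot

/-- The signed distance of a point from the wall of a root. -/
noncomputable def val (a : AffineRoot W) (x : E) : ℝ := ⟪a.normal, x⟫ - a.level

theorem mem_half {a : AffineRoot W} {x : E} : x ∈ a.half ↔ 0 ≤ a.val x := by
  simp [half, val]

theorem mem_wall {a : AffineRoot W} {x : E} : x ∈ a.wall ↔ a.val x = 0 := by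
  simp [wall, val, sub_eq_zero]

@[simp] theorem val_opp (a : AffineRoot W) (x : E) : a.opp.val x = -a.val x := by
  simp [val, opp]; ring

theorem opp_opp (a : AffineRoot W) : a.opp.opp = a := by
  ext <;> simp [opp]

theorem val_add (a : AffineRoot W) (x v : E) : a.val (x + v) = a.val x + ⟪a.normal, v⟫ := by
  simp only [val, inner_add_right]; ring

theorem val_line (a : AffineRoot W) (x y : E) (t : ℝ) :
    a.val (x + t • (y - x)) = (1 - t) * a.val x + t * a.val y := by
  simp only [val, inner_add_right, inner_smul_right, inner_sub_right]; ring

theorem inner_normal_self (a : AffineRoot W) : ⟪a.normal, a.normal⟫ = 1 := by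
  rw [real_inner_self_eq_norm_sq, a.norm_normal]; norm_num

theorem val_add_smul_normal (a : AffineRoot W) (x : E) (t : ℝ) :
    a.val (x + t • a.normal) = a.val x + t := by
  rw [val_add, inner_smul_right, inner_normal_self, mul_one]

theorem abs_inner_normal_le (a : AffineRoot W) (v : E) : |⟪a.normal, v⟫| ≤ ‖v‖ := by
  have := abs_real_inner_le_norm a.normal v
  rwa [a.norm_normal, one_mul] at this

theorem abs_val_sub_le (a : AffineRoot W) (x y : E) : |a.val x - a.val y| ≤ dist x y := by
  have : a.val x - a.val y = ⟪a.normal, x - y⟫ := by simp only [val, inner_sub_right]; ring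
  rw [this, dist_eq_norm]; exact a.abs_inner_normal_le _

theorem continuous_val (a : AffineRoot W) : Continuous a.val := by
  unfold val; fun_prop

theorem isClosed_half (a : AffineRoot W) : IsClosed a.half := by
  have : a.half = a.val ⁻¹' Ici 0 := by ext; simp [mem_half]
  rw [this]; exact isClosed_Ici.preimage a.continuous_val

theorem eq_or_eq_opp_of_wall {a b : AffineRoot W} {s : ℝ} (hn : b.normal = s • a.normal)
    {z : E} (ha : z ∈ a.wall) (hb : z ∈ b.wall) : b = a ∨ b = a.opp := by
  have h1 := b.norm_normal
  rw [hn, norm_smul, a.norm_normal, mul_one, Real.norm_eq_abs] at h1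
  simp only [wall, mem_ofPred_eq] at ha hb
  rcases (abs_eq zero_le_one).1 h1 with rfl | rfl
  · left
    have hn : b.normal = a.normal := by simpa using hn
    ext1
    · exact hn
    · rw [← ha, ← hb, hn]
  · right
    have hn : b.normal = -a.normal := by simpa using hn
    ext1
    · simp [opp, hn]
    · simp [opp, ← ha, ← hb, hn]

theorem eq_or_eq_opp_of_reflection {a b : AffineRoot W}
    (h : ∀ x : E, x - (2 * (⟪a.normal, x⟫ - a.level)) • a.normal =
      x - (2 * (⟪b.normal, x⟫ - b.level)) • b.normal) : b = a ∨ b = a.opp := by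
  have h' : ∀ x : E, a.val x • a.normal = b.val x • b.normal := by
    intro x
    have := h x
    rw [sub_right_inj, mul_smul, mul_smul] at this
    exact smul_right_injective E (two_ne_zero (α := ℝ)) this
  have hn : ∀ c : AffineRoot W, c.normal ≠ 0 := fun c hc => by
    have := c.norm_normal; rw [hc] at this; simp at this
  have hwall : ∀ x, x ∈ a.wall ↔ x ∈ b.wall := by
    intro x
    rw [mem_wall, mem_wall]
    constructor
    · intro h0
      have := h' x
      rw [h0, zero_smul] at this
      exact (smul_eq_zero.1 this.symm).resolve_right (hn b)
    · intro h0
      have := h' x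
      rw [h0, zero_smul] at this
      exact (smul_eq_zero.1 this).resolve_right (hn a)
  have hz : (b.level • b.normal) ∈ b.wall := by
    rw [mem_wall, val, inner_smul_right, inner_normal_self, mul_one, sub_self]
  have := h' (b.level • b.normal + (1 : ℝ) • b.normal)
  rw [val_add_smul_normal, mem_wall.1 hz, zero_add, one_smul] at this
  exact eq_or_eq_opp_of_wall this.symm ((hwall _).2 hz) hz

/-- The action of `W` on roots. -/
noncomputable def map (w : E ≃ᵃⁱ[ℝ] E) (hw : w ∈ W) (a : AffineRoot W) : AffineRoot W where
  normal := w.linearIsometryEquiv a.normal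
  level := a.level + ⟪w.linearIsometryEquiv a.normal, w 0⟫
  norm_normal := by rw [LinearIsometryEquiv.norm_map, a.norm_normal]
  reflection_mem := by
    obtain ⟨r, hr, h⟩ := a.reflection_mem
    refine ⟨w * r * w⁻¹, W.mul_mem (W.mul_mem hw hr) (W.inv_mem hw), fun x => ?_⟩
    obtain ⟨y, rfl⟩ := w.surjective x
    have e : (w * r * w⁻¹) (w y) = w (r y) := by
      rw [AffineIsometryEquiv.coe_mul, AffineIsometryEquiv.coe_mul]
      simp
    have hlin : ∀ v : E, w v = w.linearIsometryEquiv v + w 0 := fun v => by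
      have := w.map_vadd (0 : E) v
      simpa using this
    rw [e, h y, hlin (y - _), hlin y, map_sub, map_smul, inner_add_right,
      LinearIsometryEquiv.inner_map_map]
    abel_nf

theorem apply_eq (w : E ≃ᵃⁱ[ℝ] E) (v : E) : w v = w.linearIsometryEquiv v + w 0 := by
  have := w.map_vadd (0 : E) v
  simpa using this

@[simp] theorem val_map (w : E ≃ᵃⁱ[ℝ] E) (hw : w ∈ W) (a : AffineRoot W) (x : E) :
    (a.map w hw).val (w x) = a.val x := by
  simp only [val, map]
  rw [apply_eq w x, inner_add_right, LinearIsometryEquiv.inner_map_map]; ring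

end AffineRoot

open AffineRoot

theorem exists_map_eq {w : E ≃ᵃⁱ[ℝ] E} (hw : w ∈ W) (b : AffineRoot W) :
    ∃ a : AffineRoot W, ∀ x, b.val (w x) = a.val x := by
  refine ⟨b.map w⁻¹ (W.inv_mem hw), fun x => ?_⟩
  have := val_map w⁻¹ (W.inv_mem hw) b (w x)
  rw [← this]; simp

/-- A point on no wall. -/
def IsGeneric (W : Subgroup (E ≃ᵃⁱ[ℝ] E)) (x : E) : Prop := ∀ a : AffineRoot W, x ∉ a.wall

/-- A point on at most one wall. -/
def IsSimple (W : Subgroup (E ≃ᵃⁱ[ℝ] E)) (z : E) : Prop :=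
  ∀ a b : AffineRoot W, z ∈ a.wall → z ∈ b.wall → b = a ∨ b = a.opp

/-- The intersection of the half spaces that contain `x`. -/
def cell (W : Subgroup (E ≃ᵃⁱ[ℝ] E)) (x : E) : Set E :=
  {y | ∀ a : AffineRoot W, x ∈ a.half → y ∈ a.half}

theorem IsGeneric.isSimple {x : E} (hx : IsGeneric W x) : IsSimple W x :=
  fun a _ ha => absurd ha (hx a)

theorem IsGeneric.val_ne {x : E} (hx : IsGeneric W x) (a : AffineRoot W) : a.val x ≠ 0 :=
  fun h => hx a (mem_wall.2 h)

theorem mem_cell_self (x : E) : x ∈ cell W x := fun _ h => h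

theorem cell_mem_modelChambers {x : E} (hx : IsGeneric W x) : cell W x ∈ modelChambers W :=
  ⟨x, hx, rfl⟩

theorem mem_cell_iff {x y : E} : y ∈ cell W x ↔ ∀ a : AffineRoot W, 0 ≤ a.val x → 0 ≤ a.val y := by
  simp [cell, mem_half]

theorem cell_subset_half {x : E} {a : AffineRoot W} (h : x ∈ a.half) : cell W x ⊆ a.half :=
  fun _ hy => hy a h

theorem cell_eq_of_generic {x y : E} (hy : IsGeneric W y) (h : y ∈ cell W x) :
    cell W y = cell W x := by
  rw [mem_cell_iff] at h
  ext u
  rw [mem_cell_iff, mem_cell_iff]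
  refine forall_congr' fun a => ?_
  have h1 := h a
  have h2 := h a.opp
  have h3 := hy.val_ne a
  simp only [val_opp] at h2
  constructor
  · intro hh h4; exact hh (h1 h4)
  · intro hh h4
    refine hh ?_
    by_contra h5
    push Not at h5
    have := h2 (by linarith)
    exact h3 (by linarith)

theorem isGeneric_map {w : E ≃ᵃⁱ[ℝ] E} (hw : w ∈ W) {x : E} (hx : IsGeneric W x) :
    IsGeneric W (w x) := by
  intro b hb
  obtain ⟨a, ha⟩ := exists_map_eq hw b
  rw [mem_wall, ha] at hb
  exact hx a (mem_wall.2 hb)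

theorem isSimple_map {w : E ≃ᵃⁱ[ℝ] E} (hw : w ∈ W) {x : E} (hx : IsSimple W x) :
    IsSimple W (w x) := by
  intro a b ha hb
  have h := hx (a.map w⁻¹ (W.inv_mem hw)) (b.map w⁻¹ (W.inv_mem hw))
  have e : ∀ c : AffineRoot W, ∀ y, (c.map w⁻¹ (W.inv_mem hw)).val y = c.val (w y) := by
    intro c y
    have := val_map w⁻¹ (W.inv_mem hw) c (w y)
    rw [← this]; simp
  simp only [mem_wall, e] at h
  have key : ∀ t : ℝ, (b.map w⁻¹ (W.inv_mem hw)).normal = t • (a.map w⁻¹ (W.inv_mem hw)).normal →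
      b.normal = t • a.normal := by
    intro t ht
    simp only [AffineRoot.map] at ht
    rw [← map_smul] at ht
    exact (LinearIsometryEquiv.injective _) ht
  rcases h (mem_wall.1 ha) (mem_wall.1 hb) with h | h
  · exact eq_or_eq_opp_of_wall (key 1 (by rw [h, one_smul])) ha hb
  · exact eq_or_eq_opp_of_wall (key (-1) (by rw [h]; simp [opp])) ha hb

theorem mem_cell_map {w : E ≃ᵃⁱ[ℝ] E} (hw : w ∈ W) {x y : E} (h : y ∈ cell W x) :
    w y ∈ cell W (w x) := by
  rw [mem_cell_iff] at *
  intro b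
  obtain ⟨a, ha⟩ := exists_map_eq hw b
  rw [ha, ha]
  exact h a

theorem image_cell {w : E ≃ᵃⁱ[ℝ] E} (hw : w ∈ W) (x : E) : w '' cell W x = cell W (w x) := by
  apply Subset.antisymm
  · rintro _ ⟨y, hy, rfl⟩; exact mem_cell_map hw hy
  · intro y hy
    refine ⟨w⁻¹ y, ?_, by simp⟩
    have := mem_cell_map (W.inv_mem hw) hy
    simpa using this

/-- The reflection of a root moves the origin by twice the absolute value of the level, so
discreteness leaves finitely many reflections, and a reflection determines its root up to sign. -/
theorem finite_level_le (hW : IsAffineWeylGroup W) (R : ℝ) :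
    {a : AffineRoot W | |a.level| ≤ R}.Finite := by
  choose r hr h using fun a : AffineRoot W => a.reflection_mem
  refine Set.Finite.of_finite_fibers r ((hW.discrete (2 * R)).subset ?_) ?_
  · rintro _ ⟨a, ha, rfl⟩
    refine ⟨hr a, ?_⟩
    rw [h a 0, inner_zero_right, zero_sub, zero_sub, norm_neg, norm_smul, a.norm_normal]
    simp only [mem_ofPred_eq] at ha
    rw [Real.norm_eq_abs, abs_mul, abs_neg]; simp; linarith
  · rintro _ ⟨a, ha, rfl⟩
    refine (Set.toFinite {a, a.opp}).subset ?_
    rintro b ⟨-, hb⟩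
    simp only [mem_preimage, mem_singleton_iff] at hb
    refine eq_or_eq_opp_of_reflection fun x => ?_
    rw [← h a, ← h b, hb]

theorem countable_roots (hW : IsAffineWeylGroup W) : Countable (AffineRoot W) := by
  rw [← Set.countable_univ_iff]
  have : (univ : Set (AffineRoot W)) = ⋃ n : ℕ, {a : AffineRoot W | |a.level| ≤ (n : ℝ)} := by
    ext a
    simp only [mem_univ, mem_iUnion, mem_ofPred_eq, true_iff]
    exact exists_nat_ge _
  rw [this]
  exact countable_iUnion fun n => (finite_level_le hW n).countable

/-- Walls within distance 1 of `z` have level at most `‖z‖ + 1` in absolute value, so there are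
finitely many, and their nonzero distances from `z` have a positive lower bound. -/
theorem exists_ball_walls (hW : IsAffineWeylGroup W) (z : E) :
    ∃ ε > 0, ∀ a : AffineRoot W, |a.val z| < ε → a.val z = 0 := by
  have h1 : ∀ᶠ ε in nhdsWithin (0 : ℝ) (Ioi 0), ∀ a ∈ {a : AffineRoot W | |a.level| ≤ ‖z‖ + 1},
      |a.val z| < ε → a.val z = 0 := by
    rw [Filter.eventually_all_finite (finite_level_le hW _)]
    intro a _
    by_cases h0 : a.val z = 0
    · exact Filter.Eventually.of_forall fun _ _ => h0
    · filter_upwards [Ioo_mem_nhdsGT (abs_pos.2 h0)] with ε hε h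
      exact absurd h (not_lt.2 hε.2.le)
  have h2 : ∀ᶠ ε in nhdsWithin (0 : ℝ) (Ioi 0), ε ∈ Ioo (0 : ℝ) 1 := Ioo_mem_nhdsGT one_pos
  obtain ⟨ε, h, hε⟩ := (h1.and h2).exists
  refine ⟨ε, hε.1, fun a ha => h a ?_ ha⟩
  have h3 := a.abs_inner_normal_le z
  have h4 := abs_sub_abs_le_abs_sub a.level ⟪a.normal, z⟫
  rw [abs_sub_comm] at h4
  have h5 : |⟪a.normal, z⟫ - a.level| < ε := ha
  simp only [mem_ofPred_eq]
  linarith [hε.2]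

/-- Points close to `z` lie on the same side of every wall that does not contain `z`. -/
theorem exists_ball_sign (hW : IsAffineWeylGroup W) (z : E) :
    ∃ ε > 0, ∀ u, dist u z < ε → ∀ a : AffineRoot W,
      (0 < a.val z → 0 < a.val u) ∧ (a.val z < 0 → a.val u < 0) := by
  obtain ⟨ε, hε, h⟩ := exists_ball_walls hW z
  refine ⟨ε, hε, fun u hu a => ?_⟩
  have h1 := (abs_le.1 (a.abs_val_sub_le u z))
  constructor
  · intro h2
    by_contra h3
    push Not at h3
    have := h a (by rw [abs_of_pos h2]; linarith)
    linarith
  · intro h2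
    by_contra h3
    push Not at h3
    have := h a (by rw [abs_of_neg h2]; linarith)
    linarith

/-- No wall missing `z` meets a small ball around it, so a cell that meets the ball contains the
centre. Local arguments pass from nearby points to `z` in this way. -/
theorem exists_ball_mem_cell (hW : IsAffineWeylGroup W) (z : E) :
    ∃ ε > 0, ∀ u, dist u z < ε → ∀ y, u ∈ cell W y → z ∈ cell W y := by
  obtain ⟨ε, hε, h⟩ := exists_ball_sign hW z
  refine ⟨ε, hε, fun u hu y hy => ?_⟩
  rw [mem_cell_iff] at *
  intro a ha
  by_contra h1
  push Not at h1
  have := (h u hu a).2 h1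
  have := hy a ha
  linarith

theorem cell_mem_nhds (hW : IsAffineWeylGroup W) {x : E} (hx : IsGeneric W x) :
    cell W x ∈ nhds x := by
  obtain ⟨ε, hε, h⟩ := exists_ball_sign hW x
  refine Metric.mem_nhds_iff.2 ⟨ε, hε, fun u hu => ?_⟩
  rw [mem_cell_iff]
  intro a ha
  exact ((h u hu a).1 (lt_of_le_of_ne ha (hx.val_ne a).symm)).le

theorem isOpen_generic (hW : IsAffineWeylGroup W) : IsOpen {x | IsGeneric W x} := by
  rw [Metric.isOpen_iff]
  intro x hx
  obtain ⟨ε, hε, h⟩ := exists_ball_sign hW x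
  refine ⟨ε, hε, fun u hu a ha => ?_⟩
  rw [mem_wall] at ha
  rcases lt_or_gt_of_ne (hx.val_ne a) with h1 | h1
  · have := (h u hu a).2 h1; linarith
  · have := (h u hu a).1 h1; linarith

/-- Near a simple point the two sides of its wall are chambers. -/
theorem exists_ball_side (hW : IsAffineWeylGroup W) {z : E} (hz : IsSimple W z)
    {a : AffineRoot W} (ha : z ∈ a.wall) :
    ∃ ε > 0, ∀ u, dist u z < ε → 0 < a.val u →
      IsGeneric W u ∧ ∀ y, IsGeneric W y → z ∈ cell W y → 0 < a.val y → cell W u = cell W y := by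
  obtain ⟨ε, hε, h⟩ := exists_ball_sign hW z
  refine ⟨ε, hε, fun u hu hau => ?_⟩
  have hg : IsGeneric W u := by
    intro b hb
    rw [mem_wall] at hb
    rcases lt_trichotomy (b.val z) 0 with h1 | h1 | h1
    · have := (h u hu b).2 h1; linarith
    · rcases hz a b ha (mem_wall.2 h1) with rfl | rfl
      · linarith
      · rw [val_opp] at hb; linarith
    · have := (h u hu b).1 h1; linarith
  refine ⟨hg, fun y hy hzy hay => ?_⟩
  refine cell_eq_of_generic hg ?_
  rw [mem_cell_iff] at *
  intro b hb
  rcases lt_trichotomy (b.val z) 0 with h1 | h1 | h1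
  · have := hzy b hb; linarith
  · rcases hz a b ha (mem_wall.2 h1) with rfl | rfl
    · exact hau.le
    · rw [val_opp] at hb; linarith
  · exact ((h u hu b).1 h1).le

theorem cell_eq_of_same_side (hW : IsAffineWeylGroup W) {z : E} (hz : IsSimple W z)
    {a : AffineRoot W} (ha : z ∈ a.wall) {y y' : E} (hy : IsGeneric W y) (hy' : IsGeneric W y')
    (hzy : z ∈ cell W y) (hzy' : z ∈ cell W y') (hay : 0 < a.val y) (hay' : 0 < a.val y') :
    cell W y = cell W y' := by
  obtain ⟨ε, hε, h⟩ := exists_ball_side hW hz ha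
  have h1 : dist (z + (ε / 2) • a.normal) z < ε := by
    rw [dist_eq_norm, add_sub_cancel_left, norm_smul, a.norm_normal, Real.norm_eq_abs,
      abs_of_pos (by positivity)]
    linarith
  have h2 := h _ h1 (by rw [val_add_smul_normal, mem_wall.1 ha]; linarith)
  rw [← h2.2 y hy hzy hay, ← h2.2 y' hy' hzy' hay']

theorem exists_chamber_side (hW : IsAffineWeylGroup W) {z : E} (hz : IsSimple W z)
    {a : AffineRoot W} (ha : z ∈ a.wall) :
    ∃ y, IsGeneric W y ∧ 0 < a.val y ∧ z ∈ cell W y := by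
  obtain ⟨ε, hε, h⟩ := exists_ball_side hW hz ha
  obtain ⟨ε', hε', h'⟩ := exists_ball_mem_cell hW z
  set t := min ε ε' / 2
  have ht : 0 < t := by positivity
  have h1 : dist (z + t • a.normal) z = t := by
    rw [dist_eq_norm, add_sub_cancel_left, norm_smul, a.norm_normal, Real.norm_eq_abs,
      abs_of_pos ht, mul_one]
  have h2 : 0 < a.val (z + t • a.normal) := by
    rw [val_add_smul_normal, mem_wall.1 ha]; linarith
  have h3 : t < ε := by have := min_le_left ε ε'; simp only [t]; linarith
  have h4 : t < ε' := by have := min_le_right ε ε'; simp only [t]; linarith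
  exact ⟨_, (h _ (h1.trans_lt h3) h2).1, h2, h' _ (h1.trans_lt h4) _ (mem_cell_self _)⟩

/-- Two chambers at a simple point that are not separated by its wall coincide; if they are
separated, then only by this wall. -/
theorem mem_cell_of_mem_wall {z : E} (hz : IsSimple W z)
    {a : AffineRoot W} (ha : z ∈ a.wall) {y y' z' : E} (hzy : z ∈ cell W y) (hzy' : z ∈ cell W y')
    (hz'y : z' ∈ cell W y) (ha' : z' ∈ a.wall) : z' ∈ cell W y' := by
  rw [mem_cell_iff] at *
  intro b hb
  by_cases h : 0 ≤ b.val y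
  · exact hz'y b h
  · have h1 := hzy b.opp (by rw [val_opp]; linarith)
    have h2 := hzy' b hb
    rw [val_opp] at h1
    rw [mem_wall] at ha'
    rcases hz a b ha (mem_wall.2 (by linarith)) with rfl | rfl
    · rw [ha']
    · rw [val_opp, ha', neg_zero]

end WeylGeometry

/-! ### General position, galleries, and finiteness of the set of normals. -/

section WeylGeometry

variable {E : Type*} [NormedAddCommGroup E] [InnerProductSpace ℝ E]
  {W : Subgroup (E ≃ᵃⁱ[ℝ] E)}

open AffineRoot

theorem eq_one_of_fixes_open {w : E ≃ᵃⁱ[ℝ] E} {U : Set E} (hU : IsOpen U) (hne : U.Nonempty)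
    (h : ∀ x ∈ U, w x = x) : w = 1 := by
  obtain ⟨x, hx⟩ := hne
  ext y
  have h1 : ∀ᶠ t in nhds (0 : ℝ), x + t • (y - x) ∈ U := by
    have hc : Continuous fun t : ℝ => x + t • (y - x) := by fun_prop
    exact hc.continuousAt.eventually_mem (hU.mem_nhds (by simpa using hx))
  have h2 : ∀ᶠ t in nhdsWithin (0 : ℝ) {0}ᶜ, x + t • (y - x) ∈ U := nhdsWithin_le_nhds h1
  obtain ⟨t, ht, ht0⟩ := (h2.and self_mem_nhdsWithin).exists
  have h3 := h _ ht
  have h4 := h _ hx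
  rw [apply_eq w] at h3 h4
  rw [map_add, map_smul, add_right_comm, h4, add_right_inj] at h3
  have h5 := smul_right_injective E (show t ≠ 0 from ht0) h3
  rw [apply_eq w]
  have : y = (y - x) + x := by abel
  rw [this, map_add, h5, add_assoc, h4]
  simp

/-- Solve the Gram system of the two normals; for unit vectors its determinant `1 - c ^ 2` vanishes
only if they are parallel. -/
theorem exists_mem_two_walls {a b : AffineRoot W} (h : ¬ ∃ s : ℝ, b.normal = s • a.normal) :
    ∃ p, p ∈ a.wall ∧ p ∈ b.wall := by
  set c := ⟪a.normal, b.normal⟫ with hc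
  have hc' : ⟪b.normal, a.normal⟫ = c := real_inner_comm _ _
  have h1 : 1 - c ^ 2 ≠ 0 := by
    intro h1
    refine h ⟨c, ?_⟩
    rw [← sub_eq_zero, ← inner_self_eq_zero (𝕜 := ℝ)]
    simp only [inner_sub_left, inner_sub_right, inner_smul_left, inner_smul_right,
      inner_normal_self, ← hc, hc', conj_trivial]
    linear_combination h1
  refine ⟨((a.level - c * b.level) / (1 - c ^ 2)) • a.normal +
    ((b.level - c * a.level) / (1 - c ^ 2)) • b.normal, ?_, ?_⟩
  · simp only [wall, mem_ofPred_eq, inner_add_right, inner_smul_right, inner_normal_self, ← hc]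
    field_simp; ring
  · simp only [wall, mem_ofPred_eq, inner_add_right, inner_smul_right, inner_normal_self, hc']
    field_simp; ring

theorem abs_level_map_le {w : E ≃ᵃⁱ[ℝ] E} (hw : w ∈ W) {a : AffineRoot W} {p : E}
    (hp : p ∈ a.wall) : |(a.map w⁻¹ (W.inv_mem hw)).level| ≤ dist p (w 0) := by
  have h1 := val_map w⁻¹ (W.inv_mem hw) a p
  rw [mem_wall.1 hp] at h1
  have h2 : dist (w⁻¹ p) 0 = dist p (w 0) := by
    rw [← w.dist_map]; simp
  rw [dist_zero_right] at h2
  rw [← h2]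
  have h3 := abs_inner_normal_le (a.map w⁻¹ (W.inv_mem hw)) (w⁻¹ p)
  rw [val, sub_eq_zero] at h1
  rwa [h1] at h3

theorem level_eq_neg_val (a : AffineRoot W) : a.level = -a.val 0 := by
  simp [val]

theorem exists_root [Nontrivial E] (hW : IsAffineWeylGroup W) : Nonempty (AffineRoot W) := by
  by_contra h
  rw [not_nonempty_iff] at h
  have h1 : W = ⊥ := by
    rw [hW.generated, Subgroup.closure_eq_bot_iff]
    rintro r ⟨hr, v, c, hv, hx⟩
    exact h.elim ⟨v, c, hv, r, hr, hx⟩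
  obtain ⟨R, hR⟩ := hW.cocompact
  obtain ⟨x, hx⟩ := NormedSpace.exists_lt_norm ℝ E R
  obtain ⟨w, hw, hd⟩ := hR x
  rw [h1, Subgroup.mem_bot] at hw
  rw [hw] at hd
  simp at hd
  linarith

variable [FiniteDimensional ℝ E]

/-- Baire: each hyperplane is closed with dense complement. -/
theorem exists_mem_avoiding {ι : Type*} [Countable ι] (v : ι → E) (c : ι → ℝ)
    (hv : ∀ i, v i ≠ 0) {O : Set E} (hO : IsOpen O) (hne : O.Nonempty) :
    ∃ y ∈ O, ∀ i, ⟪v i, y⟫ ≠ c i := by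
  have hd : Dense (⋂ i, {y : E | ⟪v i, y⟫ ≠ c i}) := by
    refine dense_iInter_of_isOpen (fun i => ?_) fun i => ?_
    · exact isOpen_ne_fun (by fun_prop) continuous_const
    · rw [dense_iff_inter_open]
      rintro U hU ⟨y, hy⟩
      by_cases h : ⟪v i, y⟫ = c i
      · have h1 : ∀ᶠ t in nhds (0 : ℝ), y + t • v i ∈ U := by
          have hc : Continuous fun t : ℝ => y + t • v i := by fun_prop
          exact hc.continuousAt.eventually_mem (hU.mem_nhds (by simpa using hy))
        have h2 : ∀ᶠ t in nhdsWithin (0 : ℝ) {0}ᶜ, y + t • v i ∈ U := nhdsWithin_le_nhds h1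
        obtain ⟨t, ht, ht0⟩ := (h2.and self_mem_nhdsWithin).exists
        refine ⟨_, ht, ?_⟩
        simp only [mem_ofPred_eq, inner_add_right, inner_smul_right, h]
        have h3 : ⟪v i, v i⟫ ≠ 0 := inner_self_ne_zero.2 (hv i)
        intro h4
        have h5 : t * ⟪v i, v i⟫ = 0 := by linarith
        rcases mul_eq_zero.1 h5 with h6 | h6
        · exact ht0 h6
        · exact h3 h6
      · exact ⟨y, hy, h⟩
  obtain ⟨y, hy, h⟩ := hd.inter_open_nonempty O hO hne
  exact ⟨y, hy, fun i => mem_iInter.1 h i⟩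

/-- Two walls `a`, `b` meeting at a point of the segment other than `x` impose a linear condition on
`y` with coefficient vector `vec (a, b)`. The countably many nontrivial conditions are avoided. If
`vec (a, b) = 0`, either both walls pass through `x`, which genericity of `y` excludes, or the
normals are parallel and the walls coincide because they meet. -/
theorem exists_generic_simple_segment (hW : IsAffineWeylGroup W) (x : E) {O : Set E}
    (hO : IsOpen O) (hne : O.Nonempty) :
    ∃ y ∈ O, IsGeneric W y ∧ ∀ t ∈ Ioc (0 : ℝ) 1, IsSimple W (x + t • (y - x)) := by
  have := countable_roots hW
  let vec : AffineRoot W × AffineRoot W → E :=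
    fun p => p.2.val x • p.1.normal - p.1.val x • p.2.normal
  let ι := AffineRoot W ⊕ {p : AffineRoot W × AffineRoot W // vec p ≠ 0}
  obtain ⟨y, hyO, hy⟩ := exists_mem_avoiding (ι := ι)
    (Sum.elim (fun a => a.normal) (fun p => vec p.1))
    (Sum.elim (fun a => a.level)
      (fun p => p.1.2.val x * p.1.1.level - p.1.1.val x * p.1.2.level))
    (by
      rintro (a | p)
      · intro h
        have := a.norm_normal
        simp only [Sum.elim_inl] at h
        rw [h] at this; simp at this
      · exact p.2) hO hne
  have hg : IsGeneric W y := fun a => hy (Sum.inl a)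
  refine ⟨y, hyO, hg, fun t ht a b ha hb => ?_⟩
  have ha' := mem_wall.1 ha
  have hb' := mem_wall.1 hb
  rw [val_line] at ha' hb'
  have ht0 : t ≠ 0 := ht.1.ne'
  by_cases hv : vec (a, b) = 0
  · by_cases h1 : a.val x = 0
    · by_cases h2 : b.val x = 0
      · rw [h1] at ha'
        exact absurd (by simpa [ht0] using ha') (hg.val_ne a)
      · simp only [vec, h1, zero_smul, sub_zero] at hv
        have h3 := (smul_eq_zero.1 hv).resolve_left h2
        have := a.norm_normal
        rw [h3] at this; simp at this
    · refine eq_or_eq_opp_of_wall (s := b.val x / a.val x) ?_ ha hb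
      have h2 : b.val x • a.normal = a.val x • b.normal := sub_eq_zero.1 hv
      rw [div_eq_inv_mul, mul_smul, h2, smul_smul, inv_mul_cancel₀ h1, one_smul]
  · have h1 := hy (Sum.inr ⟨(a, b), hv⟩)
    simp only [Sum.elim_inr, vec, inner_sub_left, inner_smul_left] at h1
    have h2 : t * (b.val x * a.val y - a.val x * b.val y) = 0 := by
      linear_combination b.val x * ha' - a.val x * hb'
    have h3 := (mul_eq_zero.1 h2).resolve_left ht0
    refine absurd ?_ h1
    simp only [val] at h3 ⊢
    simp only [conj_trivial]
    linear_combination h3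

theorem exists_generic_mem (hW : IsAffineWeylGroup W) {O : Set E}
    (hO : IsOpen O) (hne : O.Nonempty) : ∃ y ∈ O, IsGeneric W y := by
  obtain ⟨y, hy, hg, -⟩ := exists_generic_simple_segment hW 0 hO hne
  exact ⟨y, hy, hg⟩

theorem exists_generic_cell (hW : IsAffineWeylGroup W) (z : E) :
    ∃ y, IsGeneric W y ∧ z ∈ cell W y := by
  obtain ⟨ε, hε, h⟩ := exists_ball_mem_cell hW z
  obtain ⟨y, hy, hg⟩ := exists_generic_mem hW Metric.isOpen_ball ⟨z, Metric.mem_ball_self hε⟩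
  exact ⟨y, hg, h y hy y (mem_cell_self y)⟩

/-- Cross the wall near `p` by a segment of simple points and take the crossing point. -/
theorem exists_simple_mem_wall (hW : IsAffineWeylGroup W) (a : AffineRoot W) {p : E}
    (hp : p ∈ a.wall) {ε : ℝ} (hε : 0 < ε) : ∃ z ∈ a.wall, dist z p < ε ∧ IsSimple W z := by
  set x := p - (ε / 2) • a.normal with hx
  set q := p + (ε / 2) • a.normal with hq
  have hn : ‖(ε / 2) • a.normal‖ = ε / 2 := by
    rw [norm_smul, a.norm_normal, Real.norm_eq_abs, abs_of_pos (by positivity), mul_one]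
  obtain ⟨y, hy, hg, hs⟩ := exists_generic_simple_segment hW x
    (Metric.isOpen_ball (x := q) (ε := ε / 4)) ⟨q, Metric.mem_ball_self (by positivity)⟩
  have hy' : dist y q < ε / 4 := hy
  have hvx : a.val x = -(ε / 2) := by
    rw [hx, sub_eq_add_neg, ← neg_smul, val_add_smul_normal, mem_wall.1 hp, zero_add]
  have hvq : a.val q = ε / 2 := by
    rw [hq, val_add_smul_normal, mem_wall.1 hp, zero_add]
  have hvy : 0 < a.val y := by
    have := (abs_le.1 (a.abs_val_sub_le y q)).1
    linarith
  have ht : (ε / 2) / (ε / 2 + a.val y) ∈ Ioc (0 : ℝ) 1 := by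
    constructor
    · positivity
    · rw [div_le_one (by positivity)]; linarith
  refine ⟨_, ?_, ?_, hs _ ht⟩
  · rw [mem_wall, val_line, hvx]
    field_simp
    ring
  · have h1 : x ∈ Metric.ball p ε := by
      rw [Metric.mem_ball, dist_eq_norm, hx, sub_sub_cancel_left, norm_neg, hn]; linarith
    have h2 : y ∈ Metric.ball p ε := by
      rw [Metric.mem_ball]
      have : dist q p = ε / 2 := by rw [dist_eq_norm, hq, add_sub_cancel_left, hn]
      linarith [dist_triangle y q p]
    exact (convex_ball p ε).add_smul_sub_mem h1 h2 ⟨ht.1.le, ht.2⟩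

/-- Gallery induction. Along a segment of simple points, the condition that all chambers containing
the current point belong to `Y` is locally constant. -/
theorem generic_connected (hW : IsAffineWeylGroup W) {Y : Set E} (hne : ∃ y ∈ Y, IsGeneric W y)
    (hadj : ∀ y ∈ Y, IsGeneric W y → ∀ y', IsGeneric W y' → ∀ z, IsSimple W z →
      z ∈ cell W y → z ∈ cell W y' → y' ∈ Y) {x : E} (hx : IsGeneric W x) : x ∈ Y := by
  obtain ⟨y₀, hy₀, hg₀⟩ := hne
  obtain ⟨y, hyO, hg, hs⟩ := exists_generic_simple_segment hW y₀ (isOpen_interior (s := cell W x))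
    ⟨x, mem_interior_iff_mem_nhds.2 (cell_mem_nhds hW hx)⟩
  have hyx : cell W y = cell W x := cell_eq_of_generic hg (interior_subset hyO)
  let γ : unitInterval → E := fun t => y₀ + (t : ℝ) • (y - y₀)
  have hγ : Continuous γ := by fun_prop
  have hsimp : ∀ t, IsSimple W (γ t) := by
    intro t
    rcases eq_or_lt_of_le t.2.1 with h | h
    · simp only [γ, ← h, zero_smul, add_zero]; exact hg₀.isSimple
    · exact hs t ⟨h, t.2.2⟩
  let P : unitInterval → Prop := fun t => ∀ u, IsGeneric W u → γ t ∈ cell W u → u ∈ Y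
  have hP : IsLocallyConstant P := by
    rw [IsLocallyConstant.iff_eventually_eq]
    intro t
    obtain ⟨ε, hε, h⟩ := exists_ball_mem_cell hW (γ t)
    have : ∀ᶠ s in nhds t, dist (γ s) (γ t) < ε :=
      hγ.continuousAt.eventually_mem (Metric.ball_mem_nhds _ hε)
    filter_upwards [this] with s hsd
    apply propext
    constructor
    · intro hPs u hu hut
      obtain ⟨v, hv, hsv⟩ := exists_generic_cell hW (γ s)
      exact hadj v (hPs v hv hsv) hv u hu (γ t) (hsimp t) (h _ hsd v hsv) hut
    · intro hPt u hu hus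
      exact hPt u hu (h _ hsd u hus)
  have h0 : P 0 := by
    intro u hu h
    have h' : y₀ ∈ cell W u := by simpa [γ] using h
    exact hadj y₀ hy₀ hg₀ u hu y₀ hg₀.isSimple (mem_cell_self _) h'
  have h1 : P 1 := by
    rw [hP.apply_eq_of_preconnectedSpace 1 0]; exact h0
  refine h1 x hx ?_
  have : γ 1 = y := by simp [γ]
  rw [this, ← hyx]
  exact mem_cell_self y

/-- Nonparallel walls meet, and the group moves a common point to within `R` of the origin, where
only finitely many roots occur; so inner products of normals take finitely many values. A normal is
determined by its inner products with a finite set of normals spanning all of them. -/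
theorem finite_normals (hW : IsAffineWeylGroup W) :
    (range (AffineRoot.normal (W := W))).Finite := by
  obtain ⟨R, hR⟩ := hW.cocompact
  set F := {a : AffineRoot W | |a.level| ≤ R}
  have hF : F.Finite := finite_level_le hW R
  set IP : Set ℝ := (image2 (fun a b : AffineRoot W => ⟪a.normal, b.normal⟫) F F) ∪ {1, -1}
  have hIP : IP.Finite := (hF.image2 _ hF).union (Set.toFinite _)
  have h1 : ∀ a b : AffineRoot W, ⟪a.normal, b.normal⟫ ∈ IP := by
    intro a b
    by_cases h : ∃ s : ℝ, b.normal = s • a.normal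
    · obtain ⟨s, hs⟩ := h
      right
      have h1 := b.norm_normal
      rw [hs, norm_smul, a.norm_normal, mul_one, Real.norm_eq_abs] at h1
      rw [hs, inner_smul_right, inner_normal_self, mul_one]
      exact (abs_eq zero_le_one).1 h1
    · left
      obtain ⟨p, hpa, hpb⟩ := exists_mem_two_walls h
      obtain ⟨w, hw, hd⟩ := hR p
      refine ⟨a.map w⁻¹ (W.inv_mem hw), (abs_level_map_le hw hpa).trans hd,
        b.map w⁻¹ (W.inv_mem hw), (abs_level_map_le hw hpb).trans hd, ?_⟩
      simp [AffineRoot.map, LinearIsometryEquiv.inner_map_map]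
  set S := range (AffineRoot.normal (W := W))
  obtain ⟨t, htS, hts⟩ := (Submodule.fg_span_iff_fg_span_finset_subset _).1
    (IsNoetherian.noetherian (Submodule.span ℝ S))
  let f : E → (t → ℝ) := fun v i => ⟪(i : E), v⟫
  refine Set.Finite.of_finite_image (f := f)
    ((Set.Finite.pi' (ι := t) (t := fun _ => IP) fun _ => hIP).subset ?_) ?_
  · rintro _ ⟨_, ⟨b, rfl⟩, rfl⟩ i
    obtain ⟨a, ha⟩ := htS i.2
    simp only [f, ← ha]
    exact h1 a b
  · intro v hv v' hv' h
    have h2 : ∀ u ∈ Submodule.span ℝ S, ⟪u, v - v'⟫ = 0 := by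
      intro u hu
      rw [hts] at hu
      induction hu using Submodule.span_induction with
      | mem x hx =>
        have := congrFun h ⟨x, hx⟩
        simp only [f] at this
        rw [inner_sub_right, this, sub_self]
      | zero => simp
      | add x y _ _ hx hy => rw [inner_add_left, hx, hy, add_zero]
      | smul c x _ hx => rw [inner_smul_left, hx, mul_zero]
    have h3 := h2 (v - v') (Submodule.sub_mem _ (Submodule.subset_span hv)
      (Submodule.subset_span hv'))
    exact sub_eq_zero.1 (inner_self_eq_zero.1 h3)

/-- By cocompactness `w n` moves the origin close to `-n • a.normal`. If the roots pulled back by `w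
n` and `w k` have equal normals, the linear part of `w k * (w n)⁻¹` fixes `a.normal`. For fixed `k`
this element raises the level of `a` by `n` up to a bounded error. -/
theorem exists_level_ge (hW : IsAffineWeylGroup W) (a : AffineRoot W) (M : ℝ) :
    ∃ b : AffineRoot W, b.normal = a.normal ∧ M ≤ b.level := by
  obtain ⟨R, hR⟩ := hW.cocompact
  choose w hw hd using fun n : ℕ => hR (-(n : ℝ) • a.normal)
  have : Finite (range (AffineRoot.normal (W := W))) := finite_normals hW
  let A : ℕ → AffineRoot W := fun n => a.map (w n)⁻¹ (W.inv_mem (hw n))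
  obtain ⟨m, hm⟩ := Finite.exists_infinite_fiber
    fun n : ℕ => (⟨(A n).normal, mem_range_self _⟩ : range (AffineRoot.normal (W := W)))
  have hm' := Set.infinite_coe_iff.1 hm
  obtain ⟨k, hk⟩ := hm'.nonempty
  obtain ⟨n, hn, hn'⟩ := hm'.exists_gt ⌈M - a.level + R + ‖(w k)⁻¹ (0 : E)‖⌉₊
  have hn'' := (Nat.le_ceil _).trans (Nat.cast_le (α := ℝ).2 hn'.le)
  have hnk : (A n).normal = (A k).normal := by
    have h1 : _ = m := hn
    have h2 : _ = m := hk
    exact congrArg Subtype.val (h1.trans h2.symm)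
  refine ⟨(A n).map (w k) (hw k), ?_, ?_⟩
  · show (w k).linearIsometryEquiv (A n).normal = a.normal
    rw [hnk]
    exact (w k).linearIsometryEquiv.apply_symm_apply a.normal
  · have h1 : ((A n).map (w k) (hw k)).val 0 = (A n).val ((w k)⁻¹ 0) := by
      have := val_map (w k) (hw k) (A n) ((w k)⁻¹ 0)
      rw [← this]; simp
    have h2 : (A n).val 0 = a.val (w n 0) := by
      have := val_map (w n)⁻¹ (W.inv_mem (hw n)) a (w n 0)
      rw [← this]; simp [A]
    have h3 := (abs_le.1 ((A n).abs_val_sub_le ((w k)⁻¹ 0) 0)).2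
    rw [dist_zero_right] at h3
    have h4 := (abs_le.1 (a.abs_val_sub_le (-(n : ℝ) • a.normal) (w n 0))).1
    have h5 : a.val (-(n : ℝ) • a.normal) = -n - a.level := by
      rw [val, inner_smul_right, inner_normal_self, mul_one]
    rw [level_eq_neg_val, h1]
    linarith [hd n]

end WeylGeometry

/-! ### Retractions centred at a chamber, and the agreement locus of two charts. -/

section Retraction

variable {E : Type*} [NormedAddCommGroup E] [InnerProductSpace ℝ E]

/-- Continuous induction along the segment from `x` to `y`: the local estimate at each point carries
the bound a little further. -/
theorem dist_le_of_locally_dist_le {φ : E → E}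
    (h : ∀ z, ∃ ε > 0, ∀ u, dist u z < ε → dist (φ u) (φ z) ≤ dist u z) (x y : E) :
    dist (φ y) (φ x) ≤ dist y x := by
  have hφ : Continuous φ := by
    rw [Metric.continuous_iff]
    intro z ε hε
    obtain ⟨δ, hδ, hd⟩ := h z
    refine ⟨min δ ε, lt_min hδ hε, fun u hu => ?_⟩
    exact (hd u (hu.trans_le (min_le_left _ _))).trans_lt (hu.trans_le (min_le_right _ _))
  let γ : ℝ → E := fun t => x + t • (y - x)
  have hγ : Continuous γ := by fun_prop
  have hdist : ∀ s t, dist (γ s) (γ t) = |s - t| * dist y x := by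
    intro s t
    simp only [γ, dist_eq_norm]
    rw [add_sub_add_left_eq_sub, ← sub_smul, norm_smul, Real.norm_eq_abs]
  let S : Set ℝ := {t | dist (φ (γ t)) (φ x) ≤ t * dist y x}
  have hS : IsClosed (S ∩ Icc 0 1) := by
    refine IsClosed.inter (isClosed_le ?_ ?_) isClosed_Icc <;> fun_prop
  have key : Icc (0 : ℝ) 1 ⊆ S := by
    refine hS.Icc_subset_of_forall_exists_gt (by simp [S, γ]) ?_
    rintro t ⟨htS, ht⟩ r hr
    obtain ⟨ε, hε, hz⟩ := h (γ t)
    have h1 : ∀ᶠ s in nhdsWithin t (Ioi t), dist (γ s) (γ t) < ε :=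
      nhdsWithin_le_nhds (hγ.continuousAt.eventually_mem (Metric.ball_mem_nhds _ hε))
    obtain ⟨s, hs, hs'⟩ := (h1.and (Ioc_mem_nhdsGT hr)).exists
    refine ⟨s, ?_, hs'⟩
    have h2 := hz _ hs
    rw [hdist, abs_of_pos (sub_pos.2 hs'.1)] at h2
    have h3 : dist (φ (γ t)) (φ x) ≤ t * dist y x := htS
    show dist (φ (γ s)) (φ x) ≤ s * dist y x
    linarith [dist_triangle (φ (γ s)) (φ (γ t)) (φ x)]
  have := key (right_mem_Icc.2 zero_le_one)
  simpa [S, γ] using this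

/-- This is the equality case of the triangle inequality in a strictly convex space. -/
theorem eq_of_dist_le_of_mem_segment {x y z p : E} (hz : z ∈ segment ℝ x y)
    (hx : dist p x ≤ dist z x) (hy : dist p y ≤ dist z y) : p = z := by
  obtain ⟨s, hs, rfl⟩ := (segment_eq_image_lineMap ℝ x y) ▸ hz
  rw [dist_lineMap_left, Real.norm_eq_abs, abs_of_nonneg hs.1] at hx
  rw [dist_lineMap_right, Real.norm_eq_abs, abs_of_nonneg (by linarith [hs.2])] at hy
  have h := dist_triangle x p y
  rw [dist_comm x p] at h
  refine eq_lineMap_of_dist_eq_mul_of_dist_eq_mul ?_ ?_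
  · rw [dist_comm x p]; linarith
  · linarith

namespace AffineBuilding

open AffineRoot

variable {W : Subgroup (E ≃ᵃⁱ[ℝ] E)} {X : Type*} (B : AffineBuilding W X)

variable {B}

theorem exists_chart_through {f g : E → X} (hf : f ∈ B.charts) (hg : g ∈ B.charts)
    {y y' : E} (hy : IsGeneric W y) (hy' : IsGeneric W y') :
    ∃ h ∈ B.charts, EqOn h g (cell W y) ∧ f '' cell W y' ⊆ range h ∧
      ∃ w ∈ W, ∀ x, f x ∈ range h → f x = h (w x) := by
  obtain ⟨h₀, hh₀, hgh, hfh⟩ := B.common_apartment g hg f hf _ (cell_mem_modelChambers hy) _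
    (cell_mem_modelChambers hy')
  obtain ⟨w₀, hw₀, h1⟩ := B.compatible g hg h₀ hh₀ ⟨_, cell_mem_modelChambers hy, hgh⟩
  have hr : range (h₀ ∘ w₀) = range h₀ := w₀.surjective.range_comp h₀
  refine ⟨h₀ ∘ w₀, B.comp_mem _ hh₀ _ hw₀, fun u hu => ?_, by rw [hr]; exact hfh, ?_⟩
  · exact (h1 u (hgh (mem_image_of_mem g hu))).symm
  · exact B.compatible f hf _ (B.comp_mem _ hh₀ _ hw₀)
      ⟨_, cell_mem_modelChambers hy', by rw [hr]; exact hfh⟩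

/-- The element of `W` comparing the two charts fixes an open part of the chamber, hence is the
identity. -/
theorem eq_of_mem_range (hW : IsAffineWeylGroup W) {f g : E → X} (hf : f ∈ B.charts)
    (hg : g ∈ B.charts) {y : E} (hy : IsGeneric W y) (h : EqOn f g (cell W y)) {x : E}
    (hx : f x ∈ range g) : f x = g x := by
  obtain ⟨w, hw, h1⟩ := B.compatible f hf g hg ⟨_, cell_mem_modelChambers hy, by
    rintro _ ⟨u, hu, rfl⟩; rw [h hu]; exact mem_range_self u⟩
  have : w = 1 := by
    refine eq_one_of_fixes_open (isOpen_interior (s := cell W y))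
      ⟨y, mem_interior_iff_mem_nhds.2 (cell_mem_nhds hW hy)⟩ fun u hu => ?_
    have hu' := interior_subset hu
    have h2 := h1 u (by rw [h hu']; exact mem_range_self u)
    rw [h hu'] at h2
    exact (B.injective g hg h2).symm
  have h2 := h1 x hx
  rwa [this] at h2

/-- The retraction onto the model apartment, in the chart `g`, centred at the chamber of `y`. -/
noncomputable def retr (B : AffineBuilding W X) (g : E → X) (y : E) (p : X) : E :=
  Classical.epsilon fun x => ∃ h ∈ B.charts, EqOn h g (cell W y) ∧ h x = p

theorem retr_eq (hW : IsAffineWeylGroup W) {g h : E → X} {y : E} (hy : IsGeneric W y)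
    (hh : h ∈ B.charts) (heq : EqOn h g (cell W y)) (x : E) : B.retr g y (h x) = x := by
  obtain ⟨h', hh', heq', hx⟩ :=
    Classical.epsilon_spec (p := fun u => ∃ h' ∈ B.charts, EqOn h' g (cell W y) ∧ h' u = h x)
      ⟨x, h, hh, heq, rfl⟩
  have := eq_of_mem_range hW hh hh' hy (heq.trans heq'.symm) (x := x) ⟨_, hx⟩
  rw [← hx] at this
  exact B.injective h' hh' this

theorem eqOn_cell_of_eventuallyEq (hW : IsAffineWeylGroup W) {f g : E → X} (hf : f ∈ B.charts)
    (hg : g ∈ B.charts) {x : E} (hx : IsGeneric W x) (h : ∀ᶠ u in nhds x, f u = g u) :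
    EqOn f g (cell W x) := by
  obtain ⟨k, hk, heq, hr, w, hw, hfw⟩ := exists_chart_through hf hg hx hx
  obtain ⟨U, hU, hUo, hxU⟩ := eventually_nhds_iff.1 (h.and (cell_mem_nhds hW hx))
  have h1 : w = 1 := by
    refine eq_one_of_fixes_open hUo ⟨x, hxU⟩ fun u hu => ?_
    obtain ⟨h2, h3⟩ := hU u hu
    have h4 := hfw u (hr (mem_image_of_mem f h3))
    rw [h2, ← heq h3] at h4
    exact (B.injective k hk h4).symm
  intro u hu
  have h4 := hfw u (hr (mem_image_of_mem f hu))
  rw [h1] at h4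
  rw [h4]
  exact heq hu

variable [FiniteDimensional ℝ E]

theorem exists_chart_retr (hW : IsAffineWeylGroup W) {g : E → X} (hg : g ∈ B.charts)
    {y : E} (hy : IsGeneric W y) (p : X) :
    ∃ h ∈ B.charts, EqOn h g (cell W y) ∧ h (B.retr g y p) = p := by
  obtain ⟨f, hf, u, rfl⟩ := B.cover p
  obtain ⟨y', hy', hu⟩ := exists_generic_cell hW u
  obtain ⟨h, hh, heq, hr, -⟩ := exists_chart_through hf hg hy hy'
  obtain ⟨x, hx⟩ := hr (mem_image_of_mem f hu)
  refine ⟨h, hh, heq, ?_⟩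
  rw [← hx, retr_eq hW hy hh heq]

/-- On each closed chamber the retraction composed with `f` is given by an element of `W`. Points
near `z` share a chamber with `z`, so distances to `z` are preserved locally, and the local bound is
then globalised. -/
theorem dist_retr_le (hW : IsAffineWeylGroup W) {f g : E → X} (hf : f ∈ B.charts)
    (hg : g ∈ B.charts) {y : E} (hy : IsGeneric W y) (u v : E) :
    dist (B.retr g y (f u)) (B.retr g y (f v)) ≤ dist u v := by
  refine dist_le_of_locally_dist_le (φ := fun u => B.retr g y (f u)) (fun z => ?_) v u
  obtain ⟨ε, hε, h⟩ := exists_ball_mem_cell hW z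
  refine ⟨ε, hε, fun u hu => ?_⟩
  obtain ⟨y', hy', huy⟩ := exists_generic_cell hW u
  have hzy := h u hu y' huy
  obtain ⟨k, hk, heq, hr, w, hw, hfw⟩ := exists_chart_through hf hg hy hy'
  have e : ∀ v ∈ cell W y', B.retr g y (f v) = w v := fun v hv => by
    rw [hfw v (hr (mem_image_of_mem f hv)), retr_eq hW hy hk heq]
  show dist (B.retr g y (f u)) (B.retr g y (f z)) ≤ _
  rw [e u huy, e z hzy, w.dist_map]

theorem retr_eq_of_segment (hW : IsAffineWeylGroup W) {f g : E → X} (hf : f ∈ B.charts)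
    (hg : g ∈ B.charts) {y : E} (hy : IsGeneric W y) {u v z : E}
    (hu : B.retr g y (f u) = u) (hv : B.retr g y (f v) = v) (hz : z ∈ segment ℝ u v) :
    B.retr g y (f z) = z := by
  refine eq_of_dist_le_of_mem_segment hz ?_ ?_
  · have := dist_retr_le hW hf hg hy z u
    rwa [hu] at this
  · have := dist_retr_le hW hf hg hy z v
    rwa [hv] at this

theorem eq_of_retr_eq (hW : IsAffineWeylGroup W) {f g : E → X}
    (hg : g ∈ B.charts) {y : E} (hy : IsGeneric W y) {z : E} (hz : z ∈ cell W y)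
    (h : B.retr g y (f z) = z) : f z = g z := by
  obtain ⟨k, hk, heq, hkz⟩ := exists_chart_retr hW hg hy (f z)
  rw [h] at hkz
  rw [← hkz, heq hz]

/-- For `z` between two agreement points, centre the retraction at a chamber of `g` containing `g
z`. It sends the images of the end points back to their coordinates and does not increase distances,
so it sends `f z` to `z`. A point retracting into the central chamber lies in it, so `f z = g z`. -/
theorem convex_eqLocus (hW : IsAffineWeylGroup W) {f g : E → X} (hf : f ∈ B.charts)
    (hg : g ∈ B.charts) : Convex ℝ {x | f x = g x} := by
  rw [convex_iff_segment_subset]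
  intro u hu v hv z hz
  obtain ⟨y, hy, hzy⟩ := exists_generic_cell hW z
  have e : ∀ u, f u = g u → B.retr g y (f u) = u := fun u hu => by
    rw [hu, retr_eq hW hy hg (eqOn_refl _ _)]
  exact eq_of_retr_eq hW hg hy hzy (retr_eq_of_segment hW hf hg hy (e u hu) (e v hv) hz)

theorem isClosed_eqLocus (hW : IsAffineWeylGroup W) {f g : E → X} (hf : f ∈ B.charts)
    (hg : g ∈ B.charts) : IsClosed {x | f x = g x} := by
  refine isClosed_of_closure_subset fun z hz => ?_
  obtain ⟨y, hy, hzy⟩ := exists_generic_cell hW z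
  refine eq_of_retr_eq hW hg hy hzy ?_
  have hc : Continuous fun u => B.retr g y (f u) :=
    (LipschitzWith.of_dist_le' (K := 1) fun u v => by
      rw [one_mul]; exact dist_retr_le hW hf hg hy u v).continuous
  have hcl : IsClosed {u | B.retr g y (f u) = u} := isClosed_eq hc continuous_id
  refine closure_minimal ?_ hcl hz
  intro u hu
  have hu' : f u = g u := hu
  show B.retr g y (f u) = u
  rw [hu', retr_eq hW hy hg (eqOn_refl _ _)]

/-- The locus where two charts agree is an intersection of half spaces bounded by walls. -/
theorem exists_root_separating (hW : IsAffineWeylGroup W) {f g : E → X} (hf : f ∈ B.charts)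
    (hg : g ∈ B.charts) {y : E} (hy : IsGeneric W y) (heq : EqOn f g (cell W y)) {x : E}
    (hx : f x ≠ g x) :
    ∃ b : AffineRoot W, (∀ u, f u = g u → u ∈ b.half) ∧ x ∉ b.half := by
  set I := {u | f u = g u} with hI
  have hconv : Convex ℝ I := convex_eqLocus hW hf hg
  have hclosed : IsClosed I := isClosed_eqLocus hW hf hg
  have hcell : ∀ u, IsGeneric W u → u ∈ interior I → cell W u ⊆ I := by
    intro u hu hui
    exact eqOn_cell_of_eventuallyEq hW hf hg hu (mem_interior_iff_mem_nhds.1 hui)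
  have hne : (interior I).Nonempty := ⟨y, mem_interior_iff_mem_nhds.2
    (Filter.mem_of_superset (cell_mem_nhds hW hy) heq)⟩
  obtain ⟨v, hvI, hv, hsimp⟩ := exists_generic_simple_segment hW x isOpen_interior hne
  let γ : ℝ → E := fun t => x + t • (v - x)
  have hγ : Continuous γ := by fun_prop
  -- The first point of the segment from `x` to `v` that lies in the locus is a boundary point `z`;
  -- the wall through it will be the separating one.
  obtain ⟨t, ⟨ht, htI⟩, htmin⟩ := (isCompact_Icc.inter_right (hclosed.preimage hγ)).exists_isLeast
    (⟨1, ⟨zero_le_one, le_rfl⟩, by simpa [γ] using interior_subset hvI⟩ :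
      (Icc (0 : ℝ) 1 ∩ γ ⁻¹' I).Nonempty)
  have ht0 : 0 < t := by
    refine lt_of_le_of_ne ht.1 ?_
    rintro rfl
    exact hx (by simpa [γ, hI] using htI)
  set z := γ t with hz
  have hzI : z ∈ I := htI
  have hzs : IsSimple W z := hsimp t ⟨ht0, ht.2⟩
  have hznot : z ∉ interior I := by
    intro h
    have h1 : ∀ᶠ s in nhdsWithin t (Iio t), γ s ∈ I :=
      nhdsWithin_le_nhds ((hγ.tendsto t).eventually (mem_interior_iff_mem_nhds.1 h))
    obtain ⟨s, hs, hs'⟩ := (h1.and (Ioo_mem_nhdsLT ht0)).exists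
    exact absurd (htmin ⟨⟨hs'.1.le, hs'.2.le.trans ht.2⟩, hs⟩) (not_le.2 hs'.2)
  let u : ℝ → E := fun τ => z + τ • (v - z)
  have hu : Continuous u := by fun_prop
  have hu0 : u 0 = z := by simp [u]
  have huI : ∀ τ ∈ Ioc (0 : ℝ) 1, u τ ∈ interior I :=
    fun τ hτ => hconv.add_smul_sub_mem_interior hzI hvI hτ
  have hev : ∀ᶠ τ in nhdsWithin (0 : ℝ) (Ioi 0), u τ ∈ interior I := by
    filter_upwards [Ioo_mem_nhdsGT one_pos] with τ hτ using huI τ ⟨hτ.1, hτ.2.le⟩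
  obtain ⟨a, hza, hva⟩ : ∃ a : AffineRoot W, z ∈ a.wall ∧ 0 < a.val v := by
    have h1 : ∃ a : AffineRoot W, z ∈ a.wall := by
      by_contra h
      push Not at h
      have h1 : ∀ᶠ τ in nhdsWithin (0 : ℝ) (Ioi 0), IsGeneric W (u τ) ∧ u τ ∈ cell W z := by
        have := (hu.tendsto 0)
        rw [hu0] at this
        exact nhdsWithin_le_nhds (this.eventually
          (((isOpen_generic hW).eventually_mem h).and (cell_mem_nhds hW h)))
      obtain ⟨τ, hτ, hτ'⟩ := (hev.and h1).exists
      have h2 := hcell _ hτ'.1 hτ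
      rw [cell_eq_of_generic hτ'.1 hτ'.2] at h2
      exact hznot (mem_interior_iff_mem_nhds.2 (Filter.mem_of_superset (cell_mem_nhds hW h) h2))
    obtain ⟨a, ha⟩ := h1
    rcases lt_or_gt_of_ne (hv.val_ne a) with h | h
    · refine ⟨a.opp, ?_, by rw [val_opp]; linarith⟩
      rw [mem_wall] at *; rw [val_opp, ha, neg_zero]
    · exact ⟨a, ha, h⟩
  have hxa : a.val x < 0 := by
    have h1 := mem_wall.1 hza
    simp only [hz, γ] at h1
    rw [val_line] at h1
    by_contra h2
    push Not at h2
    have h3 : 0 ≤ (1 - t) * a.val x := mul_nonneg (by linarith [ht.2]) h2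
    have h4 : 0 < t * a.val v := mul_pos ht0 hva
    linarith
  -- A point `q` of the locus beyond this wall would, by convexity together with the interior points
  -- `u τ`, put the chambers on both sides of `z` into the locus and make `z` an interior point.
  refine ⟨a, fun q hq => ?_, by rw [mem_half]; linarith⟩
  by_contra hqa
  rw [mem_half, not_le] at hqa
  have hza' : z ∈ a.opp.wall := by
    rw [mem_wall] at *; rw [val_opp, hza, neg_zero]
  obtain ⟨y₀, hy₀, hay₀, hzy₀⟩ := exists_chamber_side hW hzs hza
  obtain ⟨y₁, hy₁, hay₁, hzy₁⟩ := exists_chamber_side hW hzs hza'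
  have h0 : cell W y₀ ⊆ I := by
    obtain ⟨ε, hε, h⟩ := exists_ball_side hW hzs hza
    have h1 : ∀ᶠ τ in nhdsWithin (0 : ℝ) (Ioi 0), dist (u τ) z < ε := by
      have := (hu.tendsto 0)
      rw [hu0] at this
      exact nhdsWithin_le_nhds (this.eventually (Metric.ball_mem_nhds z hε))
    obtain ⟨τ, ⟨hτ, hτ'⟩, hτ0⟩ := ((hev.and h1).and self_mem_nhdsWithin).exists
    have h2 : 0 < a.val (u τ) := by
      simp only [u]
      rw [val_line, mem_wall.1 hza, mul_zero, zero_add]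
      exact mul_pos hτ0 hva
    obtain ⟨h3, h4⟩ := h _ hτ' h2
    rw [← h4 y₀ hy₀ hzy₀ hay₀]
    exact hcell _ h3 hτ
  have h1 : cell W y₁ ⊆ I := by
    obtain ⟨ε, hε, h⟩ := exists_ball_side hW hzs hza'
    have h1 : ∀ᶠ σ in nhdsWithin (0 : ℝ) (Ioi 0), dist (z + σ • (q - z)) z < ε := by
      have hc : Continuous fun σ : ℝ => z + σ • (q - z) := by fun_prop
      have := hc.tendsto 0
      rw [zero_smul, add_zero] at this
      exact nhdsWithin_le_nhds (this.eventually (Metric.ball_mem_nhds z hε))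
    obtain ⟨σ, hσ, hσ'⟩ := (h1.and (Ioo_mem_nhdsGT one_pos)).exists
    have h2 : ∀ᶠ τ in nhdsWithin (0 : ℝ) (Ioi 0), dist (u τ + σ • (q - u τ)) z < ε ∧
        0 < a.opp.val (u τ + σ • (q - u τ)) := by
      have hc : Continuous fun τ : ℝ => u τ + σ • (q - u τ) := by fun_prop
      have h3 := hc.tendsto 0
      rw [hu0] at h3
      refine nhdsWithin_le_nhds (Filter.Eventually.and
        (h3.eventually (Metric.isOpen_ball.eventually_mem hσ))
        (h3.eventually ((isOpen_lt continuous_const a.opp.continuous_val).eventually_mem ?_)))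
      · show 0 < a.opp.val (z + σ • (q - z))
        rw [val_line, mem_wall.1 hza', mul_zero, zero_add, val_opp]
        exact mul_pos hσ'.1 (by linarith)
    obtain ⟨τ, hτ, hτ'⟩ := (hev.and h2).exists
    obtain ⟨h3, h4⟩ := h _ hτ'.1 hτ'.2
    rw [← h4 y₁ hy₁ hzy₁ hay₁]
    refine hcell _ h3 ?_
    have h5 := hconv.add_smul_sub_mem_interior hq hτ (t := 1 - σ)
      ⟨by linarith [hσ'.2], by linarith [hσ'.1]⟩
    convert h5 using 1
    module
  refine hznot (mem_interior_iff_mem_nhds.2 ?_)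
  obtain ⟨ε, hε, h⟩ := exists_ball_mem_cell hW z
  refine Filter.mem_of_superset (Metric.ball_mem_nhds z hε) fun p hp => ?_
  obtain ⟨y', hy', hpy'⟩ := exists_generic_cell hW p
  have hzy' := h p hp y' hpy'
  rcases lt_or_gt_of_ne (hy'.val_ne a) with h2 | h2
  · rw [cell_eq_of_same_side hW hzs hza' hy' hy₁ hzy' hzy₁ (by rw [val_opp]; linarith) hay₁] at hpy'
    exact h1 hpy'
  · rw [cell_eq_of_same_side hW hzs hza hy' hy₀ hzy' hzy₀ h2 hay₀] at hpy'
    exact h0 hpy'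

/-- If two charts agree on a chamber and at a simple point, they agree on the chamber at this point
on the same side of its wall. -/
theorem eqOn_cell_of_eq_simple (hW : IsAffineWeylGroup W) {f g : E → X} (hf : f ∈ B.charts)
    (hg : g ∈ B.charts) {y : E} (hy : IsGeneric W y) (heq : EqOn f g (cell W y)) {z : E}
    (hz : IsSimple W z) (hfz : f z = g z) {a : AffineRoot W} (hza : z ∈ a.wall)
    (hay : 0 < a.val y) {y₁ : E} (hzy₁ : z ∈ cell W y₁) (hay₁ : 0 < a.val y₁) :
    EqOn f g (cell W y₁) := by
  intro x hx
  by_contra hne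
  obtain ⟨b, hb, hxb⟩ := exists_root_separating hW hf hg hy heq hne
  have h1 : b.val y₁ < 0 := by
    by_contra h
    push Not at h
    exact hxb (hx b (mem_half.2 h))
  have h2 := mem_half.1 (hb z hfz)
  have h3 := hb y (heq (mem_cell_self y))
  have h4 := mem_cell_iff.1 hzy₁ b.opp (by rw [val_opp]; linarith)
  rw [val_opp] at h4
  rw [mem_half] at h3
  rcases hz a b hza (mem_wall.2 (by linarith)) with rfl | rfl
  · linarith
  · rw [val_opp] at h3; linarith

end AffineBuilding

end Retraction

/-! ### Completeness: building apartments from compatible chambers. -/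

section Extension

variable {E : Type*} [NormedAddCommGroup E] [InnerProductSpace ℝ E]
  {W : Subgroup (E ≃ᵃⁱ[ℝ] E)}

open AffineRoot

theorem eq_of_eqOn_cell (hW : IsAffineWeylGroup W) {v w : E ≃ᵃⁱ[ℝ] E} {y : E}
    (hy : IsGeneric W y) (h : EqOn v w (cell W y)) : v = w := by
  have : w⁻¹ * v = 1 := by
    refine eq_one_of_fixes_open (isOpen_interior (s := cell W y))
      ⟨y, mem_interior_iff_mem_nhds.2 (cell_mem_nhds hW hy)⟩ fun u hu => ?_
    rw [AffineIsometryEquiv.coe_mul, Function.comp_apply, h (interior_subset hu)]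
    simp
  exact (inv_mul_eq_one.1 this).symm

theorem adjacent_cases (hW : IsAffineWeylGroup W) {y y' z : E} (hy : IsGeneric W y)
    (hy' : IsGeneric W y') (hz : IsSimple W z) (hzy : z ∈ cell W y) (hzy' : z ∈ cell W y') :
    cell W y = cell W y' ∨ ∃ a : AffineRoot W, z ∈ a.wall ∧ 0 < a.val y ∧ a.val y' < 0 := by
  by_cases h : IsGeneric W z
  · left
    rw [← cell_eq_of_generic h hzy, cell_eq_of_generic h hzy']
  · obtain ⟨a, ha, hay⟩ : ∃ a : AffineRoot W, z ∈ a.wall ∧ 0 < a.val y := by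
      simp only [IsGeneric, not_forall, not_not] at h
      obtain ⟨a, ha⟩ := h
      rcases lt_or_gt_of_ne (hy.val_ne a) with h | h
      · refine ⟨a.opp, ?_, by rw [val_opp]; linarith⟩
        rw [mem_wall] at *; rw [val_opp, ha, neg_zero]
      · exact ⟨a, ha, h⟩
    rcases lt_or_gt_of_ne (hy'.val_ne a) with h | h
    · exact Or.inr ⟨a, ha, hay, h⟩
    · exact Or.inl (cell_eq_of_same_side hW hz ha hy hy' hzy hzy' hay h)

namespace AffineBuilding

variable {X : Type*} {B : AffineBuilding W X} [FiniteDimensional ℝ E]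

theorem exists_generic_cell_half (hW : IsAffineWeylGroup W) {a : AffineRoot W} {x : E}
    (hx : x ∈ a.half) : ∃ y, IsGeneric W y ∧ x ∈ cell W y ∧ 0 < a.val y := by
  obtain ⟨ε, hε, h⟩ := exists_ball_mem_cell hW x
  set p := x + (ε / 2) • a.normal with hp
  obtain ⟨y, hy, hg⟩ := exists_generic_mem hW (Metric.isOpen_ball (x := p) (ε := ε / 2))
    ⟨p, Metric.mem_ball_self (by positivity)⟩
  have hy' : dist y p < ε / 2 := hy
  have h1 : dist p x = ε / 2 := by
    rw [hp, dist_eq_norm, add_sub_cancel_left, norm_smul, a.norm_normal, Real.norm_eq_abs,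
      abs_of_pos (by positivity), mul_one]
  have h2 : a.val p = a.val x + ε / 2 := by rw [hp, val_add_smul_normal]
  have h3 := (abs_le.1 (a.abs_val_sub_le y p)).1
  rw [mem_half] at hx
  exact ⟨y, hg, h y (by linarith [dist_triangle y p x]) y (mem_cell_self y), by linarith⟩

section Completeness

variable {k : E → X}

theorem injective_of_pairwise (hW : IsAffineWeylGroup W)
    (hk : ∀ y y', IsGeneric W y → IsGeneric W y' →
      ∃ h ∈ B.charts, EqOn h k (cell W y) ∧ EqOn h k (cell W y')) : Function.Injective k := by
  intro x x' hxx
  obtain ⟨y, hy, hxy⟩ := exists_generic_cell hW x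
  obtain ⟨y', hy', hxy'⟩ := exists_generic_cell hW x'
  obtain ⟨h, hh, h1, h2⟩ := hk y y' hy hy'
  rw [← h1 hxy, ← h2 hxy'] at hxx
  exact B.injective h hh hxx

/-- The comparison element found for a pair `y`, `y'` is already determined on the chamber of `y`,
so it is the same for every `y'`. -/
theorem compatible_left_of_pairwise (hW : IsAffineWeylGroup W)
    (hk : ∀ y y', IsGeneric W y → IsGeneric W y' →
      ∃ h ∈ B.charts, EqOn h k (cell W y) ∧ EqOn h k (cell W y'))
    {g : E → X} (hg : g ∈ B.charts) {y : E} (hy : IsGeneric W y)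
    (hyg : k '' cell W y ⊆ range g) : ∃ v ∈ W, ∀ x, k x ∈ range g → k x = g (v x) := by
  have key : ∀ y', IsGeneric W y' → ∃ v ∈ W, EqOn k (g ∘ v) (cell W y) ∧
      ∀ x ∈ cell W y', k x ∈ range g → k x = g (v x) := by
    intro y' hy'
    obtain ⟨h, hh, h1, h2⟩ := hk y y' hy hy'
    obtain ⟨v, hv, hvx⟩ := B.compatible h hh g hg ⟨_, cell_mem_modelChambers hy, by
      rw [h1.image_eq]; exact hyg⟩
    refine ⟨v, hv, fun u hu => ?_, fun x hx hxg => ?_⟩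
    · have := hvx u (by rw [h1 hu]; exact hyg (mem_image_of_mem k hu))
      rwa [h1 hu] at this
    · rw [← h2 hx] at hxg ⊢
      exact hvx x hxg
  obtain ⟨v, hv, hvy, -⟩ := key y hy
  refine ⟨v, hv, fun x hx => ?_⟩
  obtain ⟨y', hy', hxy'⟩ := exists_generic_cell hW x
  obtain ⟨v', hv', hvy', h'⟩ := key y' hy'
  have : v = v' := eq_of_eqOn_cell hW hy fun u hu =>
    B.injective g hg ((hvy hu).symm.trans (hvy' hu))
  rw [this]
  exact h' x hxy' hx

/-- As `y` is generic, a chamber of `k` through the point `f y` must be the image of the chamber of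
`y` under `f`. So `compatible_left_of_pairwise` applies and gives the inverse of the required
element. -/
theorem compatible_right_of_pairwise (hW : IsAffineWeylGroup W)
    (hk : ∀ y y', IsGeneric W y → IsGeneric W y' →
      ∃ h ∈ B.charts, EqOn h k (cell W y) ∧ EqOn h k (cell W y'))
    {f : E → X} (hf : f ∈ B.charts) {y : E} (hy : IsGeneric W y)
    (hyf : f '' cell W y ⊆ range k) : ∃ v ∈ W, ∀ x, f x ∈ range k → f x = k (v x) := by
  obtain ⟨y', hyy'⟩ := hyf (mem_image_of_mem f (mem_cell_self y))
  obtain ⟨y'', hy'', hy'y''⟩ := exists_generic_cell hW y'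
  obtain ⟨h, hh, h1, -⟩ := hk y'' y'' hy'' hy''
  obtain ⟨i, hi, hif, hr, w, hw, hhw⟩ := exists_chart_through hh hf hy hy''
  have h2 : h y' = f y := by rw [h1 hy'y'', hyy']
  have h3 : y = w y' := by
    have := hhw y' (hr (mem_image_of_mem h hy'y''))
    rw [h2, ← hif (mem_cell_self y)] at this
    exact B.injective i hi this
  have hsub : k '' cell W y'' ⊆ range f := by
    rintro _ ⟨u, hu, rfl⟩
    rw [← h1 hu, hhw u (hr (mem_image_of_mem h hu))]
    have h4 : w u ∈ cell W y := by
      have h5 := mem_cell_map hw hy'y''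
      rw [← h3] at h5
      rw [cell_eq_of_generic hy h5]
      exact mem_cell_map hw hu
    rw [hif h4]
    exact mem_range_self _
  obtain ⟨v, hv, hvx⟩ := compatible_left_of_pairwise hW hk hf hy'' hsub
  refine ⟨v⁻¹, W.inv_mem hv, ?_⟩
  rintro x ⟨x', hx'⟩
  have h4 := hvx x' (by rw [hx']; exact mem_range_self x)
  rw [hx'] at h4
  have h5 := B.injective f hf h4
  rw [← hx', h5]
  simp

/-- In a complete system of apartments, a map that is pairwise on chambers given by charts is a
chart. -/
theorem mem_charts_of_pairwise (hW : IsAffineWeylGroup W) (hB : B.IsComplete)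
    (hk : ∀ y y', IsGeneric W y → IsGeneric W y' →
      ∃ h ∈ B.charts, EqOn h k (cell W y) ∧ EqOn h k (cell W y')) : k ∈ B.charts := by
  have himg : ∀ f ∈ B.charts ∪ {f | ∃ w ∈ W, f = k ∘ w}, ∀ D ∈ modelChambers W,
      ∃ h ∈ B.charts, h '' D = f '' D := by
    rintro f (hf | ⟨w, hw, rfl⟩) D ⟨y, hy, rfl⟩
    · exact ⟨f, hf, rfl⟩
    · obtain ⟨h, hh, h1, -⟩ := hk _ _ (isGeneric_map hw hy) (isGeneric_map hw hy)
      refine ⟨h ∘ w, B.comp_mem _ hh _ hw, ?_⟩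
      change (h ∘ w) '' cell W y = (k ∘ w) '' cell W y
      rw [image_comp, image_comp, image_cell hw, h1.image_eq]
  -- Adjoining the compositions of `k` with `W` to the charts again gives a building, so maximality
  -- puts `k` into the system.
  let B' : AffineBuilding W X :=
    { charts := B.charts ∪ {f | ∃ w ∈ W, f = k ∘ w}
      injective := by
        rintro f (hf | ⟨w, hw, rfl⟩)
        · exact B.injective f hf
        · exact (injective_of_pairwise hW hk).comp w.injective
      comp_mem := by
        rintro f (hf | ⟨w, hw, rfl⟩) v hv
        · exact Or.inl (B.comp_mem f hf v hv)
        · exact Or.inr ⟨w * v, W.mul_mem hw hv, rfl⟩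
      cover := fun p => by
        obtain ⟨f, hf, hp⟩ := B.cover p
        exact ⟨f, Or.inl hf, hp⟩
      common_apartment := by
        intro f hf g hg D hD D' hD'
        obtain ⟨f', hf', h1⟩ := himg f hf D hD
        obtain ⟨g', hg', h2⟩ := himg g hg D' hD'
        obtain ⟨h, hh, h3, h4⟩ := B.common_apartment f' hf' g' hg' D hD D' hD'
        exact ⟨h, Or.inl hh, h1 ▸ h3, h2 ▸ h4⟩
      compatible := by
        rintro f (hf | ⟨w, hw, rfl⟩) g (hg | ⟨v, hv, rfl⟩) ⟨_, ⟨y, hy, rfl⟩, hD⟩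
        · exact B.compatible f hf g hg ⟨_, ⟨y, hy, rfl⟩, hD⟩
        · rw [v.surjective.range_comp] at *
          obtain ⟨u, hu, h⟩ := compatible_right_of_pairwise hW hk hf hy hD
          refine ⟨v⁻¹ * u, W.mul_mem (W.inv_mem hv) hu, fun x hx => ?_⟩
          rw [h x hx]
          simp [AffineIsometryEquiv.coe_mul]
        · change (k ∘ w) '' cell W y ⊆ _ at hD
          rw [image_comp, image_cell hw] at hD
          obtain ⟨u, hu, h⟩ := compatible_left_of_pairwise hW hk hg (isGeneric_map hw hy) hD
          exact ⟨u * w, W.mul_mem hu hw, fun x hx => h _ hx⟩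
        · refine ⟨v⁻¹ * w, W.mul_mem (W.inv_mem hv) hw, fun x _ => ?_⟩
          simp [AffineIsometryEquiv.coe_mul] }
  have h := hB B' subset_union_left
  rw [← h]
  exact Or.inr ⟨1, W.one_mem, rfl⟩

end Completeness

section Adjacent

variable {z y₀ y₁ : E} {a : AffineRoot W}

/-- A common apartment `i` of the chamber of `g` at `y` and the chamber of `j` at `y₁` contains `g
z`. As `y` and `y₀` lie on the same side of the wall, `i` agrees with `g`, hence with `j`, on the
chamber of `y₀`; this forces `i` to agree with `j` on the chamber of `y₁`. -/
theorem exists_chart_adjacent (hW : IsAffineWeylGroup W) {g j : E → X} (hg : g ∈ B.charts)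
    (hj : j ∈ B.charts) (hz : IsSimple W z) (hza : z ∈ a.wall) (hy₀ : IsGeneric W y₀)
    (hy₁ : IsGeneric W y₁) (hzy₀ : z ∈ cell W y₀) (hzy₁ : z ∈ cell W y₁) (hay₀ : 0 < a.val y₀)
    (hgj : EqOn g j (cell W y₀)) {y : E} (hy : IsGeneric W y) (hay : 0 < a.val y) :
    ∃ i ∈ B.charts, EqOn i g (cell W y) ∧ EqOn i j (cell W y₁) := by
  obtain ⟨i, hi, hig, hr, -⟩ := exists_chart_through hj hg hy hy₁
  have h1 : g z = i z := by
    refine eq_of_mem_range hW hg hi hy hig.symm ?_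
    rw [hgj hzy₀]
    exact hr (mem_image_of_mem j hzy₁)
  have h2 : EqOn i g (cell W y₀) :=
    eqOn_cell_of_eq_simple hW hi hg hy hig hz h1.symm hza hay hzy₀ hay₀
  refine ⟨i, hi, hig, fun x hx => ?_⟩
  exact (eq_of_mem_range hW hj hi hy₀ (h2.trans hgj).symm (hr (mem_image_of_mem j hx))).symm

/-- Retract onto `h` from its chamber at `y`. Through `g`, the retraction sends `k u` to `u` on the
chamber of `y'`, and it sends `k z` to `z`; hence it does so on segments from `z` to that chamber.
These fill an open part of the chamber of `y₁`, so the comparison element is trivial there. Thus `k`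
equals on that chamber a chart `i` that agrees with `h` at `z` and on the chamber of `y`, which lies
on the same side as `y₁`. -/
theorem eqOn_cell_opposite (hW : IsAffineWeylGroup W) {g h k : E → X} (hg : g ∈ B.charts)
    (hh : h ∈ B.charts) (hk : k ∈ B.charts) (hz : IsSimple W z) (hza : z ∈ a.wall)
    (hy₁ : IsGeneric W y₁) (hzy₀ : z ∈ cell W y₀) (hzy₁ : z ∈ cell W y₁)
    (hay₁ : a.val y₁ < 0) {y y' : E} (hy : IsGeneric W y)
    (hy' : IsGeneric W y') (hay : a.val y < 0) (hay' : a.val y' < 0)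
    (hkh : EqOn k h (cell W y₀)) (hgh : EqOn g h (cell W y)) (hgk : EqOn g k (cell W y')) :
    EqOn k h (cell W y₁) := by
  have hza' : z ∈ a.opp.wall := by rw [mem_wall] at *; rw [val_opp, hza, neg_zero]
  have hρ : ∀ u ∈ cell W y', B.retr h y (k u) = u := fun u hu => by
    rw [← hgk hu, retr_eq hW hy hg hgh]
  have hρz : B.retr h y (k z) = z := by
    rw [hkh hzy₀, retr_eq hW hy hh (eqOn_refl _ _)]
  obtain ⟨i, hi, hih, hr, w, hw, hkw⟩ := exists_chart_through hk hh hy hy₁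
  have hρw : ∀ x ∈ cell W y₁, B.retr h y (k x) = w x := fun x hx => by
    rw [hkw x (hr (mem_image_of_mem k hx)), retr_eq hW hy hi hih]
  have hw1 : w = 1 := by
    obtain ⟨ε, hε, hside⟩ := exists_ball_side hW hz hza'
    have h1 : ∀ᶠ τ in nhdsWithin (0 : ℝ) (Ioi 0), dist (z + τ • (y' - z)) z < ε := by
      have hc : Continuous fun τ : ℝ => z + τ • (y' - z) := by fun_prop
      have := hc.tendsto 0
      rw [zero_smul, add_zero] at this
      exact nhdsWithin_le_nhds (this.eventually (Metric.ball_mem_nhds z hε))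
    obtain ⟨τ, hτ, hτ'⟩ := (h1.and (Ioo_mem_nhdsGT one_pos)).exists
    have h2 : 0 < a.opp.val (z + τ • (y' - z)) := by
      rw [val_line, mem_wall.1 hza', mul_zero, zero_add, val_opp]
      exact mul_pos hτ'.1 (by linarith)
    obtain ⟨h3, h4⟩ := hside _ hτ h2
    have h5 := h4 y₁ hy₁ hzy₁ (by rw [val_opp]; linarith)
    have hc : Continuous fun x : E => z + τ⁻¹ • (x - z) := by fun_prop
    refine eq_one_of_fixes_open (U := interior (cell W y₁) ∩
      (fun x => z + τ⁻¹ • (x - z)) ⁻¹' interior (cell W y'))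
      (isOpen_interior.inter (isOpen_interior.preimage hc)) ⟨z + τ • (y' - z), ?_, ?_⟩ ?_
    · rw [← h5]
      exact mem_interior_iff_mem_nhds.2 (cell_mem_nhds hW h3)
    · rw [mem_preimage, add_sub_cancel_left, smul_smul, inv_mul_cancel₀ hτ'.1.ne', one_smul,
        add_sub_cancel]
      exact mem_interior_iff_mem_nhds.2 (cell_mem_nhds hW hy')
    · rintro x ⟨hx1, hx2⟩
      rw [← hρw x (interior_subset hx1)]
      refine retr_eq_of_segment hW hk hh hy hρz (hρ _ (interior_subset hx2)) ?_
      rw [segment_eq_image']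
      refine ⟨τ, ⟨hτ'.1.le, hτ'.2.le⟩, ?_⟩
      simp only [add_sub_cancel_left]
      rw [smul_smul, mul_inv_cancel₀ hτ'.1.ne', one_smul, add_sub_cancel]
  have hki : EqOn k i (cell W y₁) := fun x hx => by
    have := hkw x (hr (mem_image_of_mem k hx))
    rwa [hw1] at this
  refine hki.trans ?_
  refine eqOn_cell_of_eq_simple hW hi hh hy hih hz ?_ hza' (by rw [val_opp]; linarith) hzy₁
    (by rw [val_opp]; linarith)
  rw [← hki hzy₁, hkh hzy₀]

/-- A pairwise compatible family of chambers can be extended to an adjacent chamber. -/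
theorem exists_chart_extend_one (hW : IsAffineWeylGroup W) {M : Set (E × (E → X))}
    (hgen : ∀ p ∈ M, IsGeneric W p.1)
    (hpair : ∀ p ∈ M, ∀ q ∈ M, ∃ h ∈ B.charts, EqOn h p.2 (cell W p.1) ∧ EqOn h q.2 (cell W q.1))
    {f₀ : E → X} (hf₀ : (y₀, f₀) ∈ M) (hz : IsSimple W z) (hza : z ∈ a.wall)
    (hy₁ : IsGeneric W y₁) (hzy₀ : z ∈ cell W y₀) (hzy₁ : z ∈ cell W y₁) (hay₀ : 0 < a.val y₀)
    (hay₁ : a.val y₁ < 0) : ∃ f ∈ B.charts, ∀ q ∈ M, ∃ h ∈ B.charts,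
      EqOn h q.2 (cell W q.1) ∧ EqOn h f (cell W y₁) := by
  have hy₀ := hgen _ hf₀
  -- The new chamber is read off from `f`. A member of the family beyond the wall dictates the
  -- choice; if there is none, any apartment through the chamber of `y₀` will do.
  obtain ⟨f, hf, hf0, hcase⟩ : ∃ f ∈ B.charts, EqOn f f₀ (cell W y₀) ∧
      ((∀ q ∈ M, 0 < a.val q.1) ∨ ∃ p ∈ M, a.val p.1 < 0 ∧ EqOn f p.2 (cell W p.1)) := by
    by_cases h : ∃ p ∈ M, a.val p.1 < 0
    · obtain ⟨p, hp, hap⟩ := h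
      obtain ⟨f, hf, h1, h2⟩ := hpair _ hf₀ _ hp
      exact ⟨f, hf, h1, Or.inr ⟨p, hp, hap, h2⟩⟩
    · push Not at h
      obtain ⟨f, hf, h1, h2⟩ := hpair _ hf₀ _ hf₀
      exact ⟨f, hf, h1, Or.inl fun q hq => lt_of_le_of_ne (h q hq) ((hgen q hq).val_ne a).symm⟩
  refine ⟨f, hf, fun q hq => ?_⟩
  obtain ⟨k, hk, hk0, hkq⟩ := hpair _ hf₀ _ hq
  rcases lt_or_gt_of_ne ((hgen q hq).val_ne a) with haq | haq
  · rcases hcase with hcase | ⟨p, hp, hap, hfp⟩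
    · exact absurd (hcase q hq) (not_lt.2 haq.le)
    obtain ⟨g, hg, hgp, hgq⟩ := hpair _ hp _ hq
    exact ⟨k, hk, hkq, eqOn_cell_opposite hW hg hf hk hz hza hy₁ hzy₀ hzy₁ hay₁ (hgen p hp)
      (hgen q hq) hap haq (hk0.trans hf0.symm) (hgp.trans hfp.symm) (hgq.trans hkq.symm)⟩
  · obtain ⟨i, hi, h1, h2⟩ := exists_chart_adjacent hW hk hf hz hza hy₀ hy₁ hzy₀ hzy₁ hay₀
      (hk0.trans hf0.symm) (hgen q hq) haq
    exact ⟨i, hi, h1.trans hkq, h2⟩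

end Adjacent

/-- In a complete system of apartments, a pairwise compatible family of chambers lies in an
apartment. -/
theorem exists_chart_extending (hW : IsAffineWeylGroup W) (hB : B.IsComplete)
    {Γ : Set (E × (E → X))} (hne : Γ.Nonempty) (hgen : ∀ p ∈ Γ, IsGeneric W p.1)
    (hpair : ∀ p ∈ Γ, ∀ q ∈ Γ, ∃ h ∈ B.charts, EqOn h p.2 (cell W p.1) ∧
      EqOn h q.2 (cell W q.1)) : ∃ k ∈ B.charts, ∀ p ∈ Γ, EqOn k p.2 (cell W p.1) := by
  let S : Set (Set (E × (E → X))) := {M | (∀ p ∈ M, IsGeneric W p.1) ∧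
    ∀ p ∈ M, ∀ q ∈ M, ∃ h ∈ B.charts, EqOn h p.2 (cell W p.1) ∧ EqOn h q.2 (cell W q.1)}
  obtain ⟨M, hΓM, hM⟩ := zorn_subset_nonempty S (by
    intro c hc hchain _
    refine ⟨⋃₀ c, ⟨?_, ?_⟩, fun s hs => subset_sUnion_of_mem hs⟩
    · rintro p ⟨s, hs, hp⟩
      exact (hc hs).1 p hp
    · rintro p ⟨s, hs, hp⟩ q ⟨t, ht, hq⟩
      rcases hchain.total hs ht with h | h
      · exact (hc ht).2 p (h hp) q hq
      · exact (hc hs).2 p hp q (h hq)) Γ ⟨hgen, hpair⟩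
  obtain ⟨hMgen, hMpair⟩ := hM.prop
  -- By gallery induction a maximal compatible family has a chamber over every generic point, since
  -- an adjacent chamber could always be added.
  have hall : ∀ y, IsGeneric W y → ∃ f, (y, f) ∈ M := by
    intro y hy
    refine generic_connected hW (Y := {y | ∃ f, (y, f) ∈ M}) ?_ ?_ hy
    · obtain ⟨p, hp⟩ := hne
      exact ⟨p.1, ⟨p.2, hΓM hp⟩, hgen p hp⟩
    · rintro y₀ ⟨f₀, hf₀⟩ hy₀ y₁ hy₁ z hz hzy₀ hzy₁
      obtain ⟨f, hf, h⟩ : ∃ f ∈ B.charts, ∀ q ∈ M, ∃ h ∈ B.charts,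
          EqOn h q.2 (cell W q.1) ∧ EqOn h f (cell W y₁) := by
        rcases adjacent_cases hW hy₀ hy₁ hz hzy₀ hzy₁ with h | ⟨a, hza, hay₀, hay₁⟩
        · obtain ⟨f, hf, hf0, -⟩ := hMpair _ hf₀ _ hf₀
          refine ⟨f, hf, fun q hq => ?_⟩
          obtain ⟨k, hk, h1, h2⟩ := hMpair _ hq _ hf₀
          exact ⟨k, hk, h1, by rw [← h]; exact h2.trans hf0.symm⟩
        · exact exists_chart_extend_one hW hMgen hMpair hf₀ hz hza hy₁ hzy₀ hzy₁ hay₀ hay₁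
      refine ⟨f, ?_⟩
      have hins : insert (y₁, f) M ∈ S := by
        constructor
        · rintro p (rfl | hp)
          · exact hy₁
          · exact hMgen p hp
        · rintro p (rfl | hp) q (rfl | hq)
          · exact ⟨f, hf, eqOn_refl _ _, eqOn_refl _ _⟩
          · obtain ⟨k, hk, h1, h2⟩ := h q hq
            exact ⟨k, hk, h2, h1⟩
          · exact h p hp
          · exact hMpair p hp q hq
      exact hM.le_of_ge hins (subset_insert _ _) (mem_insert _ _)
  have : Nonempty (E → X) := ⟨hne.some.2⟩
  choose! F hF using hall
  choose c hc hxc using exists_generic_cell (W := W) hW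
  let k : E → X := fun x => F (c x) x
  have hkeq : ∀ p ∈ M, EqOn k p.2 (cell W p.1) := by
    intro p hp x hx
    obtain ⟨h, hh, h1, h2⟩ := hMpair _ hp _ (hF (c x) (hc x))
    show F (c x) x = p.2 x
    rw [← h1 hx]
    exact (h2 (hxc x)).symm
  refine ⟨k, mem_charts_of_pairwise hW hB fun y y' hy hy' => ?_, fun p hp => hkeq p (hΓM hp)⟩
  obtain ⟨h, hh, h1, h2⟩ := hMpair _ (hF y hy) _ (hF y' hy')
  exact ⟨h, hh, h1.trans (hkeq _ (hF y hy)).symm, h2.trans (hkeq _ (hF y' hy')).symm⟩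

/-- A half apartment and an adjacent chamber lie in a common apartment. -/
theorem exists_chart_half (hW : IsAffineWeylGroup W) (hB : B.IsComplete) {g j : E → X}
    (hg : g ∈ B.charts) (hj : j ∈ B.charts) {z y₀ y₁ : E} {a : AffineRoot W}
    (hz : IsSimple W z) (hza : z ∈ a.wall) (hy₀ : IsGeneric W y₀) (hy₁ : IsGeneric W y₁)
    (hzy₀ : z ∈ cell W y₀) (hzy₁ : z ∈ cell W y₁) (hay₀ : 0 < a.val y₀)
    (hgj : EqOn g j (cell W y₀)) :
    ∃ k ∈ B.charts, EqOn k g a.half ∧ EqOn k j (cell W y₁) := by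
  obtain ⟨k, hk, h⟩ := exists_chart_extending hW hB
    (Γ := insert (y₁, j) {p : E × (E → X) | IsGeneric W p.1 ∧ 0 < a.val p.1 ∧ p.2 = g})
    ⟨_, mem_insert _ _⟩ (by
      rintro p (rfl | hp)
      · exact hy₁
      · exact hp.1) (by
      rintro p (rfl | ⟨hp, hap, hpg⟩) q (rfl | ⟨hq, haq, hqg⟩)
      · exact ⟨j, hj, eqOn_refl _ _, eqOn_refl _ _⟩
      · obtain ⟨i, hi, h1, h2⟩ := exists_chart_adjacent hW hg hj hz hza hy₀ hy₁ hzy₀ hzy₁ hay₀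
          hgj hq haq
        exact ⟨i, hi, h2, hqg ▸ h1⟩
      · obtain ⟨i, hi, h1, h2⟩ := exists_chart_adjacent hW hg hj hz hza hy₀ hy₁ hzy₀ hzy₁ hay₀
          hgj hp hap
        exact ⟨i, hi, hpg ▸ h1, h2⟩
      · exact ⟨g, hg, hpg ▸ eqOn_refl _ _, hqg ▸ eqOn_refl _ _⟩)
  refine ⟨k, hk, fun x hx => ?_, h _ (mem_insert _ _)⟩
  obtain ⟨y, hy, hxy, hay⟩ := exists_generic_cell_half hW hx
  exact h (y, g) (Or.inr ⟨hy, hay, rfl⟩) hxy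

end AffineBuilding

end Extension

/-! ### Charts agreeing far out in given directions; apartments through a chamber at infinity. -/

section Directions

variable {E : Type*} [NormedAddCommGroup E] [InnerProductSpace ℝ E]
  {W : Subgroup (E ≃ᵃⁱ[ℝ] E)} {X : Type*}

open AffineRoot

/-- Two charts agree at all points that are deep with respect to the normals in `Ψ`. -/
def AgreeOn (Ψ : Set E) (g h : E → X) : Prop :=
  ∃ m : ℝ, ∀ x, (∀ c ∈ Ψ, m ≤ ⟪c, x⟫) → g x = h x

namespace AgreeOn

variable {Ψ Ψ' : Set E} {g h k : E → X}

theorem refl (Ψ : Set E) (g : E → X) : AgreeOn Ψ g g := ⟨0, fun _ _ => rfl⟩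

theorem symm (H : AgreeOn Ψ g h) : AgreeOn Ψ h g := by
  obtain ⟨m, hm⟩ := H
  exact ⟨m, fun x hx => (hm x hx).symm⟩

theorem trans (H : AgreeOn Ψ g h) (H' : AgreeOn Ψ h k) : AgreeOn Ψ g k := by
  obtain ⟨m, hm⟩ := H
  obtain ⟨m', hm'⟩ := H'
  refine ⟨max m m', fun x hx => (hm x fun c hc => ?_).trans (hm' x fun c hc => ?_)⟩
  · exact (le_max_left _ _).trans (hx c hc)
  · exact (le_max_right _ _).trans (hx c hc)

theorem mono (H : AgreeOn Ψ g h) (hΨ : Ψ ⊆ Ψ') : AgreeOn Ψ' g h := by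
  obtain ⟨m, hm⟩ := H
  exact ⟨m, fun x hx => hm x fun c hc => hx c (hΨ hc)⟩

theorem of_eqOn_half {a : AffineRoot W} (H : EqOn g h a.half) (ha : a.normal ∈ Ψ) :
    AgreeOn Ψ g h :=
  ⟨a.level, fun _ hx => H (hx _ ha)⟩

end AgreeOn

/-- The normals that are positive on `ξ`. -/
def posNormals (W : Subgroup (E ≃ᵃⁱ[ℝ] E)) (ξ : E) : Set E :=
  {c | c ∈ range (AffineRoot.normal (W := W)) ∧ 0 < ⟪c, ξ⟫}

theorem nonneg_of_forall_add_mul {A C : ℝ} (h : ∀ t : ℝ, 0 ≤ t → 0 ≤ A + t * C) : 0 ≤ C := by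
  by_contra hC
  push Not at hC
  have h1 := h (|A| / -C + 1) (by have : 0 < -C := by linarith
                                  positivity)
  have h2 : |A| / -C * C = -|A| := by
    rw [div_neg, neg_mul, div_mul_cancel₀ _ hC.ne]
  have h3 := le_abs_self A
  nlinarith

theorem eventually_deep {Ψ : Set E} (hΨ : Ψ.Finite) {η : E} (h : ∀ c ∈ Ψ, 0 < ⟪c, η⟫) (p : E)
    (m : ℝ) : ∀ᶠ t : ℝ in Filter.atTop, ∀ c ∈ Ψ, m ≤ ⟪c, p + t • η⟫ := by
  rw [Filter.eventually_all_finite hΨ]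
  intro c hc
  filter_upwards [Filter.eventually_ge_atTop ((m - ⟪c, p⟫) / ⟪c, η⟫)] with t ht
  rw [div_le_iff₀ (h c hc)] at ht
  rw [inner_add_right, inner_smul_right]
  linarith

variable [FiniteDimensional ℝ E]

theorem finite_posNormals (hW : IsAffineWeylGroup W) (ξ : E) : (posNormals W ξ).Finite :=
  (finite_normals hW).subset fun _ h => h.1

/-- Every positive normal belongs to a root of level at least `m`. A generic point far out in
direction `ξ` lies in all these finitely many roots, and then so does its whole cell. -/
theorem exists_cell_deep (hW : IsAffineWeylGroup W) (ξ : E) (m : ℝ) :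
    ∃ y, IsGeneric W y ∧ ∀ x ∈ cell W y, ∀ c ∈ posNormals W ξ, m ≤ ⟪c, x⟫ := by
  have h : ∀ c : E, ∃ M : ℝ, c ∈ posNormals W ξ → ∃ b : AffineRoot W,
      b.normal = c ∧ m ≤ b.level ∧ b.level = M := by
    intro c
    by_cases hc : c ∈ posNormals W ξ
    · obtain ⟨a, ha⟩ := hc.1
      obtain ⟨b, hb, hm⟩ := exists_level_ge hW a m
      exact ⟨b.level, fun _ => ⟨b, hb.trans ha, hm, rfl⟩⟩
    · exact ⟨0, fun h => absurd h hc⟩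
  choose M hM using h
  have hfin := finite_posNormals hW ξ
  obtain ⟨y, hyO, hy⟩ := exists_generic_mem hW (O := ⋂ c ∈ posNormals W ξ, {y | M c < ⟪c, y⟫})
    (hfin.isOpen_biInter fun c _ => isOpen_lt continuous_const (by fun_prop)) (by
      have h1 : ∀ᶠ t : ℝ in Filter.atTop, ∀ c ∈ posNormals W ξ, M c < ⟪c, t • ξ⟫ := by
        rw [Filter.eventually_all_finite hfin]
        intro c hc
        filter_upwards [Filter.eventually_gt_atTop (M c / ⟪c, ξ⟫)] with t ht
        rw [div_lt_iff₀ hc.2] at ht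
        rwa [inner_smul_right]
      obtain ⟨t, ht⟩ := h1.exists
      exact ⟨t • ξ, mem_iInter₂.2 ht⟩)
  refine ⟨y, hy, fun x hx c hc => ?_⟩
  obtain ⟨b, hb, hm, hbM⟩ := hM c hc
  have h1 : M c < ⟪c, y⟫ := mem_iInter₂.1 hyO c hc
  have h2 := hx b (by rw [half, mem_ofPred_eq, hb, hbM]; exact h1.le)
  rw [half, mem_ofPred_eq, hb] at h2
  exact hm.trans h2

namespace AffineBuilding

variable {B : AffineBuilding W X} {ξ : E}

theorem exists_eqOn_cell (hW : IsAffineWeylGroup W) {g h : E → X}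
    (H : AgreeOn (posNormals W ξ) g h) : ∃ y, IsGeneric W y ∧ EqOn g h (cell W y) := by
  obtain ⟨m, hm⟩ := H
  obtain ⟨y, hy, hd⟩ := exists_cell_deep hW ξ m
  exact ⟨y, hy, fun x hx => hm x (hd x hx)⟩

theorem eq_of_forall_roots (hW : IsAffineWeylGroup W) {g h : E → X} (hg : g ∈ B.charts)
    (hh : h ∈ B.charts) (H : AgreeOn (posNormals W ξ) g h) {x : E}
    (hx : ∀ b : AffineRoot W, {u | g u = h u} ⊆ b.half → x ∈ b.half) : g x = h x := by
  obtain ⟨y, hy, heq⟩ := exists_eqOn_cell hW H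
  by_contra hne
  obtain ⟨b, hb, hxb⟩ := exists_root_separating hW hg hh hy heq hne
  exact hxb (hx b hb)

/-- Agreement deep in the sector includes a whole chamber, which fixes the coordinates. This is what
turns intersections of apartments into agreement loci. -/
theorem eq_of_mem_range_of_agreeOn (hW : IsAffineWeylGroup W) {g h : E → X} (hg : g ∈ B.charts)
    (hh : h ∈ B.charts) (H : AgreeOn (posNormals W ξ) g h) {x : E} (hx : g x ∈ range h) :
    g x = h x := by
  obtain ⟨y, hy, heq⟩ := exists_eqOn_cell hW H
  exact eq_of_mem_range hW hg hh hy heq hx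

/-- Every chamber of the building lies in an apartment that has the same chamber at infinity as
the apartment of `f` in the direction `ξ`. -/
theorem exists_chart_chamber (hW : IsAffineWeylGroup W) (hB : B.IsComplete)
    (hξ : ∀ a : AffineRoot W, ⟪a.normal, ξ⟫ ≠ 0) {f f' : E → X} (hf : f ∈ B.charts)
    (hf' : f' ∈ B.charts) {y : E} (hy : IsGeneric W y) :
    ∃ g ∈ B.charts, AgreeOn (posNormals W ξ) g f ∧ f' '' cell W y ⊆ range g := by
  obtain ⟨y₀, hy₀, -⟩ := exists_generic_cell hW (0 : E)
  obtain ⟨h, hh, hhf, hr, w₁, hw₁, hw₁h⟩ := exists_chart_through hf' hf hy₀ hy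
  -- Gallery induction inside the chart `h`, starting from a chamber of `f`. At each panel the
  -- apartment is changed only outside a half apartment whose normal is positive on `ξ`.
  have key : w₁ y ∈ {u | ∃ g ∈ B.charts, AgreeOn (posNormals W ξ) g f ∧
      h '' cell W u ⊆ range g} := by
    refine generic_connected (W := W) hW (Y := {u | ∃ g ∈ B.charts, AgreeOn (posNormals W ξ) g f ∧
      h '' cell W u ⊆ range g}) ⟨y₀, ⟨f, hf, AgreeOn.refl _ _, ?_⟩, hy₀⟩ ?_
      (isGeneric_map hw₁ hy)
    · rw [hhf.image_eq]; exact image_subset_range _ _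
    rintro u ⟨g, hg, hgf, hug⟩ hu u' hu' z hz hzu hzu'
    obtain ⟨w, hw, hhw⟩ := B.compatible h hh g hg ⟨_, cell_mem_modelChambers hu, hug⟩
    set j : E → X := h ∘ (w⁻¹ : E ≃ᵃⁱ[ℝ] E) with hj_def
    have hj : j ∈ B.charts := B.comp_mem _ hh _ (W.inv_mem hw)
    have hjw : ∀ x, j (w x) = h x := fun x => by simp [j]
    have hU := isGeneric_map hw hu
    have hU' := isGeneric_map hw hu'
    have hZ := isSimple_map hw hz
    have hZU := mem_cell_map hw hzu
    have hZU' := mem_cell_map hw hzu'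
    have himg : ∀ v, h '' cell W v = j '' cell W (w v) := fun v => by
      rw [← image_cell hw, image_image]
      simp only [hjw]
    have hjg : EqOn j g (cell W (w u)) := by
      intro x hx
      rw [← image_cell hw] at hx
      obtain ⟨x, hx, rfl⟩ := hx
      rw [hjw]
      exact hhw x (hug (mem_image_of_mem h hx))
    simp only [mem_ofPred_eq, himg] at hug ⊢
    rcases adjacent_cases hW hU hU' hZ hZU hZU' with hc | ⟨a, hZa, haU, haU'⟩
    · exact ⟨g, hg, hgf, by rw [← hc]; exact hug⟩
    -- If `a` is positive on `ξ`, the half apartment of the old chamber is kept and the new chamber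
    -- attached to it. If `a` is negative, the half apartment beyond the panel has to be kept:
    -- either the new chamber is the chamber of `g` there, or it can be attached to that half.
    rcases lt_or_gt_of_ne (hξ a) with haξ | haξ
    · have hZa' : w z ∈ a.opp.wall := by rw [mem_wall] at *; rw [val_opp, hZa, neg_zero]
      obtain ⟨i, hi, hig, hir, v, hv, hjv⟩ := exists_chart_through hj hg hU' hU'
      have hvZ : v (w z) = w z := by
        have h1 := hjv (w z) (hir (mem_image_of_mem j hZU'))
        rw [hjg hZU, ← hig hZU'] at h1
        exact (B.injective i hi h1).symm
      have hZv : w z ∈ cell W (v (w u')) := by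
        have := mem_cell_map hv hZU'
        rwa [hvZ] at this
      have hvU := isGeneric_map hv hU'
      have hji : j '' cell W (w u') = i '' cell W (v (w u')) := by
        rw [← image_cell hv, image_image]
        exact image_congr fun x hx => hjv x (hir (mem_image_of_mem j hx))
      rcases lt_or_gt_of_ne (hvU.val_ne a) with h1 | h1
      · refine ⟨g, hg, hgf, ?_⟩
        rw [hji, cell_eq_of_same_side hW hZ hZa' hvU hU' hZv hZU' (by rw [val_opp]; linarith)
          (by rw [val_opp]; linarith), hig.image_eq]
        exact image_subset_range _ _
      · obtain ⟨k, hk, hkg, hki⟩ := exists_chart_half hW hB hg hi hZ hZa' hU' hU hZU' hZU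
          (by rw [val_opp]; linarith) hig.symm
        have hkg' : AgreeOn (posNormals W ξ) k g := AgreeOn.of_eqOn_half hkg
          ⟨⟨_, rfl⟩, by simp only [opp, inner_neg_left]; linarith⟩
        refine ⟨k, hk, hkg'.trans hgf, ?_⟩
        rw [hji, cell_eq_of_same_side hW hZ hZa hvU hU hZv hZU h1 haU, ← hki.image_eq]
        exact image_subset_range _ _
    · obtain ⟨k, hk, hkg, hkj⟩ := exists_chart_half hW hB hg hj hZ hZa hU hU' hZU hZU' haU hjg.symm
      have hkg' : AgreeOn (posNormals W ξ) k g := AgreeOn.of_eqOn_half hkg ⟨⟨_, rfl⟩, haξ⟩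
      refine ⟨k, hk, hkg'.trans hgf, ?_⟩
      rw [← hkj.image_eq]
      exact image_subset_range _ _
  obtain ⟨g, hg, hgf, hyg⟩ := key
  refine ⟨g, hg, hgf, ?_⟩
  rw [← image_cell hw₁, image_image] at hyg
  rintro _ ⟨x, hx, rfl⟩
  rw [hw₁h x (hr (mem_image_of_mem f' hx))]
  exact hyg (mem_image_of_mem _ hx)

end AffineBuilding

end Directions

/-! ### The exchange property when one normal is discarded. -/

section Exchange

variable {E : Type*} [NormedAddCommGroup E] [InnerProductSpace ℝ E]
  {W : Subgroup (E ≃ᵃⁱ[ℝ] E)} {X : Type*}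

open AffineRoot

/-- The normals that are positive on `ξ` and nonnegative on `η`. -/
def weakNormals (W : Subgroup (E ≃ᵃⁱ[ℝ] E)) (ξ η : E) : Set E :=
  {c | c ∈ posNormals W ξ ∧ 0 ≤ ⟪c, η⟫}

/-- The normals that are positive on `ξ` and on `η`. -/
def strictNormals (W : Subgroup (E ≃ᵃⁱ[ℝ] E)) (ξ η : E) : Set E :=
  {c | c ∈ posNormals W ξ ∧ 0 < ⟪c, η⟫}

theorem weakNormals_subset (ξ η : E) : weakNormals W ξ η ⊆ posNormals W ξ := fun _ h => h.1

theorem strictNormals_subset (ξ η : E) : strictNormals W ξ η ⊆ weakNormals W ξ η :=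
  fun _ h => ⟨h.1, h.2.le⟩

/-- The intersection of the half spaces with normal `a` that contain the agreement locus. -/
def hull (W : Subgroup (E ≃ᵃⁱ[ℝ] E)) (a : E) (g h : E → X) : Set E :=
  {x | ∀ b : AffineRoot W, b.normal = a → {u | g u = h u} ⊆ b.half → x ∈ b.half}

theorem mem_hull_of_eq {a : E} {g h : E → X} {x : E} (hx : g x = h x) : x ∈ hull W a g h :=
  fun _ _ hb => hb hx

theorem cell_subset_hull {a : E} {g h : E → X} {y : E} (hy : y ∈ hull W a g h) :
    cell W y ⊆ hull W a g h :=
  fun _ hx b hba hb => hx b (hy b hba hb)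

theorem hull_mono {a : E} {g h g' h' : E → X} (H : {u | g u = h u} ⊆ {u | g' u = h' u}) :
    hull W a g h ⊆ hull W a g' h' :=
  fun _ hx b hba hb => hx b hba (H.trans hb)

theorem AffineRoot.half_ne_univ (b : AffineRoot W) : b.half ≠ univ := by
  intro h
  have : (b.level - 1) • b.normal ∈ b.half := h ▸ mem_univ _
  rw [mem_half, val, inner_smul_right, inner_normal_self] at this
  linarith

theorem AffineRoot.level_le_of_half_subset {b b' : AffineRoot W} (hn : b.normal = b'.normal)
    (h : b'.half ⊆ b.half) : b.level ≤ b'.level := by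
  have h1 : b'.level • b'.normal ∈ b'.half := by
    rw [mem_half, val, inner_smul_right, inner_normal_self]; linarith
  have h2 := h h1
  rw [mem_half, val, hn, inner_smul_right, inner_normal_self] at h2
  linarith

/-- An agreement point bounds the levels of the roots with normal `a` that contain the locus, and
only finitely many levels lie between such a bound and a given one, so the largest is attained. -/
theorem hull_eq (hW : IsAffineWeylGroup W) (a : E) (g h : E → X) (hne : ∃ u, g u = h u) :
    hull W a g h = univ ∨ ∃ b : AffineRoot W, b.normal = a ∧ hull W a g h = b.half ∧
      ∀ b' : AffineRoot W, b'.normal = a → {u | g u = h u} ⊆ b'.half → b'.level ≤ b.level := by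
  by_cases hb : ∃ b : AffineRoot W, b.normal = a ∧ {u | g u = h u} ⊆ b.half
  · right
    obtain ⟨b₀, hb₀, hb₀'⟩ := hb
    obtain ⟨u, hu⟩ := hne
    set S := {b : AffineRoot W | b.normal = a ∧ {u | g u = h u} ⊆ b.half ∧ b₀.level ≤ b.level}
    have hS : S.Finite := by
      refine (finite_level_le hW (max |b₀.level| |⟪a, u⟫|)).subset ?_
      rintro b ⟨hb1, hb2, hb3⟩
      have h1 := hb2 hu
      rw [mem_half, val, hb1] at h1
      exact abs_le_max_abs_abs hb3 (by linarith)
    obtain ⟨b, ⟨hba, hbH, hbl⟩, hmax⟩ := hS.exists_maximalFor AffineRoot.level S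
      ⟨b₀, hb₀, hb₀', le_rfl⟩
    have hmax' : ∀ b' : AffineRoot W, b'.normal = a → {u | g u = h u} ⊆ b'.half →
        b'.level ≤ b.level := by
      intro b' h1 h2
      by_contra h3
      push Not at h3
      exact absurd (hmax ⟨h1, h2, hbl.trans h3.le⟩ h3.le) (not_le.2 h3)
    refine ⟨b, hba, Subset.antisymm (fun x hx => hx b hba hbH) fun x hx b' h1 h2 => ?_, hmax'⟩
    have := hmax' b' h1 h2
    rw [mem_half, val] at *
    rw [h1]; rw [hba] at hx
    linarith
  · left
    push Not at hb
    exact eq_univ_of_forall fun x b h1 h2 => absurd h2 (hb b h1)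

variable [FiniteDimensional ℝ E]

namespace AffineBuilding

variable {B : AffineBuilding W X} {ξ η a : E}

section

variable {g h : E → X}

theorem exists_deep_mem (hW : IsAffineWeylGroup W) (H : AgreeOn (weakNormals W ξ η) g h) :
    ∃ p, ∀ s t : ℝ, 0 ≤ s → 0 ≤ t → g (p + s • ξ + t • η) = h (p + s • ξ + t • η) := by
  obtain ⟨m, hm⟩ := H
  obtain ⟨t, ht⟩ := (eventually_deep (finite_posNormals hW ξ) (fun c hc => hc.2) 0 m).exists
  refine ⟨0 + t • ξ, fun s t' hs ht' => hm _ fun c hc => ?_⟩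
  have h1 := ht c hc.1
  rw [inner_add_right, inner_add_right, inner_smul_right, inner_smul_right]
  have h2 := mul_nonneg hs hc.1.2.le
  have h3 := mul_nonneg ht' hc.2
  linarith

/-- The agreement locus contains a translate of the cone spanned by `ξ` and `η`. A half space
containing it has normal nonnegative on both, and `hξ` excludes the value zero on `ξ`. -/
theorem normal_mem_weakNormals (hW : IsAffineWeylGroup W)
    (hξ : ∀ a : AffineRoot W, ⟪a.normal, ξ⟫ ≠ 0) (H : AgreeOn (weakNormals W ξ η) g h)
    {b : AffineRoot W} (hb : {u | g u = h u} ⊆ b.half) : b.normal ∈ weakNormals W ξ η := by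
  obtain ⟨p, hp⟩ := exists_deep_mem hW H
  refine ⟨⟨⟨b, rfl⟩, lt_of_le_of_ne ?_ (hξ b).symm⟩, ?_⟩
  · refine nonneg_of_forall_add_mul (A := b.val p) fun t ht => ?_
    have := mem_half.1 (hb (hp t 0 ht le_rfl))
    rwa [zero_smul, add_zero, val_add, inner_smul_right] at this
  · refine nonneg_of_forall_add_mul (A := b.val p) fun t ht => ?_
    have := mem_half.1 (hb (hp 0 t le_rfl ht))
    rwa [zero_smul, add_zero, val_add, inner_smul_right] at this

theorem nonempty_eq (hW : IsAffineWeylGroup W) (H : AgreeOn (weakNormals W ξ η) g h) :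
    ∃ u, g u = h u := by
  obtain ⟨p, hp⟩ := exists_deep_mem hW H
  exact ⟨_, hp 0 0 le_rfl le_rfl⟩

/-- If the hull is everything, no root with normal `a` contains the locus. All roots containing it
then have normals positive on `η`, and their levels are bounded by the norm of one agreement point,
which gives a uniform depth. -/
theorem agreeOn_strictNormals (hW : IsAffineWeylGroup W)
    (hξ : ∀ a : AffineRoot W, ⟪a.normal, ξ⟫ ≠ 0)
    (ha : ∀ c ∈ weakNormals W ξ η, ⟪c, η⟫ = 0 → c = a)
    (hg : g ∈ B.charts) (hh : h ∈ B.charts) (H : AgreeOn (weakNormals W ξ η) g h)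
    (hno : hull W a g h = univ) : AgreeOn (strictNormals W ξ η) g h := by
  obtain ⟨p, hp⟩ := nonempty_eq hW H
  refine ⟨‖p‖, fun x hx => eq_of_forall_roots hW hg hh (H.mono (weakNormals_subset ξ η)) ?_⟩
  intro b hb
  have h1 := normal_mem_weakNormals hW hξ H hb
  have h2 : ⟪b.normal, η⟫ ≠ 0 := fun h0 => by
    refine b.half_ne_univ (eq_univ_of_forall fun u => ?_)
    have hu : u ∈ hull W a g h := hno ▸ mem_univ u
    exact hu b (ha _ h1 h0) hb
  have h3 := hx b.normal ⟨h1.1, lt_of_le_of_ne h1.2 h2.symm⟩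
  have h4 := hb hp
  have h5 := (abs_le.1 (b.abs_inner_normal_le p)).2
  rw [mem_half, val] at *
  linarith

/-- Moving an agreement point of `g` and `h` along `η` keeps it in the locus, does not change its
inner product with `a`, and finally reaches the region where `g = g'` and `h = h'`. -/
theorem hull_subset_of_agreeOn (hW : IsAffineWeylGroup W)
    (hξ : ∀ a : AffineRoot W, ⟪a.normal, ξ⟫ ≠ 0) (haη : ⟪a, η⟫ = 0)
    {g' h' : E → X} (hg : g ∈ B.charts) (hh : h ∈ B.charts)
    (H : AgreeOn (weakNormals W ξ η) g h) (Hg : AgreeOn (strictNormals W ξ η) g g')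
    (Hh : AgreeOn (strictNormals W ξ η) h h') : hull W a g h ⊆ hull W a g' h' := by
  intro x hx b hba hb
  refine hx b hba fun p hp => ?_
  obtain ⟨m, hm⟩ := Hg
  obtain ⟨m', hm'⟩ := Hh
  have hfin : (strictNormals W ξ η).Finite := (finite_posNormals hW ξ).subset fun _ h => h.1
  obtain ⟨t, ⟨h1, h2⟩, ht⟩ := (((eventually_deep hfin (fun c hc => hc.2) p m).and
    (eventually_deep hfin (fun c hc => hc.2) p m')).and
      (Filter.eventually_ge_atTop (0 : ℝ))).exists
  have h3 : g (p + t • η) = h (p + t • η) := by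
    refine eq_of_forall_roots hW hg hh (H.mono (weakNormals_subset ξ η)) fun b' hb' => ?_
    have h4 := normal_mem_weakNormals hW hξ H hb'
    have h5 := mem_half.1 (hb' hp)
    rw [mem_half, val_add, inner_smul_right]
    exact add_nonneg h5 (mul_nonneg ht h4.2)
  have h4 : g' (p + t • η) = h' (p + t • η) := by rw [← hm _ h1, ← hm' _ h2, h3]
  have h5 := mem_half.1 (hb h4)
  rw [val_add, inner_smul_right, hba, haη, mul_zero, add_zero] at h5
  exact mem_half.2 h5

/-- The hull depends only on the classes of the charts. -/
theorem hull_eq_of_agreeOn (hW : IsAffineWeylGroup W)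
    (hξ : ∀ a : AffineRoot W, ⟪a.normal, ξ⟫ ≠ 0) (haη : ⟪a, η⟫ = 0)
    {g' h' : E → X} (hg : g ∈ B.charts) (hh : h ∈ B.charts) (hg' : g' ∈ B.charts)
    (hh' : h' ∈ B.charts) (H : AgreeOn (weakNormals W ξ η) g h)
    (Hg : AgreeOn (strictNormals W ξ η) g g') (Hh : AgreeOn (strictNormals W ξ η) h h') :
    hull W a g h = hull W a g' h' := by
  refine Subset.antisymm (hull_subset_of_agreeOn hW hξ haη hg hh H Hg Hh)
    (hull_subset_of_agreeOn hW hξ haη hg' hh' ?_ Hg.symm Hh.symm)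
  exact ((Hg.symm.mono (strictNormals_subset ξ η)).trans H).trans
    (Hh.mono (strictNormals_subset ξ η))

/-- Folding across the boundary of the hull. Far along `η` this wall is the only remaining
constraint, so a chamber just inside it belongs to the locus. The half apartment of `g` and the
chamber of `h` just outside then lie in one apartment, whose agreement with `h` reaches beyond the
hull. -/
theorem exists_exchange_step (hW : IsAffineWeylGroup W) (hB : B.IsComplete)
    (hξ : ∀ a : AffineRoot W, ⟪a.normal, ξ⟫ ≠ 0) (haη : ⟪a, η⟫ = 0)
    (ha : ∀ c ∈ weakNormals W ξ η, ⟪c, η⟫ = 0 → c = a)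
    (hg : g ∈ B.charts) (hh : h ∈ B.charts) (H : AgreeOn (weakNormals W ξ η) g h) :
    ∃ k ∈ B.charts, EqOn k g (hull W a g h) ∧
      (hull W a g h ≠ univ → ∃ u, k u = h u ∧ u ∉ hull W a g h) := by
  rcases hull_eq hW a g h (nonempty_eq hW H) with huniv | ⟨b, hba, hbH, hbmax⟩
  · exact ⟨g, hg, eqOn_refl _ _, fun h => absurd huniv h⟩
  obtain ⟨q, hq⟩ := nonempty_eq hW H
  have hfin : (strictNormals W ξ η).Finite := (finite_posNormals hW ξ).subset fun _ h => h.1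
  -- Roots containing the locus have level at most `‖q‖`. Depth `‖q‖ + 1`, less the `1 / 2` lost in
  -- moving to a simple point `z`, leaves `z` strictly inside all of them whose normal is positive
  -- on `η`.
  obtain ⟨t, ht⟩ := (eventually_deep hfin (fun c hc => hc.2) (b.level • b.normal)
    (‖q‖ + 1)).exists
  obtain ⟨z, hzb, hzp, hz⟩ := exists_simple_mem_wall hW b (p := b.level • b.normal + t • η) (by
    rw [mem_wall, val_add, inner_smul_right, hba, haη, ← hba, val, inner_smul_right,
      inner_normal_self]; ring) one_half_pos
  have hzb' : z ∈ b.opp.wall := by rw [mem_wall] at *; rw [val_opp, hzb, neg_zero]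
  obtain ⟨y₀, hy₀, hby₀, hzy₀⟩ := exists_chamber_side hW hz hzb
  obtain ⟨y₁, hy₁, hby₁, hzy₁⟩ := exists_chamber_side hW hz hzb'
  have heq : EqOn g h (cell W y₀) := by
    intro x hx
    refine eq_of_forall_roots hW hg hh (H.mono (weakNormals_subset ξ η)) fun c hc => ?_
    refine cell_subset_half ?_ hx
    rw [mem_half]
    have hcn := normal_mem_weakNormals hW hξ H hc
    by_cases h0 : ⟪c.normal, η⟫ = 0
    · have hca := ha _ hcn h0
      have h1 := hbmax c hca hc
      rw [val, hba] at hby₀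
      rw [val, hca]
      linarith
    · by_contra hneg
      push Not at hneg
      have h1 := mem_cell_iff.1 hzy₀ c.opp (by rw [val_opp]; linarith)
      have h2 := ht c.normal ⟨hcn.1, lt_of_le_of_ne hcn.2 (Ne.symm h0)⟩
      have h3 := (abs_le.1 (c.abs_val_sub_le z (b.level • b.normal + t • η))).1
      have h4 := mem_half.1 (hc hq)
      have h5 := (abs_le.1 (c.abs_inner_normal_le q)).2
      rw [val_opp] at h1
      simp only [val] at h1 h3 h4
      linarith
  obtain ⟨k, hk, hkg, hkh⟩ := exists_chart_half hW hB hg hh hz hzb hy₀ hy₁ hzy₀ hzy₁ hby₀ heq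
  refine ⟨k, hk, hbH ▸ hkg, fun _ => ⟨y₁, hkh (mem_cell_self y₁), ?_⟩⟩
  rw [val_opp] at hby₁
  rw [hbH, mem_half]
  linarith

/-- The exchange property. -/
theorem exists_exchange (hW : IsAffineWeylGroup W) (hB : B.IsComplete)
    (hξ : ∀ a : AffineRoot W, ⟪a.normal, ξ⟫ ≠ 0) (haη : ⟪a, η⟫ = 0)
    (ha : ∀ c ∈ weakNormals W ξ η, ⟪c, η⟫ = 0 → c = a)
    (hg : g ∈ B.charts) (hh : h ∈ B.charts) (H : AgreeOn (weakNormals W ξ η) g h) :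
    ∃ k ∈ B.charts, AgreeOn (strictNormals W ξ η) k h ∧ EqOn k g (hull W a g h) := by
  have hagree : ∀ {k k' : E → X}, EqOn k' k (hull W a k h) →
      {u | k u = h u} ⊆ {u | k' u = h u} := by
    intro k k' hkk u hu
    show k' u = h u
    rw [hkk (mem_hull_of_eq hu)]
    exact hu
  let T := {k : E → X // k ∈ B.charts ∧ AgreeOn (weakNormals W ξ η) k h}
  have hstep : ∀ k : T, ∃ k' : T, EqOn k'.1 k.1 (hull W a k.1 h) ∧
      (hull W a k.1 h ≠ univ → ∃ u, k'.1 u = h u ∧ u ∉ hull W a k.1 h) := by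
    rintro ⟨k, hk, hkH⟩
    obtain ⟨k', hk', h1, h2⟩ := exists_exchange_step hW hB hξ haη ha hk hh hkH
    refine ⟨⟨k', hk', ?_⟩, h1, h2⟩
    obtain ⟨m, hm⟩ := hkH
    exact ⟨m, fun x hx => hagree h1 (hm x hx)⟩
  choose nxt hnxt using hstep
  let K : ℕ → T := fun n => Nat.rec ⟨g, hg, H⟩ (fun _ k => nxt k) n
  let Hn : ℕ → Set E := fun n => hull W a (K n).1 h
  have hsucc : ∀ n, EqOn (K (n + 1)).1 (K n).1 (Hn n) := fun n => (hnxt (K n)).1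
  have hmono : Monotone Hn := monotone_nat_of_le_succ fun n => hull_mono (hagree (hsucc n))
  have hEq : ∀ {m n}, n ≤ m → EqOn (K m).1 (K n).1 (Hn n) := by
    intro m n hnm
    induction m, hnm using Nat.le_induction with
    | base => exact eqOn_refl _ _
    | succ m hm ih => exact ((hsucc m).mono (hmono hm)).trans ih
  -- If a point lay in no hull, the hulls would be infinitely many distinct roots with normal `a`,
  -- with levels bounded below by the point and above by the first hull.
  have hcover : ∀ x, ∃ n, x ∈ Hn n := by
    intro x
    by_contra hx
    push Not at hx
    have hnuniv : ∀ n, Hn n ≠ univ := fun n h0 => hx n (h0 ▸ mem_univ x)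
    have hroot : ∀ n, ∃ b : AffineRoot W, b.normal = a ∧ Hn n = b.half := fun n => by
      rcases hull_eq hW a (K n).1 h (nonempty_eq hW (K n).2.2) with h0 | ⟨b, hba, hbH, -⟩
      · exact absurd h0 (hnuniv n)
      · exact ⟨b, hba, hbH⟩
    choose b hba hbH using hroot
    have hinj : Function.Injective b := by
      have hstrict : StrictMono Hn := by
        refine strictMono_nat_of_lt_succ fun n => ?_
        refine (hmono n.le_succ).lt_of_ne fun h0 => ?_
        obtain ⟨u, hu, hu'⟩ := (hnxt (K n)).2 (hnuniv n)
        refine hu' ?_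
        have : u ∈ Hn (n + 1) := mem_hull_of_eq hu
        rwa [← h0] at this
      intro m n hmn
      refine hstrict.injective ?_
      rw [hbH m, hbH n, hmn]
    refine Set.infinite_of_injective_forall_mem hinj
      (s := {c : AffineRoot W | |c.level| ≤ max |⟪a, x⟫| |(b 0).level|}) (fun n => ?_)
      (finite_level_le hW _)
    show |(b n).level| ≤ max |⟪a, x⟫| |(b 0).level|
    refine abs_le_max_abs_abs ?_ ?_
    · have := hx n
      rw [hbH n, mem_half, val, hba n] at this
      linarith
    · refine AffineRoot.level_le_of_half_subset ((hba n).trans (hba 0).symm) ?_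
      rw [← hbH, ← hbH]
      exact hmono (Nat.zero_le n)
  choose N hN using hcover
  -- The limit chart: its value at `x` is taken at a stage whose hull contains `x`, from which on
  -- the value no longer changes.
  let k : E → X := fun x => (K (N x)).1 x
  have hkK : ∀ n, EqOn k (K n).1 (Hn n) := by
    intro n x hx
    show (K (N x)).1 x = _
    rw [← hEq (le_max_left (N x) n) (hN x), ← hEq (le_max_right (N x) n) hx]
  have hk : k ∈ B.charts := by
    refine mem_charts_of_pairwise hW hB fun y y' _ _ => ?_
    refine ⟨(K (max (N y) (N y'))).1, (K _).2.1, ?_, ?_⟩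
    · exact ((hkK _).mono (cell_subset_hull (hmono (le_max_left _ _) (hN y)))).symm
    · exact ((hkK _).mono (cell_subset_hull (hmono (le_max_right _ _) (hN y')))).symm
  refine ⟨k, hk, ?_, hkK 0⟩
  refine agreeOn_strictNormals hW hξ ha hk hh ?_ ?_
  · obtain ⟨m, hm⟩ := H
    exact ⟨m, fun x hx => hagree (hkK 0) (hm x hx)⟩
  · refine eq_univ_of_forall fun x => ?_
    exact hull_mono (hagree (hkK (N x))) (hN x)

end

end AffineBuilding

end Exchange

/-! ### Combinatorics of adding charts in an admissible order. -/

section Growth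

variable {E X : Type*}

open Relation

/-- The locus where `g` agrees with some member of `S` is a union of members of `𝓗`, on each of
which `g` agrees with a member of `S`. -/
def Admissible (𝓗 : Set (Set E)) (S : Set (E → X)) (g : E → X) : Prop :=
  ∀ h ∈ S, ∀ x, h x = g x → ∃ k ∈ S, ∃ β ∈ 𝓗, x ∈ β ∧ EqOn k g β

/-- Adding one admissible member of `𝒦`. -/
def GrowStep (𝓗 : Set (Set E)) (𝒦 : Set (E → X)) (Good : Set (E → X) → Prop)
    (S S' : Set (E → X)) : Prop :=
  ∃ m ∈ 𝒦, S' = insert m S ∧ Good S' ∧ Admissible 𝓗 S m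

/-- A property of subsets of `𝒦` that allows to reach every member of `𝒦` by adding
admissible members one by one. -/
structure IsGrowth (𝓗 : Set (Set E)) (𝒦 : Set (E → X)) (Good : Set (E → X) → Prop) : Prop where
  empty : Good ∅
  subset : ∀ S, Good S → S ⊆ 𝒦
  reach : ∀ S, Good S → ∀ g ∈ 𝒦, ∃ S', ReflTransGen (GrowStep 𝓗 𝒦 Good) S S' ∧ g ∈ S'

theorem admissible_of_mem {𝓗 : Set (Set E)} (hU : univ ∈ 𝓗) {S : Set (E → X)} {g : E → X}
    (hg : g ∈ S) : Admissible 𝓗 S g :=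
  fun _ _ _ _ => ⟨g, hg, univ, hU, mem_univ _, eqOn_refl _ _⟩

theorem isGrowth_of_subsingleton {𝓗 : Set (Set E)} (hU : univ ∈ 𝓗) {𝒦 : Set (E → X)}
    (h𝒦 : 𝒦.Subsingleton) : IsGrowth 𝓗 𝒦 (fun S => S ⊆ 𝒦) where
  empty := empty_subset _
  subset := fun _ hS => hS
  reach := fun S hS g hg => by
    refine ⟨insert g S, ReflTransGen.single ⟨g, hg, rfl, insert_subset hg hS, ?_⟩,
      mem_insert _ _⟩
    intro h hh x _
    exact ⟨h, hh, univ, hU, mem_univ _, by rw [h𝒦 (hS hh) hg]; exact eqOn_refl _ _⟩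

/-- A partition of `𝒦` into classes with an exchange property. -/
structure IsExchangeSystem (𝓗 : Set (Set E)) (𝒦 : Set (E → X)) (r : (E → X) → (E → X) → Prop)
    (H : (E → X) → (E → X) → Set E) : Prop where
  equiv : Equivalence r
  hull_mem : ∀ g ∈ 𝒦, ∀ h ∈ 𝒦, H g h ∈ 𝓗
  mem_hull : ∀ g ∈ 𝒦, ∀ h ∈ 𝒦, ∀ x, g x = h x → x ∈ H g h
  hull_congr : ∀ g ∈ 𝒦, ∀ h ∈ 𝒦, ∀ h' ∈ 𝒦, r h h' → H g h = H g h'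
  exchange : ∀ g ∈ 𝒦, ∀ h ∈ 𝒦, ∃ k ∈ 𝒦, r k h ∧ EqOn k g (H g h)
  growth : ∀ g ∈ 𝒦, ∃ Good, IsGrowth 𝓗 {h | h ∈ 𝒦 ∧ r g h} Good

variable {𝓗 : Set (Set E)} {𝒦 : Set (E → X)} {r : (E → X) → (E → X) → Prop}
  {H : (E → X) → (E → X) → Set E}

/-- A chosen growth property of a class. -/
noncomputable def classGood (𝓗 : Set (Set E)) (κ : Set (E → X)) : Set (E → X) → Prop :=
  Classical.epsilon fun Good => IsGrowth 𝓗 κ Good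

theorem IsExchangeSystem.isGrowth_classGood (hs : IsExchangeSystem 𝓗 𝒦 r H) {g : E → X}
    (hg : g ∈ 𝒦) : IsGrowth 𝓗 {h | h ∈ 𝒦 ∧ r g h} (classGood 𝓗 {h | h ∈ 𝒦 ∧ r g h}) :=
  Classical.epsilon_spec (hs.growth g hg)

/-- Finite subsets of `𝒦` that can be extended, with respect to an order of the classes. -/
structure GoodRank (𝓗 : Set (Set E)) (𝒦 : Set (E → X)) (r : (E → X) → (E → X) → Prop)
    (H : (E → X) → (E → X) → Set E) (rk : (E → X) → ℕ) (S : Set (E → X)) : Prop where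
  finite : S.Finite
  subset : S ⊆ 𝒦
  inj : ∀ g ∈ S, ∀ h ∈ S, rk g = rk h → r g h
  cls : ∀ g ∈ 𝒦, classGood 𝓗 {h | h ∈ 𝒦 ∧ r g h} (S ∩ {h | h ∈ 𝒦 ∧ r g h})
  lower : ∀ g ∈ S, ∀ h ∈ S, rk h < rk g → ∃ k ∈ S, rk k < rk g ∧ EqOn k g (H g h)

variable {rk : (E → X) → ℕ} {S : Set (E → X)} {m : E → X}

/-- By `hP`, either `m` has rank above all of `S` or its class is already represented. In the second
case charts of higher rank satisfy `lower` for that class already, and `hull_congr` transfers this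
to `m`. -/
theorem GoodRank.adjoin (hs : IsExchangeSystem 𝓗 𝒦 r H) (hrk : ∀ g h, r g h → rk g = rk h)
    (hS : GoodRank 𝓗 𝒦 r H rk S) (hm : m ∈ 𝒦)
    (hP : ∀ h ∈ S, rk m ≤ rk h → ∃ h₀ ∈ S, r h₀ m)
    (hlow : ∀ h ∈ S, rk h < rk m → ∃ k ∈ S, rk k < rk m ∧ EqOn k m (H m h))
    (hgood : classGood 𝓗 {h | h ∈ 𝒦 ∧ r m h} (insert m (S ∩ {h | h ∈ 𝒦 ∧ r m h}))) :
    GoodRank 𝓗 𝒦 r H rk (insert m S) where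
  finite := hS.finite.insert m
  subset := insert_subset hm hS.subset
  inj := by
    have key : ∀ h ∈ S, rk h = rk m → r h m := by
      intro h hh e
      obtain ⟨h₀, hh₀, h0m⟩ := hP h hh e.ge
      exact hs.equiv.trans (hS.inj h hh h₀ hh₀ (e.trans (hrk _ _ h0m).symm)) h0m
    rintro g (rfl | hg) h (rfl | hh) e
    · exact hs.equiv.refl _
    · exact hs.equiv.symm (key h hh e.symm)
    · exact key g hg e
    · exact hS.inj g hg h hh e
  cls := by
    intro g hg
    by_cases hgm : r g m
    · have e : {h | h ∈ 𝒦 ∧ r g h} = {h | h ∈ 𝒦 ∧ r m h} := by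
        ext h
        exact and_congr_right fun _ =>
          ⟨fun h1 => hs.equiv.trans (hs.equiv.symm hgm) h1, fun h1 => hs.equiv.trans hgm h1⟩
      rw [e, insert_inter_of_mem (show m ∈ {h | h ∈ 𝒦 ∧ r m h} from ⟨hm, hs.equiv.refl m⟩)]
      exact hgood
    · rw [insert_inter_of_notMem fun h : m ∈ {h | h ∈ 𝒦 ∧ r g h} => hgm h.2]
      exact hS.cls g hg
  lower := by
    rintro g (rfl | hg) h (rfl | hh) e
    · exact absurd e (lt_irrefl _)
    · obtain ⟨k, hk, h1⟩ := hlow h hh e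
      exact ⟨k, mem_insert_of_mem _ hk, h1⟩
    · obtain ⟨h₀, hh₀, h0m⟩ := hP g hg e.le
      obtain ⟨k, hk, h1, h2⟩ := hS.lower g hg h₀ hh₀ (by rwa [hrk _ _ h0m])
      rw [hs.hull_congr g (hS.subset hg) h₀ (hS.subset hh₀) _ hm h0m] at h2
      exact ⟨k, mem_insert_of_mem _ hk, h1, h2⟩
    · obtain ⟨k, hk, h1⟩ := hS.lower g hg h hh e
      exact ⟨k, mem_insert_of_mem _ hk, h1⟩

/-- Charts of lower rank are handled by `hlow`, those of the class of `m` by `hadm`. A chart `h` of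
higher rank can be replaced by one of smaller rank that equals `h` on the hull of `h` and `m`, which
contains `x`; so the rank descends. -/
theorem GoodRank.admissible (hs : IsExchangeSystem 𝓗 𝒦 r H) (hrk : ∀ g h, r g h → rk g = rk h)
    (hS : GoodRank 𝓗 𝒦 r H rk S) (hm : m ∈ 𝒦)
    (hP : ∀ h ∈ S, rk m ≤ rk h → ∃ h₀ ∈ S, r h₀ m)
    (hlow : ∀ h ∈ S, rk h < rk m → ∃ k ∈ S, rk k < rk m ∧ EqOn k m (H m h))
    (hadm : Admissible 𝓗 (S ∩ {h | h ∈ 𝒦 ∧ r m h}) m) : Admissible 𝓗 S m := by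
  have key : ∀ n, ∀ h ∈ S, rk h = n → ∀ x, h x = m x →
      ∃ k ∈ S, ∃ β ∈ 𝓗, x ∈ β ∧ EqOn k m β := by
    intro n
    induction n using Nat.strong_induction_on with
    | _ n ih =>
      intro h hh hn x hx
      rcases lt_trichotomy (rk h) (rk m) with hlt | heq | hgt
      · obtain ⟨k, hk, -, h2⟩ := hlow h hh hlt
        exact ⟨k, hk, _, hs.hull_mem m hm h (hS.subset hh),
          hs.mem_hull m hm h (hS.subset hh) x hx.symm, h2⟩
      · obtain ⟨h₀, hh₀, h0m⟩ := hP h hh heq.ge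
        have h1 := hs.equiv.trans (hS.inj h hh h₀ hh₀ (heq.trans (hrk _ _ h0m).symm)) h0m
        obtain ⟨k, hk, h2⟩ := hadm h ⟨hh, hS.subset hh, hs.equiv.symm h1⟩ x hx
        exact ⟨k, hk.1, h2⟩
      · obtain ⟨h₀, hh₀, h0m⟩ := hP h hh hgt.le
        obtain ⟨k, hk, h1, h2⟩ := hS.lower h hh h₀ hh₀ (by rwa [hrk _ _ h0m])
        rw [hs.hull_congr h (hS.subset hh) h₀ (hS.subset hh₀) _ hm h0m] at h2
        refine ih (rk k) (hn ▸ h1) k hk rfl x ?_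
        rw [h2 (hs.mem_hull h (hS.subset hh) m hm x hx), hx]
  exact fun h hh x hx => key _ h hh rfl x hx

/-- Follow a growth chain of the class of `g`. Before each chart `m` of the chain, every lower class
in use receives a chart equal to `m` on the hull; such targets have smaller rank and are reached by
induction. The last clause makes the bookkeeping work: new charts stay in the class of `g` or in
lower classes already represented, so no unranked class appears on the way. -/
theorem GoodRank.exists_extension (hs : IsExchangeSystem 𝓗 𝒦 r H)
    (hrk : ∀ g h, r g h → rk g = rk h) (n : ℕ) : ∀ S, GoodRank 𝓗 𝒦 r H rk S → ∀ g ∈ 𝒦,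
      rk g = n → (∀ h ∈ S, rk g ≤ rk h → ∃ h₀ ∈ S, r h₀ g) →
      ∃ S', ReflTransGen (GrowStep 𝓗 𝒦 (GoodRank 𝓗 𝒦 r H rk)) S S' ∧ g ∈ S' ∧
        GoodRank 𝓗 𝒦 r H rk S' ∧ S ⊆ S' ∧
        ∀ h ∈ S', h ∉ S → r g h ∨ (rk h < rk g ∧ ∃ h₀ ∈ S, r h₀ h) := by
  induction n using Nat.strong_induction_on with
  | _ n ih =>
    intro S hS g hg hgn hP
    have htargets : ∀ 𝒯 : Set (E → X), 𝒯.Finite → ∀ S, GoodRank 𝓗 𝒦 r H rk S →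
        (∀ t ∈ 𝒯, t ∈ 𝒦 ∧ rk t < n ∧ ∃ h₀ ∈ S, r h₀ t) →
        ∃ S', ReflTransGen (GrowStep 𝓗 𝒦 (GoodRank 𝓗 𝒦 r H rk)) S S' ∧ 𝒯 ⊆ S' ∧
          GoodRank 𝓗 𝒦 r H rk S' ∧ S ⊆ S' ∧
          ∀ h ∈ S', h ∉ S → rk h < n ∧ ∃ h₀ ∈ S, r h₀ h := by
      intro 𝒯 h𝒯 S hS
      induction 𝒯, h𝒯 using Set.Finite.induction_on with
      | empty =>
        intro _
        exact ⟨S, ReflTransGen.refl, empty_subset _, hS, Subset.rfl, fun h h1 h2 => absurd h1 h2⟩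
      | @insert t 𝒯 _ _ ih' =>
        intro ht
        obtain ⟨S₁, hreach₁, h𝒯₁, hS₁, hSS₁, hnew₁⟩ :=
          ih' fun t' ht' => ht t' (mem_insert_of_mem _ ht')
        obtain ⟨ht𝒦, htn, h₀, hh₀, h0t⟩ := ht t (mem_insert _ _)
        obtain ⟨S₂, hreach₂, htS₂, hS₂, hSS₂, hnew₂⟩ :=
          ih (rk t) htn S₁ hS₁ t ht𝒦 rfl fun _ _ _ => ⟨h₀, hSS₁ hh₀, h0t⟩
        refine ⟨S₂, hreach₁.trans hreach₂, insert_subset htS₂ (h𝒯₁.trans hSS₂), hS₂,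
          hSS₁.trans hSS₂, fun h hh hnS => ?_⟩
        by_cases hh₁ : h ∈ S₁
        · exact hnew₁ h hh₁ hnS
        · rcases hnew₂ h hh hh₁ with h1 | ⟨h1, h', hh', h2⟩
          · exact ⟨by rwa [← hrk _ _ h1], h₀, hh₀, hs.equiv.trans h0t h1⟩
          · refine ⟨h1.trans htn, ?_⟩
            by_cases hh'S : h' ∈ S
            · exact ⟨h', hh'S, h2⟩
            · obtain ⟨-, h'', hh'', h3⟩ := hnew₁ h' hh' hh'S
              exact ⟨h'', hh'', hs.equiv.trans h3 h2⟩
    set κ := {h | h ∈ 𝒦 ∧ r g h} with hκ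
    have hκeq : ∀ m ∈ κ, {h | h ∈ 𝒦 ∧ r m h} = κ := by
      intro m hm
      ext h
      exact and_congr_right fun _ =>
        ⟨fun h1 => hs.equiv.trans hm.2 h1, fun h1 => hs.equiv.trans (hs.equiv.symm hm.2) h1⟩
    have hchain : ∀ T, ReflTransGen (GrowStep 𝓗 κ (classGood 𝓗 κ)) (S ∩ κ) T →
        ∃ S', ReflTransGen (GrowStep 𝓗 𝒦 (GoodRank 𝓗 𝒦 r H rk)) S S' ∧ S' ∩ κ = T ∧
          GoodRank 𝓗 𝒦 r H rk S' ∧ S ⊆ S' ∧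
          ∀ h ∈ S', h ∉ S → r g h ∨ (rk h < rk g ∧ ∃ h₀ ∈ S, r h₀ h) := by
      intro T hT
      induction hT with
      | refl =>
        exact ⟨S, ReflTransGen.refl, rfl, hS, Subset.rfl, fun h h1 h2 => absurd h1 h2⟩
      | @tail T _ _ hstep ihT =>
        obtain ⟨S₁, hreach₁, hT₁, hS₁, hSS₁, hnew₁⟩ := ihT
        obtain ⟨m, hmκ, rfl, hgoodT, hadm⟩ := hstep
        have hmn : rk m = n := by rw [← hrk _ _ hmκ.2, hgn]
        choose! ex hex𝒦 hexr hexeq using hs.exchange m hmκ.1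
        obtain ⟨S₂, hreach₂, h𝒯₂, hS₂, hSS₂, hnew₂⟩ :=
          htargets (ex '' {h | h ∈ S₁ ∧ rk h < n})
            ((hS₁.finite.subset fun h hh => hh.1).image _) S₁ hS₁ (by
              rintro _ ⟨h, ⟨hh, hhn⟩, rfl⟩
              have := hexr h (hS₁.subset hh)
              exact ⟨hex𝒦 h (hS₁.subset hh), by rwa [hrk _ _ this], h, hh, hs.equiv.symm this⟩)
        -- Reaching the targets adds only charts of rank below `n`, so the chain inside the class
        -- `κ` is not disturbed.
        have hT₂ : S₂ ∩ κ = T := by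
          rw [← hT₁]
          refine Subset.antisymm (fun h hh => ⟨?_, hh.2⟩) fun h hh => ⟨hSS₂ hh.1, hh.2⟩
          by_contra hn
          have := (hnew₂ h hh.1 hn).1
          rw [← hrk _ _ hh.2.2, hgn] at this
          exact lt_irrefl _ this
        have hlow : ∀ h ∈ S₂, rk h < rk m → ∃ k ∈ S₂, rk k < rk m ∧ EqOn k m (H m h) := by
          intro h hh hlt
          obtain ⟨h', hh', h'h⟩ : ∃ h' ∈ S₁, r h' h := by
            by_cases h1 : h ∈ S₁
            · exact ⟨h, h1, hs.equiv.refl h⟩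
            · exact (hnew₂ h hh h1).2
          have h2 := hS₁.subset hh'
          have h3 : rk h' < n := by rw [hrk _ _ h'h]; omega
          refine ⟨ex h', h𝒯₂ (mem_image_of_mem _ ⟨hh', h3⟩), ?_, ?_⟩
          · rw [hrk _ _ (hexr h' h2)]; omega
          · rw [← hs.hull_congr m hmκ.1 h' h2 h (hS₂.subset hh) h'h]
            exact hexeq h' h2
        have hP₂ : ∀ h ∈ S₂, rk m ≤ rk h → ∃ h₀ ∈ S₂, r h₀ m := by
          intro h hh hle
          by_cases h1 : h ∈ S₁
          · by_cases h2 : h ∈ S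
            · obtain ⟨h₀, hh₀, h0g⟩ := hP h h2 (by omega)
              exact ⟨h₀, hSS₂ (hSS₁ hh₀), hs.equiv.trans h0g hmκ.2⟩
            · rcases hnew₁ h h1 h2 with h3 | ⟨h3, -⟩
              · exact ⟨h, hh, hs.equiv.trans (hs.equiv.symm h3) hmκ.2⟩
              · omega
          · have := (hnew₂ h hh h1).1
            omega
        have hS₃ : GoodRank 𝓗 𝒦 r H rk (insert m S₂) :=
          hS₂.adjoin hs hrk hmκ.1 hP₂ hlow (by rw [hκeq m hmκ, hT₂]; exact hgoodT)
        have hadm₃ : Admissible 𝓗 S₂ m :=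
          hS₂.admissible hs hrk hmκ.1 hP₂ hlow (by rw [hκeq m hmκ, hT₂]; exact hadm)
        refine ⟨insert m S₂, (hreach₁.trans hreach₂).tail ⟨m, hmκ.1, rfl, hS₃, hadm₃⟩,
          by rw [insert_inter_of_mem hmκ, hT₂], hS₃,
          (hSS₁.trans hSS₂).trans (subset_insert _ _), ?_⟩
        rintro h (rfl | hh) hnS
        · exact Or.inl hmκ.2
        · by_cases h1 : h ∈ S₁
          · exact hnew₁ h h1 hnS
          · obtain ⟨h2, h', hh', h3⟩ := hnew₂ h hh h1
            refine Or.inr ⟨by omega, ?_⟩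
            by_cases h4 : h' ∈ S
            · exact ⟨h', h4, h3⟩
            · rcases hnew₁ h' hh' h4 with h5 | ⟨-, h'', hh'', h5⟩
              · have := hrk _ _ h5
                have := hrk _ _ h3
                omega
              · exact ⟨h'', hh'', hs.equiv.trans h5 h3⟩
    obtain ⟨T, hT, hgT⟩ := (hs.isGrowth_classGood hg).reach _ (hS.cls g hg) g
      ⟨hg, hs.equiv.refl g⟩
    obtain ⟨S', h1, h2, h3⟩ := hchain T hT
    rw [← h2] at hgT
    exact ⟨S', h1, hgT.1, h3⟩

/-- Growth properties of the classes give a growth property of the union. -/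
theorem IsExchangeSystem.exists_isGrowth (hs : IsExchangeSystem 𝓗 𝒦 r H) :
    ∃ Good, IsGrowth 𝓗 𝒦 Good := by
  classical
  refine ⟨fun S => ∃ rk : (E → X) → ℕ, (∀ g h, r g h → rk g = rk h) ∧ GoodRank 𝓗 𝒦 r H rk S,
    ⟨fun _ => 0, fun _ _ _ => rfl, finite_empty, empty_subset _, fun g hg => hg.elim,
      fun g hg => ?_, fun g hg => hg.elim⟩,
    fun S ⟨rk, _, h⟩ => h.subset, ?_⟩
  · rw [empty_inter]
    exact (hs.isGrowth_classGood hg).empty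
  rintro S ⟨rk, hrk, hS⟩ g hg
  obtain ⟨rk', hrk', hS', hP⟩ : ∃ rk' : (E → X) → ℕ, (∀ g h, r g h → rk' g = rk' h) ∧
      GoodRank 𝓗 𝒦 r H rk' S ∧ ∀ h ∈ S, rk' g ≤ rk' h → ∃ h₀ ∈ S, r h₀ g := by
    by_cases hg' : ∃ h₀ ∈ S, r h₀ g
    · exact ⟨rk, hrk, hS, fun _ _ _ => hg'⟩
    push Not at hg'
    -- A class not yet represented is ranked above all of `S`; the ranks on `S` do not change.
    obtain ⟨N, hN⟩ := (hS.finite.image rk).bddAbove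
    have hN' : ∀ h ∈ S, rk h < N + 1 := fun h hh => Nat.lt_succ_of_le (hN (mem_image_of_mem _ hh))
    let rk' : (E → X) → ℕ := fun x => if r g x then N + 1 else rk x
    have heq : ∀ h ∈ S, rk' h = rk h := fun h hh =>
      if_neg fun h1 => hg' h hh (hs.equiv.symm h1)
    refine ⟨rk', fun u v huv => ?_, ⟨hS.finite, hS.subset, ?_, hS.cls, ?_⟩, fun h hh hle => ?_⟩
    · have : r g u ↔ r g v := ⟨fun h => hs.equiv.trans h huv,
        fun h => hs.equiv.trans h (hs.equiv.symm huv)⟩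
      simp only [rk', this, hrk u v huv]
    · intro u hu v hv e
      rw [heq u hu, heq v hv] at e
      exact hS.inj u hu v hv e
    · intro u hu v hv e
      rw [heq u hu, heq v hv] at e
      obtain ⟨k, hk, h1, h2⟩ := hS.lower u hu v hv e
      exact ⟨k, hk, by rwa [heq u hu, heq k hk], h2⟩
    · have h1 : rk' g = N + 1 := if_pos (hs.equiv.refl g)
      rw [heq h hh, h1] at hle
      exact absurd (hN' h hh) (not_lt.2 hle)
  obtain ⟨S', h1, h2, -⟩ := GoodRank.exists_extension hs hrk' _ S hS' g hg rfl hP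
  refine ⟨S', ReflTransGen.mono ?_ _ _ h1, h2⟩
  rintro T T' ⟨m, hm, h3, h4, h5⟩
  exact ⟨m, hm, h3, ⟨rk', hrk', h4⟩, h5⟩

/-- A growth property gives an infinite sequence of admissible members that contains a given
sequence. -/
theorem IsGrowth.exists_sequence {Good : Set (E → X) → Prop} (hG : IsGrowth 𝓗 𝒦 Good)
    (hU : univ ∈ 𝓗) (e : ℕ → E → X) (he : ∀ n, e n ∈ 𝒦) :
    ∃ A : ℕ → E → X, (∀ j, A j ∈ 𝒦) ∧ (∀ j, Admissible 𝓗 {k | ∃ i < j, A i = k} (A j)) ∧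
      ∀ n, ∃ j, A j = e n := by
  let Ok : List (E → X) → Prop := fun l => ∀ l₁ m l₂, l = l₁ ++ m :: l₂ →
    Admissible 𝓗 {k | k ∈ l₁} m
  have hOk : ∀ l m, Ok l → Admissible 𝓗 {k | k ∈ l} m → Ok (l ++ [m]) := by
    intro l m hl hm l₁ m' l₂ heq
    rcases List.eq_nil_or_concat l₂ with rfl | ⟨l₃, b, rfl⟩
    · obtain ⟨rfl, h2⟩ := List.append_inj' heq rfl
      simp only [List.cons.injEq, and_true] at h2
      exact h2 ▸ hm
    · rw [List.concat_eq_append, ← List.cons_append, ← List.append_assoc] at heq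
      exact hl l₁ m' l₃ (List.append_inj' heq rfl).1
  let T := {l : List (E → X) // Ok l ∧ Good {k | k ∈ l}}
  have hlist : ∀ l : T, ∀ S', ReflTransGen (GrowStep 𝓗 𝒦 Good) {k | k ∈ l.1} S' →
      ∃ l' : T, l.1 <+: l'.1 ∧ {k | k ∈ l'.1} = S' := by
    intro l S' hS'
    induction hS' with
    | refl => exact ⟨l, List.prefix_rfl, rfl⟩
    | @tail S₁ S₂ _ hstep ih =>
      obtain ⟨l', hl', hS₁⟩ := ih
      obtain ⟨m, hm, rfl, hgood, hadm⟩ := hstep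
      have hset : {k | k ∈ l'.1 ++ [m]} = insert m S₁ := by
        rw [← hS₁]; ext k; simp [or_comm]
      refine ⟨⟨l'.1 ++ [m], hOk _ _ l'.2.1 (by rw [hS₁]; exact hadm), by rw [hset]; exact hgood⟩,
        hl'.trans (List.prefix_append _ _), hset⟩
  have hnext : ∀ (n : ℕ) (l : T), ∃ l' : T, l.1 <+: l'.1 ∧ l.1.length < l'.1.length ∧
      e n ∈ l'.1 := by
    intro n l
    obtain ⟨S', hS', hn⟩ := hG.reach _ l.2.2 (e n) (he n)
    obtain ⟨l', hl', hl'S⟩ := hlist l S' hS'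
    have hmem : e n ∈ {k | k ∈ l'.1} := hl'S ▸ hn
    have hset : {k | k ∈ l'.1 ++ [e n]} = {k | k ∈ l'.1} := by
      ext k
      simp only [List.mem_append, List.mem_singleton, mem_ofPred_eq]
      constructor
      · rintro (h | rfl)
        · exact h
        · exact hmem
      · exact Or.inl
    -- Repeating `e n` makes the list strictly longer, so the limit is an infinite sequence in every
    -- case. The repetition is admissible because it equals an earlier entry everywhere.
    refine ⟨⟨l'.1 ++ [e n], hOk _ _ l'.2.1 (admissible_of_mem hU hmem), by
      rw [hset]; exact l'.2.2⟩, hl'.trans (List.prefix_append _ _), ?_, by simp⟩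
    have := hl'.length_le
    simp only [List.length_append, List.length_singleton]
    omega
  choose nxt hpre hlen hmem using hnext
  let L : ℕ → T := fun n => Nat.rec
    ⟨[], fun l₁ m l₂ h => by simp at h, by simpa using hG.empty⟩ (fun n l => nxt n l) n
  have hLpre : ∀ {m n}, m ≤ n → (L m).1 <+: (L n).1 := by
    intro m n hmn
    induction n, hmn using Nat.le_induction with
    | base => exact List.prefix_rfl
    | succ n _ ih => exact ih.trans (hpre n (L n))
  have hLlen : ∀ n, n ≤ (L n).1.length := by
    intro n
    induction n with
    | zero => exact Nat.zero_le _
    | succ n ih => exact Nat.succ_le_of_lt (ih.trans_lt (hlen n (L n)))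
  let A : ℕ → E → X := fun j => (L (j + 1)).1[j]'(hLlen (j + 1))
  have hA : ∀ n j (hj : j < (L n).1.length), (L n).1[j] = A j := by
    intro n j hj
    rcases le_total n (j + 1) with h | h
    · exact (hLpre h).getElem hj
    · exact ((hLpre h).getElem (hLlen (j + 1))).symm
  refine ⟨A, fun j => ?_, fun j => ?_, fun n => ?_⟩
  · exact hG.subset _ (L (j + 1)).2.2 (List.getElem_mem _)
  · have h1 := (L (j + 1)).2.1 ((L (j + 1)).1.take j) (A j) ((L (j + 1)).1.drop (j + 1)) (by
      rw [List.cons_getElem_drop_succ, List.take_append_drop])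
    convert h1 using 1
    ext k
    simp only [mem_ofPred_eq, List.mem_take_iff_getElem]
    constructor
    · rintro ⟨i, hi, rfl⟩
      have := hLlen (j + 1)
      exact ⟨i, by omega, hA (j + 1) i (by omega)⟩
    · rintro ⟨i, hi, rfl⟩
      exact ⟨i, by omega, (hA (j + 1) i (by omega)).symm⟩
  · obtain ⟨j, hj, h⟩ := List.getElem_of_mem (hmem n (L n))
    exact ⟨j, (hA (n + 1) j hj).symm.trans h⟩

end Growth

/-! ### Ordering the normals by slope; countability of chambers; the weak topology. -/

section Covering

variable {E : Type*} [NormedAddCommGroup E] [InnerProductSpace ℝ E]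
  {W : Subgroup (E ≃ᵃⁱ[ℝ] E)} {X : Type*} [FiniteDimensional ℝ E]

open AffineRoot

/-- The whole model apartment and the half spaces with normals positive on `ξ`. -/
def posHalves (W : Subgroup (E ≃ᵃⁱ[ℝ] E)) (ξ : E) : Set (Set E) :=
  insert univ {β | ∃ b : AffineRoot W, b.normal ∈ posNormals W ξ ∧ β = b.half}

/-- A direction for which the normals that are positive on `ξ` have pairwise distinct slopes. -/
theorem exists_slope_injOn (hW : IsAffineWeylGroup W) (ξ : E) :
    ∃ θ : E, (∀ c ∈ posNormals W ξ, 0 < ⟪c, θ⟫) ∧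
      InjOn (fun c : E => ⟪c, ξ⟫ / ⟪c, θ⟫) (posNormals W ξ) := by
  have hfin := finite_posNormals hW ξ
  have : Finite (posNormals W ξ) := hfin
  -- Two slopes coincide only if `θ` is orthogonal to the vector below. Were this vector zero,
  -- comparing norms would give equal inner products with `ξ`, and the two unit normals would
  -- coincide.
  obtain ⟨θ, hθO, hθ⟩ := exists_mem_avoiding
    (ι := {p : posNormals W ξ × posNormals W ξ // p.1 ≠ p.2})
    (fun p => ⟪(p.1.1 : E), ξ⟫ • (p.1.2 : E) - ⟪(p.1.2 : E), ξ⟫ • (p.1.1 : E)) (fun _ => 0) (by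
      rintro ⟨⟨⟨a, ⟨⟨a', rfl⟩, ha⟩⟩, ⟨b, ⟨⟨b', rfl⟩, hb⟩⟩⟩, hab⟩ h0
      refine hab (Subtype.ext ?_)
      simp only at h0 ⊢
      have h1 := sub_eq_zero.1 h0
      have h2 := congrArg norm h1
      rw [norm_smul, norm_smul, a'.norm_normal, b'.norm_normal, mul_one, mul_one,
        Real.norm_of_nonneg ha.le, Real.norm_of_nonneg hb.le] at h2
      rw [h2] at h1
      exact (smul_right_injective E hb.ne' h1).symm)
    (hfin.isOpen_biInter (s := posNormals W ξ) (f := fun c => {θ : E | 0 < ⟪c, θ⟫})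
      fun c _ => isOpen_lt continuous_const (by fun_prop))
    ⟨ξ, mem_iInter₂.2 fun c hc => hc.2⟩
  have hpos : ∀ c ∈ posNormals W ξ, 0 < ⟪c, θ⟫ := fun c hc => mem_iInter₂.1 hθO c hc
  refine ⟨θ, hpos, fun a ha b hb hab => ?_⟩
  by_contra hne
  refine hθ ⟨(⟨a, ha⟩, ⟨b, hb⟩), fun h => hne (congrArg Subtype.val h)⟩ ?_
  simp only at hab ⊢
  rw [div_eq_div_iff (hpos a ha).ne' (hpos b hb).ne'] at hab
  rw [inner_sub_left, inner_smul_left, inner_smul_left]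
  simp only [conj_trivial]
  linarith

namespace AffineBuilding

variable {B : AffineBuilding W X} {ξ : E}

/-- The apartments with a common chamber at infinity have a growth property. -/
theorem exists_isGrowth (hW : IsAffineWeylGroup W) (hB : B.IsComplete)
    (hξ : ∀ a : AffineRoot W, ⟪a.normal, ξ⟫ ≠ 0) {f : E → X} (hf : f ∈ B.charts) :
    ∃ Good, IsGrowth (posHalves W ξ) {g | g ∈ B.charts ∧ AgreeOn (posNormals W ξ) f g} Good := by
  obtain ⟨θ, hθ, hinj⟩ := exists_slope_injOn hW ξ
  set s : E → ℝ := fun c => ⟪c, ξ⟫ / ⟪c, θ⟫ with hs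
  have hfin := finite_posNormals hW ξ
  -- Induction on the number of normals of slope above `σ`. When none is left, agreement holds
  -- without any condition and the class is a single chart.
  have key : ∀ (n : ℕ) (σ : ℝ), {c | c ∈ posNormals W ξ ∧ σ < s c}.ncard = n → ∀ f ∈ B.charts,
      ∃ Good, IsGrowth (posHalves W ξ)
        {g | g ∈ B.charts ∧ AgreeOn {c | c ∈ posNormals W ξ ∧ σ < s c} f g} Good := by
    intro n
    induction n using Nat.strong_induction_on with
    | _ n ih =>
      intro σ hn f hf
      set Ψ := {c | c ∈ posNormals W ξ ∧ σ < s c} with hΨ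
      have hΨfin : Ψ.Finite := hfin.subset fun c hc => hc.1
      rcases Ψ.eq_empty_or_nonempty with hempty | hne
      · refine ⟨_, isGrowth_of_subsingleton (Or.inl rfl) ?_⟩
        rintro g ⟨-, m, hg⟩ h ⟨-, m', hh⟩
        rw [hempty] at hg hh
        funext x
        rw [← hg x (by simp), ← hh x (by simp)]
      obtain ⟨a, haΨ, hamin⟩ := hΨfin.exists_minimalFor s Ψ hne
      have hmin : ∀ c ∈ Ψ, s a ≤ s c := fun c hc => by
        by_contra h
        push Not at h
        exact absurd (hamin hc h.le) (not_le.2 h)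
      -- On a positive normal `c`, the sign of `η` is that of `s c - s a`. As `a` has the least
      -- slope in `Ψ`, discarding it is the passage from weak to strict normals.
      set η := ξ - s a • θ with hη
      have hinner : ∀ c ∈ posNormals W ξ, ⟪c, η⟫ = ⟪c, θ⟫ * (s c - s a) := by
        intro c hc
        have := (hθ c hc).ne'
        rw [hη, inner_sub_right, inner_smul_right]
        simp only [hs]
        field_simp
      have hweak : weakNormals W ξ η = Ψ := by
        ext c
        refine and_congr_right fun hc => ?_
        rw [hinner c hc, mul_nonneg_iff_of_pos_left (hθ c hc), sub_nonneg]
        exact ⟨fun h => haΨ.2.trans_le h, fun h => hmin c ⟨hc, h⟩⟩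
      have hstrict : strictNormals W ξ η = {c | c ∈ posNormals W ξ ∧ s a < s c} := by
        ext c
        refine and_congr_right fun hc => ?_
        rw [hinner c hc, mul_pos_iff_of_pos_left (hθ c hc), sub_pos]
      have haη : ⟪a, η⟫ = 0 := by rw [hinner a haΨ.1, sub_self, mul_zero]
      have ha : ∀ c ∈ weakNormals W ξ η, ⟪c, η⟫ = 0 → c = a := by
        intro c hc h0
        rw [hinner c hc.1] at h0
        exact hinj hc.1 haΨ.1 (sub_eq_zero.1 ((mul_eq_zero.1 h0).resolve_left (hθ c hc.1).ne'))
      have hlt : {c | c ∈ posNormals W ξ ∧ s a < s c}.ncard < n := by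
        rw [← hn]
        refine ncard_lt_ncard ⟨fun c hc => ⟨hc.1, haΨ.2.trans hc.2⟩, fun h => ?_⟩ hΨfin
        exact lt_irrefl _ (h haΨ).2
      have hpair : ∀ g, AgreeOn Ψ f g → ∀ h, AgreeOn Ψ f h → AgreeOn (weakNormals W ξ η) g h := by
        intro g hg h hh
        rw [hweak]
        exact hg.symm.trans hh
      have hsub : strictNormals W ξ η ⊆ Ψ := hweak ▸ strictNormals_subset ξ η
      refine IsExchangeSystem.exists_isGrowth (r := AgreeOn (strictNormals W ξ η))
        (H := hull W a) ⟨⟨AgreeOn.refl _, AgreeOn.symm, AgreeOn.trans⟩, ?_, ?_, ?_, ?_, ?_⟩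
      · rintro g ⟨hg, hfg⟩ h ⟨hh, hfh⟩
        rcases hull_eq hW a g h (nonempty_eq hW (hpair g hfg h hfh)) with h1 | ⟨b, hba, hbH, -⟩
        · exact Or.inl h1
        · exact Or.inr ⟨b, hba ▸ haΨ.1, hbH⟩
      · rintro g - h - x hx
        exact mem_hull_of_eq hx
      · rintro g ⟨hg, hfg⟩ h ⟨hh, hfh⟩ h' ⟨hh', hfh'⟩ hr
        exact hull_eq_of_agreeOn hW hξ haη hg hh hg hh' (hpair g hfg h hfh) (AgreeOn.refl _ _) hr
      · rintro g ⟨hg, hfg⟩ h ⟨hh, hfh⟩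
        obtain ⟨k, hk, hkh, hkg⟩ := exists_exchange hW hB hξ haη ha hg hh (hpair g hfg h hfh)
        exact ⟨k, ⟨hk, hfh.trans (hkh.symm.mono hsub)⟩, hkh, hkg⟩
      · rintro g ⟨hg, hfg⟩
        have h1 := ih _ hlt (s a) rfl g hg
        rw [← hstrict] at h1
        convert h1 using 4
        ext h
        constructor
        · rintro ⟨⟨hh, -⟩, hr⟩
          exact ⟨hh, hr⟩
        · rintro ⟨hh, hr⟩
          exact ⟨⟨hh, hfg.trans (hr.mono hsub)⟩, hr⟩
  have h0 : {c | c ∈ posNormals W ξ ∧ 0 < s c} = posNormals W ξ := by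
    ext c
    exact ⟨fun h => h.1, fun h => ⟨h, div_pos h.2 (hθ c h)⟩⟩
  have := key _ 0 rfl f hf
  rwa [h0] at this

/-- A locally finite building has only countably many chambers. -/
theorem countable_chambers (hW : IsAffineWeylGroup W) (hfin : B.IsLocallyFinite) :
    B.chambers.Countable := by
  have := countable_roots hW
  rcases B.chambers.eq_empty_or_nonempty with hempty | ⟨c₀, hc₀⟩
  · rw [hempty]; exact countable_empty
  have hrep : ∀ c, c ∈ B.chambers → ∃ f ∈ B.charts, ∃ y, IsGeneric W y ∧ c = f '' cell W y := by
    rintro c ⟨f, hf, _, ⟨y, hy, rfl⟩, rfl⟩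
    exact ⟨f, hf, y, hy, rfl⟩
  have hX : Nonempty (E → X) := ⟨(hrep c₀ hc₀).choose⟩
  choose! F hF Y hY hFY using hrep
  -- One point is marked on each nonempty intersection of a cell with a wall. Adjacent chambers
  -- share such a marked point, because at a simple point their intersections with the common wall
  -- coincide. By local finiteness a chamber then has countably many neighbours.
  have hζ : ∀ (y : E) (a : AffineRoot W), ∃ z, (∃ z, z ∈ cell W y ∧ z ∈ a.wall) →
      z ∈ cell W y ∧ z ∈ a.wall := by
    intro y a
    by_cases h : ∃ z, z ∈ cell W y ∧ z ∈ a.wall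
    · obtain ⟨z, hz⟩ := h
      exact ⟨z, fun _ => hz⟩
    · exact ⟨0, fun h' => absurd h' h⟩
  choose ζ hζ using hζ
  let nb : Set X → Set (Set X) := fun c => ⋃ a : AffineRoot W,
    {c' | c' ∈ B.chambers ∧ F c (ζ (Y c) a) ∈ c'}
  let S : ℕ → Set (Set X) := fun n => Nat.rec {c₀} (fun _ T => ⋃ c ∈ T, nb c) n
  have hS : ∀ n, (S n).Countable := by
    intro n
    induction n with
    | zero => exact countable_singleton _
    | succ n ih => exact ih.biUnion fun c _ => countable_iUnion fun a => (hfin _).countable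
  have hSsub : ∀ n, S n ⊆ B.chambers := by
    intro n
    cases n with
    | zero => exact singleton_subset_iff.2 hc₀
    | succ n => exact iUnion₂_subset fun c _ => iUnion_subset fun a c' h => h.1
  refine (countable_iUnion hS).mono ?_
  rintro _ ⟨f, hf, _, ⟨y, hy, rfl⟩, rfl⟩
  obtain ⟨h, hh, hhF, hr, w, hw, hfw⟩ := exists_chart_through hf (hF c₀ hc₀) (hY c₀ hc₀) hy
  have himg : f '' cell W y = h '' cell W (w y) := by
    rw [← image_cell hw, image_image]
    exact image_congr fun x hx => hfw x (hr (mem_image_of_mem f hx))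
  change f '' cell W y ∈ _
  rw [himg]
  have key : w y ∈ {u | ∃ n, h '' cell W u ∈ S n} := by
    refine generic_connected (W := W) hW (Y := {u | ∃ n, h '' cell W u ∈ S n})
      ⟨Y c₀, ⟨0, ?_⟩, hY c₀ hc₀⟩ ?_ (isGeneric_map hw hy)
    · rw [hhF.image_eq, ← hFY c₀ hc₀]
      exact mem_singleton _
    rintro u ⟨n, hn⟩ hu u' hu' z hz hzu hzu'
    rcases adjacent_cases hW hu hu' hz hzu hzu' with hc | ⟨a, hza, -, -⟩
    · exact ⟨n, by rw [← hc]; exact hn⟩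
    set c := h '' cell W u with hc_def
    have hcB := hSsub n hn
    have hFc : F c '' cell W (Y c) ⊆ range h := by
      rw [← hFY c hcB]; exact image_subset_range _ _
    obtain ⟨v, hv, hFv⟩ := B.compatible (F c) (hF c hcB) h hh
      ⟨_, cell_mem_modelChambers (hY c hcB), hFc⟩
    have hcell : cell W (v (Y c)) = cell W u := by
      refine (B.injective h hh).image_injective ?_
      rw [← hc_def, ← image_cell hv, image_image]
      exact (image_congr fun x hx => hFv x (hFc (mem_image_of_mem _ hx))).symm.trans
        (hFY c hcB).symm
    obtain ⟨a', ha'⟩ := exists_map_eq hv a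
    have hex : ∃ z, z ∈ cell W (Y c) ∧ z ∈ a'.wall := by
      rw [← hcell, ← image_cell hv] at hzu
      obtain ⟨z', hz', rfl⟩ := hzu
      exact ⟨z', hz', by rwa [mem_wall, ← ha', ← mem_wall]⟩
    obtain ⟨h1, h2⟩ := hζ _ _ hex
    have h3 : v (ζ (Y c) a') ∈ cell W u' := by
      refine mem_cell_of_mem_wall hz hza hzu hzu' ?_ (by rwa [mem_wall, ha', ← mem_wall])
      rw [← hcell, ← image_cell hv]
      exact mem_image_of_mem v h1
    refine ⟨n + 1, mem_iUnion₂.2 ⟨c, hn, mem_iUnion.2 ⟨a', ⟨h, hh, _,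
      cell_mem_modelChambers hu', rfl⟩, ?_⟩⟩⟩
    rw [hFv _ (hFc (mem_image_of_mem _ h1))]
    exact mem_image_of_mem h h3
  exact mem_iUnion.2 key

/-- Charts are closed maps for the weak topology. -/
theorem isClosed_image (hW : IsAffineWeylGroup W) {g : E → X} (hg : g ∈ B.charts) {Z : Set E}
    (hZ : IsClosed Z) : @IsClosed X B.topology (g '' Z) := by
  rw [isClosed_iSup_iff]
  intro f
  rw [isClosed_iSup_iff]
  intro hf
  rw [isClosed_coinduced]
  refine IsSeqClosed.isClosed fun x p hx hxp => ?_
  choose u huZ hu using hx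
  have hcont : ∀ y, IsGeneric W y → Continuous fun v => B.retr g y (f v) := fun y hy =>
    (LipschitzWith.of_dist_le' (K := 1) fun u v => by
      rw [one_mul]; exact dist_retr_le hW hf hg hy u v).continuous
  have hretr : ∀ y, IsGeneric W y → ∀ n, B.retr g y (f (x n)) = u n := fun y hy n => by
    rw [← hu n, retr_eq hW hy hg (eqOn_refl _ _)]
  obtain ⟨y₀, hy₀, -⟩ := exists_generic_cell hW (0 : E)
  have hlim : ∀ y, IsGeneric W y → Filter.Tendsto u Filter.atTop (nhds (B.retr g y (f p))) := by
    intro y hy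
    have := ((hcont y hy).tendsto p).comp hxp
    exact this.congr (hretr y hy)
  -- The coordinates `u n` converge to the image of `f p` under every retraction onto `g`, so all
  -- these images equal `q`. Centring at a chamber containing `q` shows `f p = g q`.
  set q := B.retr g y₀ (f p) with hq
  obtain ⟨y, hy, hqy⟩ := exists_generic_cell hW q
  have hq' : B.retr g y (f p) = q := tendsto_nhds_unique (hlim y hy) (hlim y₀ hy₀)
  obtain ⟨k, hk, hkg, hkp⟩ := exists_chart_retr hW hg hy (f p)
  rw [hq'] at hkp
  exact ⟨q, hZ.isSeqClosed huZ (hlim y₀ hy₀), by rw [← hkg hqy, hkp]⟩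

theorem closure_image (hW : IsAffineWeylGroup W) {g : E → X} (hg : g ∈ B.charts) (Z : Set E) :
    B.closure (g '' Z) = g '' _root_.closure Z := by
  let _ := B.topology
  have hcont : Continuous g := by
    rw [continuous_iff_coinduced_le]
    exact le_iSup₂_of_le (f := fun f (_ : f ∈ B.charts) =>
      TopologicalSpace.coinduced f inferInstance) g hg le_rfl
  refine Subset.antisymm ?_ (image_closure_subset_closure_image hcont)
  exact closure_minimal (image_mono subset_closure) (isClosed_image hW hg isClosed_closure)

end AffineBuilding

end Covering

/-! ### Complements of unions of half spaces, and the chamber at infinity. -/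

section Directed

variable {E : Type*} [NormedAddCommGroup E] [InnerProductSpace ℝ E]
  {W : Subgroup (E ≃ᵃⁱ[ℝ] E)} {X : Type*}

open AffineRoot

/-- The closure of an intersection of open half spaces. -/
theorem closure_iInter_neg {𝓑 : Set (AffineRoot W)} {y : E} (hy : ∀ b ∈ 𝓑, b.val y < 0) :
    _root_.closure {x | ∀ b ∈ 𝓑, b.val x < 0} = {x | ∀ b ∈ 𝓑, x ∈ b.opp.half} := by
  refine Subset.antisymm (closure_minimal (fun x hx b hb => ?_) ?_) fun x hx => ?_
  · rw [mem_half, val_opp]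
    linarith [hx b hb]
  · simp only [ofPred_forall]
    exact isClosed_biInter fun b _ => b.opp.isClosed_half
  · have hlim : Filter.Tendsto (fun t : ℝ => x + t • (y - x)) (nhdsWithin 0 (Ioo 0 1)) (nhds x) := by
      have : Continuous fun t : ℝ => x + t • (y - x) := by fun_prop
      have := this.tendsto 0
      rw [zero_smul, add_zero] at this
      exact this.mono_left nhdsWithin_le_nhds
    have : (nhdsWithin (0 : ℝ) (Ioo 0 1)).NeBot := by
      rw [← mem_closure_iff_nhdsWithin_neBot, closure_Ioo zero_ne_one]
      exact left_mem_Icc.2 zero_le_one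
    refine mem_closure_of_tendsto hlim (Filter.eventually_of_mem self_mem_nhdsWithin ?_)
    rintro t ⟨ht0, ht1⟩ b hb
    have h1 := hx b hb
    rw [mem_half, val_opp] at h1
    rw [val_line]
    nlinarith [mul_nonneg (sub_nonneg.2 ht1.le) h1, mul_pos_of_neg_of_neg (hy b hb) (neg_lt_zero.2 ht0)]

variable [FiniteDimensional ℝ E]

namespace AffineBuilding

variable {B : AffineBuilding W X} {ξ : E}

/-- A half apartment whose inner normal is negative on the direction of a sector does not contain
the chamber at infinity of that sector. -/
theorem not_containsAtInfinity (hW : IsAffineWeylGroup W) {f g : E → X} (hf : f ∈ B.charts)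
    (hg : g ∈ B.charts) (hfg : AgreeOn (posNormals W ξ) f g) (x₀ : E) {b : AffineRoot W}
    (hb : b.normal ∈ posNormals W ξ) :
    ¬ ContainsAtInfinity (g '' b.opp.half) {T | T ∈ B.sectors ∧ ∃ R ∈ B.sectors,
      R ⊆ f '' {y | ∀ a : AffineRoot W, 0 < ⟪a.normal, ξ⟫ → 0 ≤ ⟪a.normal, y - x₀⟫} ∩ T} := by
  rintro ⟨T, ⟨-, R, ⟨h, hh, _, ⟨x', ξ', hξ', rfl⟩, rfl⟩, hRT⟩, hT⟩
  set S : Set E := {y | ∀ a : AffineRoot W, 0 < ⟪a.normal, ξ'⟫ → 0 ≤ ⟪a.normal, y - x'⟫} with hS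
  obtain ⟨y, hy, hdeep⟩ := exists_cell_deep hW ξ' ‖x'‖
  have hyS : cell W y ⊆ S := by
    intro x hx a ha
    have h1 := hdeep x hx a.normal ⟨mem_range_self a, ha⟩
    have h2 := (le_abs_self _).trans (abs_inner_normal_le a x')
    rw [inner_sub_right]
    linarith
  obtain ⟨w, hw, hhf⟩ := B.compatible h hh f hf ⟨_, cell_mem_modelChambers hy, by
    rintro _ ⟨x, hx, rfl⟩
    exact image_subset_range _ _ (hRT (mem_image_of_mem h (hyS hx))).1⟩
  have hray : ∀ t : ℝ, 0 ≤ t → x' + t • ξ' ∈ S := by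
    intro t ht a ha
    rw [add_sub_cancel_left, inner_smul_right]
    exact mul_nonneg ht ha.le
  have hwS : ∀ x ∈ S, h x = f (w x) ∧ ∀ a : AffineRoot W, 0 < ⟪a.normal, ξ⟫ →
      0 ≤ ⟪a.normal, w x - x₀⟫ := by
    intro x hx
    obtain ⟨u, hu, hux⟩ := (hRT (mem_image_of_mem h hx)).1
    have h1 := hhf x (hux ▸ mem_range_self u)
    have h2 : u = w x := B.injective f hf (hux.trans h1)
    exact ⟨h1, h2 ▸ hu⟩
  -- This is the direction of the subsector `R` in the coordinates of `f`. Since `R` stays in the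
  -- sector of `f`, it is nonnegative on each normal positive on `ξ`, and nonzero there because `ξ'`
  -- is regular. So a ray of `R` becomes arbitrarily deep, where `f = g`, and leaves `b.opp.half`.
  set η := w.linearIsometryEquiv ξ' with hη
  have hwray : ∀ t : ℝ, w (x' + t • ξ') = w x' + t • η := by
    intro t
    rw [apply_eq w (x' + t • ξ'), apply_eq w x', map_add, map_smul]
    abel
  have hpos : ∀ c ∈ posNormals W ξ, 0 < ⟪c, η⟫ := by
    rintro _ ⟨⟨a, rfl⟩, ha⟩
    refine lt_of_le_of_ne (nonneg_of_forall_add_mul (A := ⟪a.normal, w x' - x₀⟫) fun t ht => ?_)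
      fun h0 => ?_
    · have h1 := (hwS _ (hray t ht)).2 a ha
      rwa [hwray, add_sub_right_comm, inner_add_right, inner_smul_right] at h1
    · obtain ⟨a', ha'⟩ := exists_map_eq hw a
      refine hξ' a' ?_
      have h1 := ha' (x' + (1 : ℝ) • ξ')
      rw [hwray, one_smul, one_smul, val_add, val_add, ha' x', ← h0] at h1
      linarith
  obtain ⟨m, hm⟩ := hfg
  obtain ⟨t, ht0, ht⟩ := ((Filter.eventually_ge_atTop 0).and
    (eventually_deep (finite_posNormals hW ξ) hpos (w x') (max m (b.level + 1)))).exists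
  obtain ⟨u, hu, hug⟩ := hT (hRT (mem_image_of_mem h (hray t ht0))).2
  rw [(hwS _ (hray t ht0)).1, hwray, hm _ fun c hc => (le_max_left _ _).trans (ht c hc)] at hug
  rw [B.injective g hg hug, mem_half, val_opp, val] at hu
  have := (le_max_right _ _).trans (ht b.normal hb)
  linarith

/-- A sequence of charts running through all apartments that are needed to cover the building. -/
theorem exists_charts_cover (hW : IsAffineWeylGroup W) (hB : B.IsComplete)
    (hfin : B.IsLocallyFinite) (hξ : ∀ a : AffineRoot W, ⟪a.normal, ξ⟫ ≠ 0) {f : E → X}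
    (hf : f ∈ B.charts) : ∃ e : ℕ → E → X,
      (∀ n, e n ∈ {g | g ∈ B.charts ∧ AgreeOn (posNormals W ξ) f g}) ∧ ⋃ n, range (e n) = univ := by
  obtain ⟨y₀, hy₀, -⟩ := exists_generic_cell hW (0 : E)
  obtain ⟨s, hs⟩ := (countable_chambers hW hfin).exists_eq_range
    ⟨_, f, hf, _, cell_mem_modelChambers hy₀, rfl⟩
  have h : ∀ n, ∃ g, (g ∈ B.charts ∧ AgreeOn (posNormals W ξ) f g) ∧ s n ⊆ range g := by
    intro n
    have hn : s n ∈ B.chambers := hs ▸ mem_range_self n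
    obtain ⟨f', hf', _, ⟨y, hy, rfl⟩, hsn⟩ := hn
    obtain ⟨g, hg, hgf, hfg⟩ := exists_chart_chamber hW hB hξ hf hf' hy
    exact ⟨g, ⟨hg, hgf.symm⟩, hsn ▸ hfg⟩
  choose e he hes using h
  refine ⟨e, he, eq_univ_of_forall fun p => ?_⟩
  obtain ⟨f', hf', x, rfl⟩ := B.cover p
  obtain ⟨y, hy, hxy⟩ := exists_generic_cell hW x
  have hc : f' '' cell W y ∈ B.chambers := ⟨f', hf', _, cell_mem_modelChambers hy, rfl⟩
  rw [hs] at hc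
  obtain ⟨n, hn⟩ := hc
  exact mem_iUnion.2 ⟨n, hes n (hn ▸ mem_image_of_mem f' hxy)⟩

/-- The closure of the complement of an admissible union of half spaces. -/
theorem exists_family_closure_compl [Nontrivial E] (hW : IsAffineWeylGroup W)
    (hξ : ∀ a : AffineRoot W, ⟪a.normal, ξ⟫ ≠ 0) {S : Set (E → X)} {g : E → X}
    (hadm : Admissible (posHalves W ξ) S g) :
    ∃ 𝓑 : Set (AffineRoot W), (∀ b ∈ 𝓑, b.normal ∈ posNormals W ξ) ∧
      _root_.closure {x | ∃ h ∈ S, h x = g x}ᶜ = {x | ∀ b ∈ 𝓑, x ∈ b.opp.half} := by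
  rcases ({x | ∃ h ∈ S, h x = g x}ᶜ).eq_empty_or_nonempty with hempty | ⟨y, hy⟩
  -- If nothing is left over, the empty set is obtained as the intersection of all roots with normal
  -- `-c.normal`, whose levels are unbounded.
  · obtain ⟨c, hc⟩ : ∃ c : AffineRoot W, 0 < ⟪c.normal, ξ⟫ := by
      obtain ⟨a⟩ := exists_root hW
      rcases (hξ a).lt_or_gt with h | h
      · exact ⟨a.opp, by simpa [opp] using h⟩
      · exact ⟨a, h⟩
    refine ⟨{b | b.normal = c.normal}, fun b hb => hb ▸ ⟨mem_range_self c, hc⟩, ?_⟩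
    rw [hempty, closure_empty, eq_comm, eq_empty_iff_forall_notMem]
    intro x hx
    obtain ⟨b, hb, hM⟩ := exists_level_ge hW c.opp (1 - ⟪c.normal, x⟫)
    have h1 := hx b.opp (by simp [opp, hb])
    rw [opp_opp, mem_half, val, hb] at h1
    simp only [opp, inner_neg_left] at h1
    linarith
  -- Here `univ` cannot occur in `hadm`, so the complement is the intersection of the open half
  -- spaces opposite to the roots on which `g` equals a member of `S`.
  · refine ⟨{b | b.normal ∈ posNormals W ξ ∧ ∃ h ∈ S, EqOn h g b.half}, fun b hb => hb.1, ?_⟩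
    have hRc : {x | ∃ h ∈ S, h x = g x}ᶜ = {x | ∀ b ∈ {b : AffineRoot W |
        b.normal ∈ posNormals W ξ ∧ ∃ h ∈ S, EqOn h g b.half}, b.val x < 0} := by
      ext x
      constructor
      · rintro hx b ⟨-, h, hh, hhg⟩
        by_contra hbx
        exact hx ⟨h, hh, hhg (mem_half.2 (not_lt.1 hbx))⟩
      · rintro hx ⟨h, hh, hhx⟩
        obtain ⟨k, hk, β, rfl | ⟨b, hb, rfl⟩, hxβ, hkg⟩ := hadm h hh x hhx
        · exact hy ⟨k, hk, hkg (mem_univ y)⟩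
        · exact absurd (hx b ⟨hb, k, hk, hkg⟩) (not_lt.2 (mem_half.1 hxβ))
    rw [hRc] at hy ⊢
    exact closure_iInter_neg hy

end AffineBuilding

end Directed

/-! ### Assembling the directed covering. -/

theorem mainTheorem5 {E : Type*} [NormedAddCommGroup E] [InnerProductSpace ℝ E]
    [FiniteDimensional ℝ E] [Nontrivial E]
    (W : Subgroup (E ≃ᵃⁱ[ℝ] E)) (hW : IsAffineWeylGroup W)
    {X : Type*} (B : AffineBuilding W X) (hcomplete : B.IsComplete)
    (hfin : B.IsLocallyFinite) (hmoufang : B.IsMoufang)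
    (C : Set (Set X)) (hC : C ∈ B.chambersAtInfinity) :
    ∃ A : ℕ → Set X, B.IsDirected C A ∧ ⋃ i, A i = univ := by
  obtain ⟨_, ⟨f, hf, _, ⟨x₀, ξ, hξ, rfl⟩, rfl⟩, rfl⟩ := hC
  obtain ⟨e, he, hcover⟩ := B.exists_charts_cover hW hcomplete hfin hξ hf
  obtain ⟨Good, hG⟩ := B.exists_isGrowth hW hcomplete hξ hf
  obtain ⟨A, hA, hadm, hAe⟩ := hG.exists_sequence (Or.inl rfl) e he
  refine ⟨fun j => range (A j), ⟨fun j => ⟨A j, (hA j).1, rfl⟩, fun j => ?_⟩, ?_⟩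
  · obtain ⟨𝓑, h𝓑, hcl⟩ := AffineBuilding.exists_family_closure_compl hW hξ (hadm j)
    refine ⟨{H | ∃ b ∈ 𝓑, H = A j '' b.opp.half}, ?_, ?_⟩
    · rintro _ ⟨b, hb, rfl⟩
      exact ⟨⟨A j, (hA j).1, rfl, b.opp, rfl⟩,
        B.not_containsAtInfinity hW hf (hA j).1 (hA j).2 x₀ (h𝓑 b hb)⟩
    -- Charts of the family agree wherever their images meet, so removing earlier apartments amounts
    -- to removing agreement loci in the coordinates of `A j`.
    · have hdiff : range (A j) \ ⋃ i < j, range (A i) =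
          A j '' {x | ∃ h ∈ {k | ∃ i < j, A i = k}, h x = A j x}ᶜ := by
        ext p
        constructor
        · rintro ⟨⟨x, rfl⟩, hx⟩
          refine ⟨x, ?_, rfl⟩
          rintro ⟨_, ⟨i, hi, rfl⟩, hix⟩
          exact hx (mem_iUnion₂.2 ⟨i, hi, x, hix⟩)
        · rintro ⟨x, hx, rfl⟩
          refine ⟨mem_range_self x, fun hmem => hx ?_⟩
          obtain ⟨i, hi, hxi⟩ := mem_iUnion₂.1 hmem
          exact ⟨A i, ⟨i, hi, rfl⟩, (AffineBuilding.eq_of_mem_range_of_agreeOn hW (hA j).1 (hA i).1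
            ((hA j).2.symm.trans (hA i).2) hxi).symm⟩
      rw [hdiff, AffineBuilding.closure_image hW (hA j).1, hcl]
      ext p
      constructor
      · rintro ⟨x, hx, rfl⟩
        refine ⟨mem_range_self x, ?_⟩
        rintro _ ⟨b, hb, rfl⟩
        exact mem_image_of_mem _ (hx b hb)
      · rintro ⟨⟨x, rfl⟩, hx⟩
        refine ⟨x, fun b hb => ?_, rfl⟩
        exact ((B.injective _ (hA j).1).mem_set_image).1 (hx _ ⟨b, hb, rfl⟩)
  · rw [eq_univ_iff_forall] at hcover ⊢
    intro p
    obtain ⟨n, hn⟩ := mem_iUnion.1 (hcover p)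
    obtain ⟨j, hj⟩ := hAe n
    exact mem_iUnion.2 ⟨j, hj ▸ hn⟩
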